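/- Notation. Write $x=(x_1,x')\in\mathbb R^3_+=\{x_1>0\}$, $\xi\in\mathbb R^3$, $\langle\xi\rangle=1+|\xi|$. Fix $\sigma_0,\rho_\infty,T_\infty>0$ and $u_\infty=(u_{\infty,1},0,0)$ with Mach number $\mathcal M_\infty=u_{\infty,1}/\sqrt{5T_\infty/3}<-1$. Let $M[\rho,u,T](\xi)=\frac{\rho}{(2\pi T)^{3/2}}e^{-|\xi-u|^2/(2T)}$, $M_\infty=M[\rho_\infty,u_\infty,T_\infty]$, $W_0=M[1,u_\infty,T_\infty]^{1/2}$, and let $$Q(F,G)=\tfrac12\int_{\mathbb R^3\times S^2}\big(F(\xi')G(\xi_*')+F(\xi_*')G(\xi')-F(\xi)G(\xi_*)-F(\xi_*)G(\xi)\big)\,\sigma_0|(\xi-\xi_*)\cdot\omega|\,d\xi_*d\omega,$$ with $\xi'=\xi-[(\xi-\xi_*)\cdot\omega]\omega$, $\xi'_*=\xi_*+[(\xi-\xi_*)\cdot\omega]\omega$, be the hard-sphere collision operator. Put $Lf=W_0^{-1}\{Q(M_\infty,W_0f)+Q(W_0f,M_\infty)\}$, $\Gamma(f,g)=W_0^{-1}Q(W_0f,W_0g)$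 and $\Gamma(f)=\Gamma(f,f)$. Let $\|f\|_{L^\infty_\beta}=\operatorname{ess\,sup}\langle\xi\rangle^\beta|f|$, write $\|\cdot\|$ and $\|\cdot\|_\beta$ for the norms of $L^2$ and $L^\infty_\beta$ on $\mathbb R^3_+\times\mathbb R^3$, and let $X(-\infty,0,\beta)$ be the set of $g\in L^\infty(\mathbb R;L^\infty_\beta)\cap C(\mathbb R;L^2)$ with $|||g|||_{-\infty,0,\beta}=\sup_{t\in\mathbb R}(\|g(t)\|+\|g(t)\|_\beta)<\infty$. Data. Let $\beta>7/2$ and $R,\gamma_0,M_0>0$; let $0\le\varphi\in C^\infty$ with $\varphi(s)=1$ for $s\le1$ and $\varphi(s)=0$ for $s\ge2$, and set $\varphi_R(x')=\varphi(|x'|/R)$. Let $|a_0(\xi)|\le\tilde\delta\langle\xi\rangle^{-\beta}$ and let $\tilde f(x_1,\xi)$ be a distributional solution of $\xi_1\partial_{x_1}\tilde f-L\tilde f=\Gamma(\tilde f)$ for $x_1>0$, with $\tilde f(0,\xi)=a_0(\xi)$ for $\xi_1>0$ and $|\tilde f|\le\tilde\delta M_0e^{-\gamma_0x_1}\langle\xi\rangle^{-\beta}$.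 The boundary data $f_b$ are of one of two kinds. Norms of tuples are sums of the norms of the entries. (a) Time-independent: $f_b^s=f_b-\varphi_Ra_0$ satisfies $\langle\xi\rangle f_b^s\in L^2(\mathbb R^2\times\mathbb R^3)$ and $f_b^s\in L^\infty_\beta(\mathbb R^2\times\mathbb R^3)$. Then $U(x,\xi)=\varphi(x_1)F_b(x,\xi)$, where $F_b(x,\xi)=f_b^s(x_2-x_1\xi_2/\xi_1,\,x_3-x_1\xi_3/\xi_1,\,\xi)$ for $\xi_1>0$ and $F_b=0$ for $\xi_1\le0$, and $\delta=\tilde\delta+\|\langle\xi\rangle f_b^s\|_{L^2}+\|f_b^s\|_{L^\infty_\beta}$. (b) Time-periodic: $f_b^*=f_b-\varphi_Ra_0$ has period $T^*$ in $t$; $\langle\xi\rangle f_b^*,\ \partial_tf_b^*,\ \langle\xi\rangle\nabla_{x'}f_b^*\in C(\mathbb R;L^2(\mathbb R^2\times\mathbb R^3))$; and $f_b^*,\ \langle\xi\rangle^{-1}\partial_tf_b^*,\ \nabla_{x'}f_b^*\in L^\infty(\mathbb R;L^\infty_\beta(\mathbb R^2\times\mathbb R^3))$. Then $U(t,x,\xi)=\varphi(x_1)f_b^*(t,x',\xi)$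 and $$\delta=\tilde\delta+\sup_{0\le t\le T^*}\big\{\|(\langle\xi\rangle f_b^*,\partial_tf_b^*,\langle\xi\rangle\nabla_{x'}f_b^*)(t)\|_{L^2}+\|(f_b^*,\langle\xi\rangle^{-1}\partial_tf_b^*,\nabla_{x'}f_b^*)(t)\|_{L^\infty_\beta}\big\}.$$ In both cases set $$H=-\Gamma(\varphi_R^{1/2}\tilde f)-\sum_{i=2}^3\xi_i(\partial_{x_i}\varphi_R)\tilde f-\partial_tU-\xi\cdot\nabla_xU+LU+\Gamma(\varphi_R\tilde f+U).$$ In case (a), $\partial_tU+\xi\cdot\nabla_xU$ means $F_b\,\xi_1\varphi'(x_1)$. Solutions. For $\sigma>0$, a time-periodic solution with period $T^*$ is a $g\in X(-\infty,0,\beta)$ with $g(t+T^*)=g(t)$ for all $t$ such that, for every $\phi\in C^1_0(\mathbb R\times\overline{\mathbb R^3_+}\times\mathbb R^3)$ with $\phi(t,0,x',\xi)=0$ for $\xi_1<0$, $$(g,\partial_t\phi)+(g,\xi\cdot\nabla_x\phi)+(\sigma\xi_1g+Lg,\phi)=-\big(e^{-\sigma x_1}\Gamma(g)+2\Gamma(\varphi_R\tilde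 f+U,g)+e^{\sigma x_1}H,\ \phi\big)$$ in $L^2_{t,x,\xi}$. This is the distributional form of $\partial_tg+\xi\cdot\nabla_xg-\sigma\xi_1g-Lg=e^{-\sigma x_1}\Gamma(g)+2\Gamma(\varphi_R\tilde f+U,g)+e^{\sigma x_1}H$ with $g=0$ at $x_1=0$, $\xi_1>0$. Proposition. Given $\sigma_0,\rho_\infty,u_\infty,T_\infty,\beta,R,\varphi,\gamma_0,M_0$ as above, there is $\sigma_1\in(0,\gamma_0/2]$ such that for every $\sigma\in(0,\sigma_1]$ there is $\eta_0>0$, independent of the period $T^*$ and of $\tilde\delta,a_0,\tilde f,f_b$, with the following property. For every $T^*>0$ and all data as above, if $g^*$ and $g^\#$ are time-periodic solutions with period $T^*$ satisfying $$\delta+|||g^*|||_{-\infty,0,\beta}\le\eta_0,\qquad \delta+|||g^\#|||_{-\infty,0,\beta}\le\eta_0,$$ then $g^*=g^\#$. -/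

import Mathlib

open MeasureTheory Filter Topology
open scoped ENNReal

noncomputable section

namespace HalfSpaceBoltzmann

/-- Three-dimensional Euclidean space, for positions and velocities. Coordinates `0, 1, 2` of the
code are the coordinates `1, 2, 3` of the mathematics. -/
abbrev V3 := EuclideanSpace ℝ (Fin 3)

/-- The tangential plane. -/
abbrev V2 := EuclideanSpace ℝ (Fin 2)

/-- The tangential part `x' = (x₂, x₃)` of `x = (x₁, x₂, x₃)`. -/
def tang (x : V3) : V2 := !₂[x 1, x 2]

/-- The weight `⟨ξ⟩ = 1 + |ξ|`. -/
def wt (ξ : V3) : ℝ := 1 + ‖ξ‖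

/-! ### The gas and the collision operator -/

/-- Hard-sphere constant `σ₀` and far-field state `(ρ∞, u∞, T∞)`. -/
structure Gas where
  sigma : ℝ
  rho : ℝ
  u : V3
  temp : ℝ

/-- The Mach number of the far field. -/
def Gas.mach (G : Gas) : ℝ := G.u 0 / √(5 * G.temp / 3)

structure Gas.Admissible (G : Gas) : Prop where
  sigma_pos : 0 < G.sigma
  rho_pos : 0 < G.rho
  temp_pos : 0 < G.temp
  u_one : G.u 1 = 0
  u_two : G.u 2 = 0
  mach_lt : G.mach < -1

/-- The Maxwellian `M[ρ, u, T]`. -/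
def maxwellian (ρ : ℝ) (u : V3) (T : ℝ) (ξ : V3) : ℝ :=
  ρ / (2 * Real.pi * T) ^ (3 / 2 : ℝ) * Real.exp (-(‖ξ - u‖ ^ 2 / (2 * T)))

/-- The far-field Maxwellian `M∞`. -/
def Gas.minf (G : Gas) : V3 → ℝ := maxwellian G.rho G.u G.temp

/-- The weight function `W₀ = M[1, u∞, T∞]^{1/2}`. -/
def Gas.w0 (G : Gas) (ξ : V3) : ℝ := √(maxwellian 1 G.u G.temp ξ)

/-- Post-collisional velocity `ξ'`. -/
def post (ξ ξs w : V3) : V3 := ξ - (inner ℝ (ξ - ξs) w : ℝ) • w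

/-- Post-collisional velocity `ξ'_*`. -/
def postStar (ξ ξs w : V3) : V3 := ξs + (inner ℝ (ξ - ξs) w : ℝ) • w

/-- The hard-sphere collision operator `Q(F, G)`; the unit sphere carries its surface measure. -/
def Gas.Q (G : Gas) (F K : V3 → ℝ) (ξ : V3) : ℝ :=
  (1 / 2) * ∫ p : V3 × Metric.sphere (0 : V3) 1,
    (F (post ξ p.1 p.2) * K (postStar ξ p.1 p.2) + F (postStar ξ p.1 p.2) * K (post ξ p.1 p.2)
      - F ξ * K p.1 - F p.1 * K ξ) * (G.sigma * |(inner ℝ (ξ - p.1) (p.2 : V3) : ℝ)|)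
    ∂((volume : Measure V3).prod (volume : Measure V3).toSphere)

/-- `Γ(f, k) = W₀⁻¹ Q(W₀ f, W₀ k)`. -/
def Gas.Gam (G : Gas) (f k : V3 → ℝ) (ξ : V3) : ℝ :=
  (G.w0 ξ)⁻¹ * G.Q (fun v => G.w0 v * f v) (fun v => G.w0 v * k v) ξ

/-- The linearized operator `L f = W₀⁻¹ (Q(M∞, W₀ f) + Q(W₀ f, M∞))`. -/
def Gas.Lin (G : Gas) (f : V3 → ℝ) (ξ : V3) : ℝ :=
  (G.w0 ξ)⁻¹ * (G.Q G.minf (fun v => G.w0 v * f v) ξ + G.Q (fun v => G.w0 v * f v) G.minf ξ)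

/-! ### Norms and the solution space -/

/-- The norm of `L^∞_β(X × ℝ³)`: essential supremum of `⟨ξ⟩^β |f|`. -/
def velSup {X E : Type*} [MeasurableSpace X] [NormedAddCommGroup E] [NormedSpace ℝ E]
    (μ : Measure (X × V3)) (β : ℝ) (f : X × V3 → E) : ℝ≥0∞ :=
  eLpNorm (fun p => (wt p.2 ^ β) • f p) ⊤ μ

/-- Lebesgue measure on the phase space `ℝ³₊ × ℝ³`. -/
def phase : Measure (V3 × V3) := volume.restrict {p | 0 < p.1 0}

/-- The norm of `X(-∞, 0, β)`: the supremum over `t ∈ ℝ` of the sum of the `L²` norm and the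
`L^∞_β` norm of `g(t)`. -/
def normX (β : ℝ) (g : ℝ → Lp ℝ 2 phase) : ℝ≥0∞ :=
  ⨆ t : ℝ, (eLpNorm (g t) 2 phase + velSup phase β (g t))

/-- Membership in `X(-∞, 0, β) ⊂ L^∞(ℝ; L^∞_β) ∩ C(ℝ; L²)`. -/
def InX (β : ℝ) (g : ℝ → Lp ℝ 2 phase) : Prop :=
  Continuous g ∧ normX β g < ⊤

/-- `F ∈ C(ℝ; L²(μ))`. -/
def ContinuousInL2 {X E : Type*} [MeasurableSpace X] [NormedAddCommGroup E]
    (μ : Measure X) (F : ℝ → X → E) : Prop :=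
  (∀ t, MemLp (F t) 2 μ) ∧
    ∀ t₀, Tendsto (fun t => eLpNorm (fun p => F t p - F t₀ p) 2 μ) (𝓝 t₀) (𝓝 0)

/-- `F ∈ L^∞(ℝ; L^∞_β)`. -/
def BoundedInVelSup {X E : Type*} [MeasurableSpace X] [NormedAddCommGroup E] [NormedSpace ℝ E]
    (μ : Measure (X × V3)) (β : ℝ) (F : ℝ → X × V3 → E) : Prop :=
  ∃ C : ℝ, ∀ᵐ t : ℝ, velSup μ β (F t) ≤ ENNReal.ofReal C

/-! ### The fixed parameters and the cutoff -/

/-- Gas parameters, velocity exponent `β`, cutoff radius `R` and cutoff function `φ`. -/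
structure Frame where
  gas : Gas
  beta : ℝ
  R : ℝ
  cut : ℝ → ℝ

structure Frame.Admissible (S : Frame) : Prop where
  gas : S.gas.Admissible
  beta_gt : 7 / 2 < S.beta
  R_pos : 0 < S.R
  cut_smooth : ContDiff ℝ (⊤ : ℕ∞) S.cut
  cut_nonneg : ∀ s, 0 ≤ S.cut s
  cut_one : ∀ s, s ≤ 1 → S.cut s = 1
  cut_zero : ∀ s, 2 ≤ s → S.cut s = 0

/-- The tangential cutoff `φ_R(x') = φ(|x'| / R)`. -/
def Frame.cutR (S : Frame) (y : V2) : ℝ := S.cut (‖y‖ / S.R)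

/-! ### The slab-symmetric stationary profile -/

/-- The size `δ̃`, the incoming data `a₀` and the profile `f̃(x₁, ξ)`. -/
structure Profile where
  dtil : ℝ
  a0 : V3 → ℝ
  ftil : ℝ × V3 → ℝ

/-- Lebesgue measure on `ℝ₊ × ℝ³`. -/
def slab : Measure (ℝ × V3) := volume.restrict {p | 0 < p.1}

/-- `ξ₁ ∂_{x₁} f̃ - L f̃ = Γ(f̃, f̃)` for `x₁ > 0` and `f̃(0, ξ) = a₀(ξ)` for `ξ₁ > 0`, in the sense
of distributions (test functions up to the boundary that vanish at `x₁ = 0`, `ξ₁ < 0`). -/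
def IsSlabSolution (G : Gas) (a0 : V3 → ℝ) (f : ℝ × V3 → ℝ) : Prop :=
  ∀ ψ : ℝ × V3 → ℝ, ContDiff ℝ 1 ψ → HasCompactSupport ψ →
    (∀ ξ : V3, ξ 0 < 0 → ψ (0, ξ) = 0) →
    (∫ p, p.2 0 * f p * fderiv ℝ ψ p (1, 0) ∂slab)
      + (∫ p, (G.Lin (fun v => f (p.1, v)) p.2
          + G.Gam (fun v => f (p.1, v)) (fun v => f (p.1, v)) p.2) * ψ p ∂slab)
      + (∫ ξ in {ξ : V3 | 0 < ξ 0}, ξ 0 * a0 ξ * ψ (0, ξ)) = 0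

/-- `f̃` is a stationary slab solution with incoming data `a₀`, where `|a₀| ≤ δ̃ ⟨ξ⟩^{-β}` and
`|f̃| ≤ δ̃ M₀ e^{-γ₀ x₁} ⟨ξ⟩^{-β}`; the last bound contains the condition `f̃ → 0` at infinity. -/
structure Profile.Admissible (P : Profile) (S : Frame) (γ₀ M₀ : ℝ) : Prop where
  a0_measurable : Measurable P.a0
  a0_bound : ∀ ξ, |P.a0 ξ| ≤ P.dtil * wt ξ ^ (-S.beta)
  ftil_measurable : Measurable P.ftil
  ftil_solution : IsSlabSolution S.gas P.a0 P.ftil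
  ftil_bound : ∀ᵐ p ∂slab,
    |P.ftil p| ≤ P.dtil * M₀ * Real.exp (-(γ₀ * p.1)) * wt p.2 ^ (-S.beta)

/-! ### Boundary data -/

/-- Boundary data `f_b`, either time-independent or time-periodic. In the second case `dt` and
`grad` stand for `∂_t` and `∇_{x'}` of `f_b - φ_R a₀`; that they are these distributional
derivatives is part of `BoundaryData.Admissible`. -/
inductive BoundaryData where
  | stationary (fb : V2 × V3 → ℝ)
  | periodic (fb : ℝ → V2 × V3 → ℝ) (dt : ℝ → V2 × V3 → ℝ) (grad : ℝ → V2 × V3 → V2)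

/-- `f - φ_R(x') a₀(ξ)`, which gives `f_b^s` and `f_b^*`. -/
def pert (S : Frame) (P : Profile) (f : V2 × V3 → ℝ) (p : V2 × V3) : ℝ :=
  f p - S.cutR p.1 * P.a0 p.2

/-- `dt = ∂_t f` and `grad = ∇_{x'} f` in the sense of distributions on `ℝ × ℝ² × ℝ³`. -/
def IsWeakDerivative (f dt : ℝ → V2 × V3 → ℝ) (grad : ℝ → V2 × V3 → V2) : Prop :=
  ∀ ψ : ℝ × V2 × V3 → ℝ, ContDiff ℝ (⊤ : ℕ∞) ψ → HasCompactSupport ψ →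
    (∫ z, f z.1 z.2 * fderiv ℝ ψ z (1, 0, 0) = - ∫ z, dt z.1 z.2 * ψ z) ∧
    ∀ e : V2, ∫ z, f z.1 z.2 * fderiv ℝ ψ z (0, e, 0)
      = - ∫ z, (inner ℝ (grad z.1 z.2) e : ℝ) * ψ z

structure StationaryAdmissible (β : ℝ) (f : V2 × V3 → ℝ) : Prop where
  meas : Measurable f
  memL2 : MemLp (fun p => wt p.2 * f p) 2 volume
  memSup : velSup volume β f < ⊤

structure PeriodicAdmissible (β T : ℝ) (f dt : ℝ → V2 × V3 → ℝ) (grad : ℝ → V2 × V3 → V2) :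
    Prop where
  meas : Measurable (Function.uncurry f)
  meas_dt : Measurable (Function.uncurry dt)
  meas_grad : Measurable (Function.uncurry grad)
  weak : IsWeakDerivative f dt grad
  periodic : ∀ t, f (t + T) =ᵐ[volume] f t
  contL2 : ContinuousInL2 volume (fun t p => wt p.2 * f t p)
  contL2_dt : ContinuousInL2 volume dt
  contL2_grad : ContinuousInL2 volume (fun t p => wt p.2 • grad t p)
  bdd : BoundedInVelSup volume β f
  bdd_dt : BoundedInVelSup volume β (fun t p => (wt p.2)⁻¹ * dt t p)
  bdd_grad : BoundedInVelSup volume β grad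

/-- The regularity required of the boundary data; `T` is the period. -/
def BoundaryData.Admissible (B : BoundaryData) (S : Frame) (P : Profile) (T : ℝ) : Prop :=
  match B with
  | .stationary fb => StationaryAdmissible S.beta (pert S P fb)
  | .periodic fb dt grad => PeriodicAdmissible S.beta T (fun t => pert S P (fb t)) dt grad

/-- The size `δ` of the data: `δ^s` or `δ^*`. -/
def BoundaryData.delta (B : BoundaryData) (S : Frame) (P : Profile) (T : ℝ) : ℝ≥0∞ :=
  match B with
  | .stationary fb =>
      ENNReal.ofReal P.dtil + eLpNorm (fun p : V2 × V3 => wt p.2 * pert S P fb p) 2 volume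
        + velSup volume S.beta (pert S P fb)
  | .periodic fb dt grad =>
      ENNReal.ofReal P.dtil + ⨆ t ∈ Set.Icc 0 T,
        (eLpNorm (fun p : V2 × V3 => wt p.2 * pert S P (fb t) p) 2 volume
          + eLpNorm (dt t) 2 volume
          + eLpNorm (fun p : V2 × V3 => wt p.2 • grad t p) 2 volume
          + velSup volume S.beta (pert S P (fb t))
          + velSup volume S.beta (fun p => (wt p.2)⁻¹ * dt t p)
          + velSup volume S.beta (grad t))

/-- `F_b(x, ξ) = χ(ξ₁) f_b^s(x₂ - x₁ ξ₂ / ξ₁, x₃ - x₁ ξ₃ / ξ₁, ξ)`, `χ` being the indicator function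
of the positive half-line. -/
def freeExt (f : V2 × V3 → ℝ) (x ξ : V3) : ℝ :=
  if 0 < ξ 0 then f (tang x - (x 0 / ξ 0) • tang ξ, ξ) else 0

/-- The extension `U` of the boundary data: `U^s = φ(x₁) F_b` or `U^* = φ(x₁) f_b^*(t, x', ξ)`. -/
def BoundaryData.U (B : BoundaryData) (S : Frame) (P : Profile) (t : ℝ) (x ξ : V3) : ℝ :=
  match B with
  | .stationary fb => S.cut (x 0) * freeExt (pert S P fb) x ξ
  | .periodic fb _ _ => S.cut (x 0) * pert S P (fb t) (tang x, ξ)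

/-- `∂_t U + ξ · ∇_x U`, written out for both kinds of boundary data. -/
def BoundaryData.transportU (B : BoundaryData) (S : Frame) (P : Profile) (t : ℝ) (x ξ : V3) : ℝ :=
  match B with
  | .stationary fb => freeExt (pert S P fb) x ξ * ξ 0 * deriv S.cut (x 0)
  | .periodic fb dt grad =>
      S.cut (x 0) * dt t (tang x, ξ)
        + ξ 0 * deriv S.cut (x 0) * pert S P (fb t) (tang x, ξ)
        + S.cut (x 0) * (inner ℝ (tang ξ) (grad t (tang x, ξ)) : ℝ)

/-- The background `φ_R f̃ + U`. -/
def BoundaryData.background (B : BoundaryData) (S : Frame) (P : Profile) (t : ℝ) (x ξ : V3) : ℝ :=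
  S.cutR (tang x) * P.ftil (x 0, ξ) + B.U S P t x ξ

/-- The inhomogeneous term
`H = -Γ(φ_R^{1/2} f̃) - ∑_{i=2,3} ξ_i (∂_{x_i} φ_R) f̃ - (∂_t + ξ · ∇_x) U + L U + Γ(φ_R f̃ + U)`. -/
def BoundaryData.H (B : BoundaryData) (S : Frame) (P : Profile) (t : ℝ) (x ξ : V3) : ℝ :=
  - S.gas.Gam (fun v => √(S.cutR (tang x)) * P.ftil (x 0, v))
      (fun v => √(S.cutR (tang x)) * P.ftil (x 0, v)) ξ
    - fderiv ℝ S.cutR (tang x) (tang ξ) * P.ftil (x 0, ξ)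
    - B.transportU S P t x ξ
    + S.gas.Lin (B.U S P t x) ξ
    + S.gas.Gam (B.background S P t x) (B.background S P t x) ξ

/-! ### Time-periodic solutions -/

/-- Test functions: `C¹` with compact support in `ℝ × closure ℝ³₊ × ℝ³` (given as restrictions of
such functions on the whole space), vanishing at `x₁ = 0`, `ξ₁ < 0`. -/
structure IsTest (ψ : ℝ × V3 × V3 → ℝ) : Prop where
  contDiff : ContDiff ℝ 1 ψ
  compact : HasCompactSupport ψ
  vanish : ∀ (t : ℝ) (x ξ : V3), x 0 = 0 → ξ 0 < 0 → ψ (t, x, ξ) = 0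

/-- The `L²_{t,x,ξ}` inner product over `ℝ × ℝ³₊ × ℝ³`. -/
def pairing (F : ℝ → V3 → V3 → ℝ) (ψ : ℝ × V3 × V3 → ℝ) : ℝ :=
  ∫ t : ℝ, ∫ p, F t p.1 p.2 * ψ (t, p.1, p.2) ∂phase

/-- `g` as a function of `(t, x, ξ)`. -/
def valAt (g : ℝ → Lp ℝ 2 phase) (t : ℝ) (x ξ : V3) : ℝ := g t (x, ξ)

/-- Time-periodic solutions with period `T`, in the sense of distributions, of
`∂_t g + ξ · ∇_x g - σ ξ₁ g - L g = e^{-σ x₁} Γ(g) + 2 Γ(φ_R f̃ + U, g) + e^{σ x₁} H`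
with `g = 0` at `x₁ = 0`, `ξ₁ > 0`. -/
structure IsTimePeriodicSolution (S : Frame) (P : Profile) (B : BoundaryData) (σ T : ℝ)
    (g : ℝ → Lp ℝ 2 phase) : Prop where
  mem : InX S.beta g
  periodic : ∀ t, g (t + T) = g t
  weak : ∀ ψ : ℝ × V3 × V3 → ℝ, IsTest ψ →
    pairing (valAt g) (fun z => fderiv ℝ ψ z (1, 0, 0))
      + pairing (valAt g) (fun z => fderiv ℝ ψ z (0, z.2.2, 0))
      + pairing (fun t x ξ => σ * ξ 0 * valAt g t x ξ + S.gas.Lin (valAt g t x) ξ) ψ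
    = - (pairing (fun t x ξ => Real.exp (-(σ * x 0)) * S.gas.Gam (valAt g t x) (valAt g t x) ξ
            + 2 * S.gas.Gam (B.background S P t x) (valAt g t x) ξ) ψ
        + pairing (fun t x ξ => Real.exp (σ * x 0) * B.H S P t x ξ) ψ)

end HalfSpaceBoltzmann

end

/-!
The difference `w` of two solutions satisfies, with vanishing incoming data, the linear equation
`(∂ₜ + ξ · ∇ₓ) w = σ ξ₁ w + L w + 2 Γ(h, w)`, where `h = e^{-σ x₁} (g₁ + g₂) / 2 + φ_R f̃ + U` is
small in `L^∞_β`; the inhomogeneous term `H` is the same number in both weak formulations and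
cancels, so nothing has to be known about it. The proof is an energy estimate for `μ w`, with the
velocity weight `μ(ξ) = (1 + ε² |ξ|²)^{-1/2}`. The weight is needed because `L w` and `Γ(h, w)` lose
one power of `⟨ξ⟩` in `L²`, whereas the solutions are only known to be in `L²`.

*Dissipation at a fixed position* (`Gas.Admissible.fiber_estimate`). Supersonic inflow, `u∞,₁ < 0`
and `|u∞,₁|² > 5 T∞ / 3`, makes the flux `∫ ξ₁ f²` negative definite on the kernel of `L`, the
collision invariants times `W₀`: this is a computation with Gaussian moments. Together with the
spectral gap of `L` it gives, for small `σ`, the coercivity `σ ∫ ξ₁ f² + ∫ f L f ≤ -c ∫ ⟨ξ⟩ f²`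
(`Gas.Admissible.coercive`). The spectral gap itself is proved in the Hilbert space of functions on
the collision space. There `-∫ f L f` is a multiple of the squared norm of
`√B W₀(ξ_*) W₀(ξ) (φ + φ_* - φ' - φ'_*)`, with `f = W₀ φ`; a sequence that violates the gap converges
weakly (along a subsequence) to an element of the kernel that is also orthogonal to the kernel, hence to `0`; the nonlocal
part of `L` is weakly continuous because its kernel is bounded by a square integrable convolution
kernel, so its form tends to `0`, whereas the form of the collision frequency does not. An element
of the kernel is a collision invariant almost everywhere; mollification makes it continuous, hence
of the form `α + b · ξ + γ |ξ|²`. The commutator of `μ` with the nonlocal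
part is `O(ε)`, and `Γ(h, ·)` is bounded by the size of `h` in the same weighted spaces, by the
Cauchy–Schwarz inequality and the invariance of the collision measure under
`(ξ, ξ_*) ↦ (ξ', ξ'_*)`.

*Energy inequality for weak solutions* (`WeakTransport.energy_sub_le`). The functions
`χ(t) μ(ξ) ψ(x + (T - t) ξ, ξ)`, with `ψ` supported in the open half-space and `χ` to the left of
`T`, are admissible test functions, and transport only differentiates `χ`. Varying `χ` gives Duhamel's
formula tested against `ψ`, for extensions by zero to the whole space. By density it may be tested
with `μ w(T)` itself, and free transport is a strongly continuous group of isometries of `L²`. Thus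
the left derivative of `‖μ w‖²` is at most `2 ∫ μ² w S ≤ -2 c ‖μ w‖²`, where `S` is the right-hand
side. Since the periodic function `‖μ w‖²` is bounded on the whole time axis, Gronwall's
inequality backwards in time shows that it vanishes (`WeakTransport.f_eq_zero`).
-/

noncomputable section

namespace HalfSpaceBoltzmann

/-! ### Integration over the sphere -/

theorem measurePreserving_coords :
    MeasurePreserving (fun x : V3 => ((x 0, x 1, x 2) : ℝ × ℝ × ℝ)) volume volume := by
  have h1 := PiLp.volume_preserving_ofLp (Fin 3)
  have h2 := volume_preserving_piFinSuccAbove (fun _ : Fin 3 => ℝ) 0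
  have h3 := volume_preserving_finTwoArrow ℝ
  have := ((MeasurePreserving.id (volume : Measure ℝ)).prod h3).comp (h2.comp h1)
  exact this

theorem lintegral_coords (F : ℝ × ℝ × ℝ → ℝ≥0∞) (hF : Measurable F) :
    ∫⁻ x : V3, F (x 0, x 1, x 2) = ∫⁻ s, ∫⁻ y, F (s, y) := by
  rw [measurePreserving_coords.lintegral_comp hF, Measure.volume_eq_prod,
    lintegral_prod _ hF.aemeasurable]

/-- Polar coordinates. -/
theorem lintegral_V3_polar (F : V3 → ℝ≥0∞) (hF : Measurable F) :
    ∫⁻ x, F x = ∫⁻ ω, ∫⁻ r in Set.Ioi (0 : ℝ), ENNReal.ofReal (r ^ 2) * F (r • (ω : V3))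
      ∂volume ∂(volume : Measure V3).toSphere := by
  have h := (volume : Measure V3).measurePreserving_homeomorphUnitSphereProd
  have hd : Module.finrank ℝ V3 - 1 = 2 := by simp
  rw [hd] at h
  have h0 : ∫⁻ x, F x = ∫⁻ x : ({0}ᶜ : Set V3), F x ∂(volume.comap (Subtype.val : ({0}ᶜ : Set V3) → V3)) := by
    rw [lintegral_subtype_comap (measurableSet_singleton (0:V3)).compl, restrict_compl_singleton]
  let e := homeomorphUnitSphereProd V3
  have h1 : ∀ x : ({0}ᶜ : Set V3), F x = F (((e x).2 : ℝ) • ((e x).1 : V3)) := by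
    intro x
    have : (x : V3) = (e.symm (e x) : ({0}ᶜ : Set V3)) := by simp
    conv_lhs => rw [this]
    simp only [e, homeomorphUnitSphereProd_symm_apply_coe]
  have hm : Measurable fun z : Metric.sphere (0:V3) 1 × Set.Ioi (0:ℝ) =>
      F ((z.2 : ℝ) • (z.1 : V3)) := by fun_prop
  rw [h0, lintegral_congr h1, h.lintegral_comp hm, lintegral_prod _ hm.aemeasurable]
  refine lintegral_congr fun ω => ?_
  rw [Measure.volumeIoiPow, lintegral_withDensity_eq_lintegral_mul _ (by fun_prop) (by fun_prop),
    ← lintegral_subtype_comap measurableSet_Ioi]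
  rfl

theorem lintegral_sphere_eq (H : V3 → ℝ≥0∞) (hH : Measurable H) :
    ∫⁻ ω, H ω ∂(volume : Measure V3).toSphere
      = 3 * ∫⁻ x in Metric.ball (0 : V3) 1, H (‖x‖⁻¹ • x) := by
  rw [← lintegral_indicator measurableSet_ball, lintegral_V3_polar _
    (Measurable.indicator (by fun_prop) measurableSet_ball)]
  have key : ∀ ω : Metric.sphere (0:V3) 1, ∫⁻ r in Set.Ioi (0 : ℝ), ENNReal.ofReal (r ^ 2) *
      (Metric.ball (0 : V3) 1).indicator (fun x => H (‖x‖⁻¹ • x)) (r • (ω : V3))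
      = H ω * 3⁻¹ := by
    intro ω
    have hω : ‖(ω : V3)‖ = 1 := by simp
    have : ∀ r ∈ Set.Ioi (0:ℝ), ENNReal.ofReal (r ^ 2) *
      (Metric.ball (0 : V3) 1).indicator (fun x => H (‖x‖⁻¹ • x)) (r • (ω : V3)) =
      H ω * (Set.Iio (1:ℝ)).indicator (fun r => ENNReal.ofReal (r ^ 2)) r := by
      intro r hr
      have hr' : 0 < r := hr
      have hn : ‖r • (ω : V3)‖ = r := by rw [norm_smul, hω, Real.norm_eq_abs, abs_of_pos hr', mul_one]
      by_cases h1 : r < 1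
      · rw [Set.indicator_of_mem (by simpa [hn] using h1), Set.indicator_of_mem (by exact h1), hn,
          smul_smul, inv_mul_cancel₀ hr'.ne', one_smul, mul_comm]
      · rw [Set.indicator_of_notMem (by simpa [hn] using h1), Set.indicator_of_notMem (by exact h1)]
        simp
    rw [setLIntegral_congr_fun measurableSet_Ioi this, lintegral_const_mul _
      (Measurable.indicator (by fun_prop) measurableSet_Iio), lintegral_indicator measurableSet_Iio,
      Measure.restrict_restrict measurableSet_Iio]
    congr 1
    rw [Set.inter_comm, Set.Ioi_inter_Iio, restrict_Ioo_eq_restrict_Ioc, ← ofReal_integral_eq_lintegral_ofReal,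
      ← intervalIntegral.integral_of_le zero_le_one]
    · norm_num [ENNReal.ofReal_div_of_pos]
    · exact (intervalIntegral.intervalIntegrable_pow 2).1
    · exact ae_of_all _ fun r => by positivity
  rw [lintegral_congr key, lintegral_mul_const _ (by fun_prop), mul_comm (∫⁻ _, _ ∂_), ← mul_assoc,
    ENNReal.mul_inv_cancel (by simp) (by simp), one_mul]

theorem lintegral_sphere_comp_isometry (R : V3 ≃ₗᵢ[ℝ] V3) (H : V3 → ℝ≥0∞) (hH : Measurable H) :
    ∫⁻ ω, H (R ω) ∂(volume : Measure V3).toSphere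
      = ∫⁻ ω, H ω ∂(volume : Measure V3).toSphere := by
  rw [lintegral_sphere_eq _ hH, lintegral_sphere_eq (fun x => H (R x)) (by fun_prop)]
  congr 1
  rw [← lintegral_indicator measurableSet_ball, ← lintegral_indicator measurableSet_ball,
    ← R.measurePreserving.lintegral_comp (f := (Metric.ball (0 : V3) 1).indicator
      fun x => H (‖x‖⁻¹ • x)) (Measurable.indicator (by fun_prop) measurableSet_ball)]
  refine lintegral_congr fun x => ?_
  by_cases h : ‖x‖ < 1 <;> simp [Set.indicator, h]

theorem exists_isometry_map (v : V3) (hv : ‖v‖ = 1) :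
    ∃ R : V3 ≃ₗᵢ[ℝ] V3, R (EuclideanSpace.single 0 1) = v :=
  ⟨_, Submodule.reflection_sub (by simp [hv])⟩

/-- A rotation by a right angle maps the upper half-plane to the left one, over which an even function
has the same integral. -/
theorem lintegral_upper_rotate (A : ℝ × ℝ → ℝ≥0∞) (hA : Measurable A)
    (hneg : ∀ z, A (-z) = A z) :
    ∫⁻ z in Set.univ ×ˢ Set.Ioi (0 : ℝ), A z
      = ∫⁻ z in Set.univ ×ˢ Set.Ioi (0 : ℝ), A (-z.2, z.1) := by
  have hm : MeasurableSet ((Set.univ : Set ℝ) ×ˢ Set.Ioi (0 : ℝ)) :=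
    MeasurableSet.univ.prod measurableSet_Ioi
  have half : ∀ A : ℝ × ℝ → ℝ≥0∞, Measurable A → (∀ z, A (-z) = A z) →
      ∫⁻ z, A z = 2 * ∫⁻ z in Set.univ ×ˢ Set.Ioi (0 : ℝ), A z := by
    intro A hA hneg
    rw [← lintegral_add_compl A hm, two_mul]
    congr 1
    have e1 : ((Set.univ : Set ℝ) ×ˢ Set.Ioi (0 : ℝ))ᶜ = Set.univ ×ˢ Set.Iic (0 : ℝ) := by
      ext ⟨a, b⟩; simp
    have e2 : (Set.univ ×ˢ Set.Iic (0 : ℝ) : Set (ℝ × ℝ)) =ᵐ[volume] Set.univ ×ˢ Set.Iio (0 : ℝ) :=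
      by
      rw [Measure.volume_eq_prod]
      exact Measure.set_prod_ae_eq (ae_eq_refl _) Iio_ae_eq_Iic.symm
    rw [e1, setLIntegral_congr e2]
    have hmp : MeasurePreserving (Neg.neg : ℝ × ℝ → ℝ × ℝ) volume volume :=
      Measure.measurePreserving_neg _
    have := hmp.setLIntegral_comp_preimage hm hA
    rw [← this]
    have e3 : (Neg.neg : ℝ × ℝ → ℝ × ℝ) ⁻¹' (Set.univ ×ˢ Set.Ioi (0 : ℝ))
        = Set.univ ×ˢ Set.Iio (0 : ℝ) := by
      ext ⟨a, b⟩; simp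
    rw [e3]
    simp_rw [hneg]
  have hrot : MeasurePreserving (fun z : ℝ × ℝ => (-z.2, z.1)) volume volume :=
    ((Measure.measurePreserving_neg (volume : Measure ℝ)).prod
      (MeasurePreserving.id (volume : Measure ℝ))).comp Measure.measurePreserving_swap
  have h1 := half A hA hneg
  have h2 := half (fun z => A (-z.2, z.1)) (by fun_prop) fun z => by
    rw [← hneg]; simp
  rw [hrot.lintegral_comp hA, h1] at h2
  exact (ENNReal.mul_right_inj (by simp) (by simp)).1 h2

/-- Cylindrical coordinates around the first axis, with the angle as outer variable. -/
theorem lintegral_V3_cylinder (F : V3 → ℝ≥0∞) (hF : Measurable F) :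
    ∫⁻ x, F x = ∫⁻ θ in Set.Ioo (-Real.pi) Real.pi, ∫⁻ z in Set.univ ×ˢ Set.Ioi (0 : ℝ),
      ENNReal.ofReal z.2 * F !₂[z.1, z.2 * Real.cos θ, z.2 * Real.sin θ] := by
  have hvec : Measurable fun w : ℝ × ℝ × ℝ => (!₂[w.1, w.2.1, w.2.2] : V3) := by
    refine (PiLp.continuous_toLp 2 _).measurable.comp ?_
    refine measurable_pi_lambda _ fun i => ?_
    fin_cases i <;> simp <;> fun_prop
  have e1 : ∀ x : V3, F x = (fun w : ℝ × ℝ × ℝ => F !₂[w.1, w.2.1, w.2.2]) (x 0, x 1, x 2) := by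
    intro x
    congr 1
    ext i; fin_cases i <;> rfl
  rw [lintegral_congr e1, lintegral_coords (fun w : ℝ × ℝ × ℝ => F !₂[w.1, w.2.1, w.2.2])
    (hF.comp hvec)]
  have e2 : ∀ s : ℝ, ∫⁻ y : ℝ × ℝ, F !₂[s, y.1, y.2] = ∫⁻ θ in Set.Ioo (-Real.pi) Real.pi,
      ∫⁻ ρ in Set.Ioi (0 : ℝ), ENNReal.ofReal ρ * F !₂[s, ρ * Real.cos θ, ρ * Real.sin θ] := by
    intro s
    rw [← lintegral_comp_polarCoord_symm, polarCoord_target, Measure.volume_eq_prod,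
      ← Measure.prod_restrict, lintegral_prod_symm]
    · rfl
    · simp only [smul_eq_mul, polarCoord_symm_apply]
      refine Measurable.aemeasurable (Measurable.mul (by fun_prop) ?_)
      exact hF.comp (hvec.comp (f := fun w : ℝ × ℝ => (s, w.1 * Real.cos w.2, w.1 * Real.sin w.2))
        (by fun_prop))
  have hG : Measurable fun w : ℝ × ℝ × ℝ =>
      ENNReal.ofReal w.2.2 * F !₂[w.1, w.2.2 * Real.cos w.2.1, w.2.2 * Real.sin w.2.1] := by
    refine Measurable.mul (by fun_prop) ?_
    exact hF.comp (hvec.comp (f := fun w : ℝ × ℝ × ℝ =>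
      (w.1, w.2.2 * Real.cos w.2.1, w.2.2 * Real.sin w.2.1)) (by fun_prop))
  rw [lintegral_congr e2, lintegral_lintegral_swap]
  · refine lintegral_congr fun θ => ?_
    rw [Measure.volume_eq_prod, ← Measure.prod_restrict, lintegral_prod, Measure.restrict_univ]
    exact Measurable.aemeasurable (hG.comp (f := fun w : ℝ × ℝ => (w.1, θ, w.2)) (by fun_prop))
  · refine Measurable.aemeasurable ?_
    exact Measurable.lintegral_prod_right' (f := fun w : (ℝ × ℝ) × ℝ =>
      ENNReal.ofReal w.2 * F !₂[w.1.1, w.2 * Real.cos w.1.2, w.2 * Real.sin w.1.2])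
      (hG.comp (f := fun w : (ℝ × ℝ) × ℝ => (w.1.1, w.1.2, w.2)) (by fun_prop))

/-- The points `(e₁ · ω) ω` and `e₁ - (e₁ · ω) ω` have the same distribution under `|e₁ · ω| dω`: in
cylindrical coordinates `(x₁, r, θ)` the density `|x₁| |r| (x₁² + r²)^{-1/2}` is invariant under the
rotation by a right angle in the plane of `(x₁, r)`. This makes the two
post-collisional velocities interchangeable. -/
theorem lintegral_sphere_exchange_axis (Φ : V3 → ℝ≥0∞) (hΦ : Measurable Φ) :
    ∫⁻ ω : Metric.sphere (0 : V3) 1, ENNReal.ofReal |(ω : V3) 0| * Φ ((ω : V3) 0 • (ω : V3))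
        ∂(volume : Measure V3).toSphere
      = ∫⁻ ω : Metric.sphere (0 : V3) 1, ENNReal.ofReal |(ω : V3) 0| *
        Φ (EuclideanSpace.single 0 1 - (ω : V3) 0 • (ω : V3)) ∂(volume : Measure V3).toSphere := by
  have hm0 : Measurable fun x : V3 => x 0 := by fun_prop
  rw [lintegral_sphere_eq (fun x : V3 => ENNReal.ofReal |x 0| * Φ (x 0 • x)) (by fun_prop),
    lintegral_sphere_eq (fun x : V3 => ENNReal.ofReal |x 0| *
      Φ (EuclideanSpace.single 0 1 - x 0 • x)) (by fun_prop)]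
  congr 1
  rw [← lintegral_indicator measurableSet_ball, ← lintegral_indicator measurableSet_ball,
    lintegral_V3_cylinder _ (Measurable.indicator (by fun_prop) measurableSet_ball),
    lintegral_V3_cylinder _ (Measurable.indicator (by fun_prop) measurableSet_ball)]
  refine lintegral_congr fun θ => ?_
  have hn : ∀ z : ℝ × ℝ, ‖(!₂[z.1, z.2 * Real.cos θ, z.2 * Real.sin θ] : V3)‖
      = √(z.1 ^ 2 + z.2 ^ 2) := by
    intro z
    rw [EuclideanSpace.norm_eq]
    congr 1
    simp [Fin.sum_univ_three]
    linear_combination z.2 ^ 2 * Real.cos_sq_add_sin_sq θ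
  have hvec : Continuous fun z : ℝ × ℝ => (!₂[z.1, z.2 * Real.cos θ, z.2 * Real.sin θ] : V3) := by
    refine (PiLp.continuous_toLp 2 _).comp ?_
    refine continuous_pi fun i => ?_
    fin_cases i <;> simp <;> fun_prop
  let q : ℝ × ℝ → V3 := fun z => (√(z.1 ^ 2 + z.2 ^ 2) ^ 2)⁻¹ • z.1 •
    !₂[z.1, z.2 * Real.cos θ, z.2 * Real.sin θ]
  let A : ℝ × ℝ → ℝ≥0∞ := fun z => {z : ℝ × ℝ | √(z.1 ^ 2 + z.2 ^ 2) < 1}.indicator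
    (fun z => ENNReal.ofReal (|z.1| * |z.2| / √(z.1 ^ 2 + z.2 ^ 2)) * Φ (q z)) z
  have hA : Measurable A := by
    refine Measurable.indicator ?_ (measurableSet_lt (by fun_prop) (by fun_prop))
    have : Measurable q := by
      have := hvec.measurable
      fun_prop
    fun_prop
  have hneg : ∀ z, A (-z) = A z := by
    intro z
    have : q (-z) = q z := by
      simp only [q]
      ext i; fin_cases i <;> simp
    simp only [A, Set.indicator, this]
    simp
  have key := lintegral_upper_rotate A hA hneg
  have hs : MeasurableSet ((Set.univ : Set ℝ) ×ˢ Set.Ioi (0 : ℝ)) :=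
    MeasurableSet.univ.prod measurableSet_Ioi
  refine (setLIntegral_congr_fun hs fun z hz => ?_).trans
    (key.trans (setLIntegral_congr_fun hs fun z hz => ?_))
  · have hz2 : 0 < z.2 := hz.2
    by_cases h1 : √(z.1 ^ 2 + z.2 ^ 2) < 1
    · rw [Set.indicator_of_mem (by simpa [hn] using h1)]
      simp only [A]
      rw [Set.indicator_of_mem (by exact h1), hn, ← mul_assoc, ← ENNReal.ofReal_mul hz2.le]
      congr 2
      · simp [abs_mul, abs_of_pos hz2]
        rw [abs_of_nonneg (Real.sqrt_nonneg _)]; ring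
      · simp only [q]
        ext i; fin_cases i <;> simp <;> ring
    · rw [Set.indicator_of_notMem (by simpa [hn] using h1)]
      simp only [A]
      rw [Set.indicator_of_notMem (by exact h1), mul_zero]
  · have hz2 : 0 < z.2 := hz.2
    have hc : (-z.2) ^ 2 + z.1 ^ 2 = z.1 ^ 2 + z.2 ^ 2 := by ring
    by_cases h1 : √(z.1 ^ 2 + z.2 ^ 2) < 1
    · rw [Set.indicator_of_mem (by simpa [hn] using h1)]
      simp only [A]
      rw [Set.indicator_of_mem (by simpa [add_comm] using h1), hn, ← mul_assoc,
        ← ENNReal.ofReal_mul hz2.le]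
      have hpos : 0 < z.1 ^ 2 + z.2 ^ 2 := by positivity
      congr 2
      · simp [abs_mul, abs_of_pos hz2]
        rw [abs_of_nonneg (Real.sqrt_nonneg _), add_comm]; ring
      · have hr := Real.sq_sqrt hpos.le
        simp only [q, hc]
        set r := √(z.1 ^ 2 + z.2 ^ 2)
        have hr0 : r ≠ 0 := by
          intro h; rw [h] at hr; simp at hr; linarith
        ext i; fin_cases i
        · simp; field_simp; linarith
        · simp; field_simp
        · simp; field_simp
    · rw [Set.indicator_of_notMem (by simpa [hn] using h1)]
      simp only [A]
      rw [Set.indicator_of_notMem (by simpa [add_comm] using h1), mul_zero]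

/-- For hard spheres the two post-collisional velocities have the same law: the directions `ω` and
its rotation by a right angle in the plane of `V` and `ω` carry the same weight. -/
theorem lintegral_sphere_exchange (Φ : V3 → ℝ≥0∞) (hΦ : Measurable Φ) (V : V3) :
    ∫⁻ ω : Metric.sphere (0 : V3) 1, ENNReal.ofReal |inner ℝ V (ω : V3)| *
        Φ (inner ℝ V (ω : V3) • (ω : V3)) ∂(volume : Measure V3).toSphere
      = ∫⁻ ω : Metric.sphere (0 : V3) 1, ENNReal.ofReal |inner ℝ V (ω : V3)| *
        Φ (V - inner ℝ V (ω : V3) • (ω : V3)) ∂(volume : Measure V3).toSphere := by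
  by_cases hV : V = 0
  · simp [hV]
  have hV' : 0 < ‖V‖ := norm_pos_iff.2 hV
  obtain ⟨R, hR⟩ := exists_isometry_map (‖V‖⁻¹ • V) (by simp [norm_smul, hV])
  have hVR : V = ‖V‖ • R (EuclideanSpace.single 0 1) := by
    rw [hR, smul_smul, mul_inv_cancel₀ hV'.ne', one_smul]
  have hin : ∀ ω : V3, inner ℝ V (R ω) = ‖V‖ * ω 0 := by
    intro ω
    conv_lhs => rw [hVR]
    rw [inner_smul_left, R.inner_map_map]
    simp [EuclideanSpace.inner_single_left]
  rw [← lintegral_sphere_comp_isometry R (fun ω => ENNReal.ofReal |inner ℝ V (ω : V3)| *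
        Φ (inner ℝ V (ω : V3) • (ω : V3))) (by fun_prop),
    ← lintegral_sphere_comp_isometry R (fun ω => ENNReal.ofReal |inner ℝ V (ω : V3)| *
        Φ (V - inner ℝ V (ω : V3) • (ω : V3))) (by fun_prop)]
  have key := lintegral_sphere_exchange_axis (fun p => Φ (‖V‖ • R p)) (by fun_prop)
  have hm0 : Measurable fun x : V3 => x 0 := by fun_prop
  have e1 : ∀ ω : V3, ENNReal.ofReal |inner ℝ V (R ω)| * Φ (inner ℝ V (R ω) • R ω)
      = ENNReal.ofReal ‖V‖ * (ENNReal.ofReal |ω 0| * Φ (‖V‖ • R (ω 0 • ω))) := by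
    intro ω
    rw [hin, abs_mul, abs_of_pos hV', ENNReal.ofReal_mul hV'.le, mul_assoc, map_smul, smul_smul]
  have e2 : ∀ ω : V3, ENNReal.ofReal |inner ℝ V (R ω)| * Φ (V - inner ℝ V (R ω) • R ω)
      = ENNReal.ofReal ‖V‖ * (ENNReal.ofReal |ω 0| *
        Φ (‖V‖ • R (EuclideanSpace.single 0 1 - ω 0 • ω))) := by
    intro ω
    rw [hin, abs_mul, abs_of_pos hV', ENNReal.ofReal_mul hV'.le, mul_assoc, map_sub, smul_sub,
      ← hVR, map_smul, smul_smul]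
  simp_rw [e1, e2]
  rw [lintegral_const_mul _ (by fun_prop), lintegral_const_mul _ (by fun_prop), key]

/-! ### Weights and the geometry of collisions -/

theorem wt_pos (ξ : V3) : 0 < wt ξ := by unfold wt; positivity
theorem one_le_wt (ξ : V3) : 1 ≤ wt ξ := by unfold wt; linarith [norm_nonneg ξ]
@[fun_prop] theorem continuous_wt : Continuous wt := by unfold wt; fun_prop
@[fun_prop] theorem measurable_wt : Measurable wt := continuous_wt.measurable

/-- Normalization constant of `W₀`. -/
def Gas.w0c (G : Gas) : ℝ := √(1 / (2 * Real.pi * G.temp) ^ (3 / 2 : ℝ))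

variable {G : Gas}

theorem Gas.Admissible.w0c_pos (hG : G.Admissible) : 0 < G.w0c := by
  have := hG.temp_pos
  have := Real.pi_pos
  unfold Gas.w0c; positivity

theorem Gas.w0_eq (G : Gas) (ξ : V3) :
    G.w0 ξ = G.w0c * Real.exp (-(‖ξ - G.u‖ ^ 2 / (4 * G.temp))) := by
  unfold Gas.w0 Gas.w0c maxwellian
  rw [Real.sqrt_mul' _ (Real.exp_pos _).le]
  congr 1
  rw [Real.sqrt_eq_rpow, ← Real.exp_mul]
  congr 1; ring

theorem Gas.Admissible.w0_pos (hG : G.Admissible) (ξ : V3) : 0 < G.w0 ξ := by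
  rw [G.w0_eq]; exact mul_pos hG.w0c_pos (Real.exp_pos _)

theorem Gas.w0_nonneg (G : Gas) (ξ : V3) : 0 ≤ G.w0 ξ := Real.sqrt_nonneg _

@[fun_prop] theorem Gas.continuous_w0 (G : Gas) : Continuous G.w0 := by
  rw [funext G.w0_eq]; fun_prop
@[fun_prop] theorem Gas.measurable_w0 (G : Gas) : Measurable G.w0 := G.continuous_w0.measurable

theorem Gas.Admissible.minf_eq (hG : G.Admissible) (ξ : V3) : G.minf ξ = G.rho * G.w0 ξ ^ 2 := by
  have := hG.temp_pos
  have := Real.pi_pos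
  unfold Gas.minf Gas.w0 maxwellian
  rw [Real.sq_sqrt (by positivity)]; ring

section Collisions
variable (ξ ξs : V3) (w : Metric.sphere (0 : V3) 1)

theorem inner_self_sphere : inner ℝ (w : V3) (w : V3) = (1 : ℝ) := by
  rw [real_inner_self_eq_norm_sq]; simp

theorem post_sub_postStar_inner :
    (inner ℝ (post ξ ξs w - postStar ξ ξs w) (w : V3) : ℝ) = -inner ℝ (ξ - ξs) (w : V3) := by
  simp only [post, postStar, inner_sub_left, inner_add_left, inner_smul_left, inner_self_sphere]
  simp

theorem post_post : post (post ξ ξs w) (postStar ξ ξs w) w = ξ := by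
  rw [post, post_sub_postStar_inner, post, neg_smul, sub_neg_eq_add, sub_add_cancel]

theorem postStar_post : postStar (post ξ ξs w) (postStar ξ ξs w) w = ξs := by
  rw [postStar, post_sub_postStar_inner, postStar]; module

theorem post_swap : post ξs ξ w = postStar ξ ξs w := by
  simp only [post, postStar, inner_sub_left, sub_smul]; module

theorem postStar_swap : postStar ξs ξ w = post ξ ξs w := by
  simp only [post, postStar, inner_sub_left, sub_smul]; module

theorem norm_sq_post_add (u : V3) :
    ‖post ξ ξs w - u‖ ^ 2 + ‖postStar ξ ξs w - u‖ ^ 2 = ‖ξ - u‖ ^ 2 + ‖ξs - u‖ ^ 2 := by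
  have h1 : post ξ ξs w - u = (ξ - u) - (inner ℝ (ξ - ξs) (w : V3) : ℝ) • (w : V3) := by
    rw [post]; module
  have h2 : postStar ξ ξs w - u = (ξs - u) + (inner ℝ (ξ - ξs) (w : V3) : ℝ) • (w : V3) := by
    rw [postStar]; module
  have h3 : (inner ℝ (ξ - ξs) (w : V3) : ℝ) = inner ℝ (ξ - u) (w : V3) - inner ℝ (ξs - u) (w : V3) := by
    simp only [inner_sub_left]; ring
  rw [h1, h2, norm_sub_sq_real, norm_add_sq_real, inner_smul_right, inner_smul_right, norm_smul,
    mul_pow, norm_eq_of_mem_sphere w, Real.norm_eq_abs, sq_abs, h3]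
  ring

theorem w0_post_mul : G.w0 (post ξ ξs w) * G.w0 (postStar ξ ξs w) = G.w0 ξ * G.w0 ξs := by
  simp only [G.w0_eq]
  have := norm_sq_post_add ξ ξs w G.u
  rw [mul_mul_mul_comm, mul_mul_mul_comm (G.w0c) _ (G.w0c), ← Real.exp_add, ← Real.exp_add]
  congr 2
  rw [← neg_add, ← neg_add, ← add_div, ← add_div, this]

theorem norm_le_post_add : ‖ξ‖ ≤ ‖post ξ ξs w‖ + ‖postStar ξ ξs w‖ := by
  have := norm_sq_post_add ξ ξs w 0
  simp only [sub_zero] at this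
  nlinarith [norm_nonneg (post ξ ξs w), norm_nonneg (postStar ξ ξs w), norm_nonneg ξ, norm_nonneg ξs]

theorem norm_star_le_post_add : ‖ξs‖ ≤ ‖post ξ ξs w‖ + ‖postStar ξ ξs w‖ := by
  have := norm_sq_post_add ξ ξs w 0
  simp only [sub_zero] at this
  nlinarith [norm_nonneg (post ξ ξs w), norm_nonneg (postStar ξ ξs w), norm_nonneg ξ, norm_nonneg ξs]

theorem abs_inner_sphere_le : |(inner ℝ (ξ - ξs) (w : V3) : ℝ)| ≤ wt ξ * wt ξs := by
  refine (abs_real_inner_le_norm _ _).trans ?_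
  rw [norm_eq_of_mem_sphere w, mul_one]
  refine (norm_sub_le _ _).trans ?_
  unfold wt; nlinarith [norm_nonneg ξ, norm_nonneg ξs]

end Collisions

/-- The measure `dξ dξ_* dω` on the space of collisions. -/
def coll : Measure (V3 × V3 × Metric.sphere (0 : V3) 1) :=
  (volume : Measure V3).prod ((volume : Measure V3).prod (volume : Measure V3).toSphere)

instance : IsFiniteMeasure (volume : Measure V3).toSphere := inferInstance
instance : SigmaFinite (volume : Measure V3).toSphere := inferInstance

/-- Exchange of the two colliding particles. -/
def exch (z : V3 × V3 × Metric.sphere (0 : V3) 1) : V3 × V3 × Metric.sphere (0 : V3) 1 :=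
  (z.2.1, z.1, z.2.2)

/-- The collision `(ξ, ξ_*, ω) ↦ (ξ', ξ_*', ω)`. -/
def scatter (z : V3 × V3 × Metric.sphere (0 : V3) 1) : V3 × V3 × Metric.sphere (0 : V3) 1 :=
  (post z.1 z.2.1 z.2.2, postStar z.1 z.2.1 z.2.2, z.2.2)

theorem measurePreserving_exch : MeasurePreserving exch coll coll := by
  have h1 := (measurePreserving_prodAssoc (volume : Measure V3) (volume : Measure V3)
    (volume : Measure V3).toSphere)
  have h2 : MeasurePreserving (Prod.swap : V3 × V3 → V3 × V3) (volume.prod volume)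
    (volume.prod volume) := Measure.measurePreserving_swap
  exact h1.comp ((h2.prod (MeasurePreserving.id _)).comp h1.symm)

/-- The collision of `(ξ, ξ_*)` in direction `w` as a linear map. -/
def scatterLin (w : V3) : V3 × V3 →ₗ[ℝ] V3 × V3 :=
  LinearMap.prod
    (LinearMap.fst ℝ V3 V3 - ((innerₗ V3 w).comp (LinearMap.fst ℝ V3 V3 - LinearMap.snd ℝ V3 V3)).smulRight w)
    (LinearMap.snd ℝ V3 V3 + ((innerₗ V3 w).comp (LinearMap.fst ℝ V3 V3 - LinearMap.snd ℝ V3 V3)).smulRight w)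

theorem scatterLin_apply (w : V3) (z : V3 × V3) :
    scatterLin w z = (post z.1 z.2 w, postStar z.1 z.2 w) := by
  simp [scatterLin, post, postStar, real_inner_comm]

theorem measurePreserving_scatterLin (w : Metric.sphere (0 : V3) 1) :
    MeasurePreserving (scatterLin w) (volume : Measure (V3 × V3)) volume := by
  have hinv : scatterLin (w : V3) ∘ₗ scatterLin (w : V3) = LinearMap.id := by
    refine LinearMap.ext fun z => ?_
    simp only [LinearMap.comp_apply, scatterLin_apply, post_post, postStar_post, LinearMap.id_apply]
  have hdet : LinearMap.det (scatterLin (w : V3)) * LinearMap.det (scatterLin (w : V3)) = 1 := by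
    rw [← LinearMap.det_comp, hinv, LinearMap.det_id]
  have hne : LinearMap.det (scatterLin (w : V3)) ≠ 0 := by
    intro h; simp [h] at hdet
  refine ⟨(LinearMap.continuous_of_finiteDimensional _).measurable, ?_⟩
  have : (volume : Measure (V3 × V3)).IsAddHaarMeasure := by
    rw [Measure.volume_eq_prod]; infer_instance
  rw [Measure.map_linearMap_addHaar_eq_smul_addHaar _ hne]
  have : |LinearMap.det (scatterLin (w : V3))| = 1 := by
    have := mul_self_eq_one_iff.1 hdet
    rcases this with h | h <;> simp [h]
  rw [abs_inv, this]; simp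

@[fun_prop] theorem continuous_post : Continuous
    (fun z : V3 × V3 × V3 => post z.1 z.2.1 z.2.2) := by unfold post; fun_prop
@[fun_prop] theorem continuous_postStar : Continuous
    (fun z : V3 × V3 × V3 => postStar z.1 z.2.1 z.2.2) := by unfold postStar; fun_prop

@[fun_prop] theorem Measurable.post {α : Type*} [MeasurableSpace α] {f g h : α → V3}
    (hf : Measurable f) (hg : Measurable g) (hh : Measurable h) :
    Measurable fun a => post (f a) (g a) (h a) :=
  continuous_post.measurable.comp (hf.prodMk (hg.prodMk hh))
@[fun_prop] theorem Measurable.postStar {α : Type*} [MeasurableSpace α] {f g h : α → V3}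
    (hf : Measurable f) (hg : Measurable g) (hh : Measurable h) :
    Measurable fun a => postStar (f a) (g a) (h a) :=
  continuous_postStar.measurable.comp (hf.prodMk (hg.prodMk hh))

theorem measurePreserving_scatter : MeasurePreserving scatter coll coll := by
  have h1 := (measurePreserving_prodAssoc (volume : Measure V3) (volume : Measure V3)
    (volume : Measure V3).toSphere)
  have h2 : MeasurePreserving (Prod.swap : (V3 × V3) × Metric.sphere (0 : V3) 1 → _)
      ((volume.prod volume).prod (volume : Measure V3).toSphere)
      ((volume : Measure V3).toSphere.prod (volume.prod volume)) := Measure.measurePreserving_swap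
  have h3 : MeasurePreserving
      (fun z : Metric.sphere (0 : V3) 1 × V3 × V3 => (z.1, scatterLin z.1 z.2))
      ((volume : Measure V3).toSphere.prod (volume.prod volume))
      ((volume : Measure V3).toSphere.prod (volume.prod volume)) := by
    refine (MeasurePreserving.id _).skew_product ?_ (ae_of_all _ fun w =>
      (measurePreserving_scatterLin w).map_eq)
    simp only [Function.uncurry_def, scatterLin_apply]
    fun_prop
  have h2' : MeasurePreserving (Prod.swap : Metric.sphere (0 : V3) 1 × (V3 × V3) → _)
      ((volume : Measure V3).toSphere.prod (volume.prod volume))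
      ((volume.prod volume).prod (volume : Measure V3).toSphere) := Measure.measurePreserving_swap
  have := h1.comp (h2'.comp (h3.comp (h2.comp h1.symm)))
  refine (show scatter = _ from ?_) ▸ this
  funext z
  simp only [Function.comp, scatterLin_apply]; rfl

theorem scatter_scatter (z) : scatter (scatter z) = z := by
  simp [scatter, post_post, postStar_post]
theorem exch_scatter (z) : exch (scatter z) = scatter (exch z) := by
  simp only [scatter, exch]; rw [post_swap z.1, postStar_swap z.1]

/-- The hard-sphere factor `|(ξ - ξ_*) · ω|`. -/
def hs (z : V3 × V3 × Metric.sphere (0 : V3) 1) : ℝ :=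
  |(inner ℝ (z.1 - z.2.1) (z.2.2 : V3) : ℝ)|

theorem hs_nonneg (z) : 0 ≤ hs z := abs_nonneg _
@[fun_prop] theorem measurable_hs : Measurable hs := by unfold hs; fun_prop
theorem hs_exch (z) : hs (exch z) = hs z := by
  simp only [hs, exch]; rw [← neg_sub, inner_neg_left, abs_neg]
theorem hs_scatter (z) : hs (scatter z) = hs z := by
  simp only [hs, scatter, post_sub_postStar_inner, abs_neg]
theorem hs_le (z) : hs z ≤ wt z.1 * wt z.2.1 := abs_inner_sphere_le _ _ _

theorem lintegral_wt_rpow_lt_top {r : ℝ} (hr : 3 < r) :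
    ∫⁻ ξ : V3, ENNReal.ofReal (wt ξ ^ (-r)) < ⊤ :=
  finite_integral_one_add_norm (by simpa using hr)

theorem Gas.Admissible.w0_decay (hG : G.Admissible) (n : ℕ) :
    ∃ C : ℝ, 0 < C ∧ ∀ ξ, G.w0 ξ * wt ξ ^ n ≤ C := by
  have hT := hG.temp_pos
  have hc := hG.w0c_pos
  refine ⟨G.w0c * ((1 + ‖G.u‖) ^ n * (n.factorial * Real.exp (1 + G.temp))), by positivity,
    fun ξ => ?_⟩
  have h1 : wt ξ ≤ (1 + ‖G.u‖) * (1 + ‖ξ - G.u‖) := by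
    have := norm_add_le (ξ - G.u) G.u
    rw [sub_add_cancel] at this
    unfold wt; nlinarith [norm_nonneg G.u, norm_nonneg (ξ - G.u)]
  set r := ‖ξ - G.u‖
  have hr : 0 ≤ r := norm_nonneg _
  have h2 : (1 + r) ^ n ≤ n.factorial * Real.exp (1 + r) := by
    have := Real.pow_div_factorial_le_exp (1 + r) (by positivity) n
    rwa [div_le_iff₀ (by positivity), mul_comm] at this
  have h3 : Real.exp (1 + r) ≤ Real.exp (1 + G.temp) * Real.exp (r ^ 2 / (4 * G.temp)) := by
    rw [← Real.exp_add]
    refine Real.exp_le_exp.2 ?_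
    have : r ≤ G.temp + r ^ 2 / (4 * G.temp) := by
      rw [← sub_nonneg]
      have : G.temp + r ^ 2 / (4 * G.temp) - r = (r - 2 * G.temp) ^ 2 / (4 * G.temp) := by
        field_simp; ring
      rw [this]; positivity
    linarith
  rw [G.w0_eq]
  calc G.w0c * Real.exp (-(r ^ 2 / (4 * G.temp))) * wt ξ ^ n
      ≤ G.w0c * Real.exp (-(r ^ 2 / (4 * G.temp))) * ((1 + ‖G.u‖) ^ n * (n.factorial *
        (Real.exp (1 + G.temp) * Real.exp (r ^ 2 / (4 * G.temp))))) := by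
        have := wt_pos ξ
        gcongr
        refine (pow_le_pow_left₀ this.le h1 n).trans ?_
        rw [mul_pow]
        gcongr
        refine h2.trans ?_
        gcongr
    _ = _ := by
        have : Real.exp (-(r ^ 2 / (4 * G.temp))) * Real.exp (r ^ 2 / (4 * G.temp)) = 1 := by
          rw [← Real.exp_add]; simp
        linear_combination (G.w0c * ((1 + ‖G.u‖) ^ n * (n.factorial * Real.exp (1 + G.temp)))) * this

/-! ### A weighted estimate of the collision integral -/

theorem ENNReal_add_sq_le (x y : ℝ≥0∞) : (x + y) ^ 2 ≤ 4 * (x ^ 2 + y ^ 2) := by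
  rcases le_total x y with h | h
  · calc (x + y) ^ 2 ≤ (y + y) ^ 2 := by gcongr
      _ = 4 * y ^ 2 := by rw [← two_mul, mul_pow]; norm_num
      _ ≤ _ := by gcongr; exact le_add_self
  · calc (x + y) ^ 2 ≤ (x + x) ^ 2 := by gcongr
      _ = 4 * x ^ 2 := by rw [← two_mul, mul_pow]; norm_num
      _ ≤ _ := by gcongr; exact le_self_add

theorem ENNReal_add_four_sq_le (a b c d : ℝ≥0∞) :
    (a + b + c + d) ^ 2 ≤ 64 * (a ^ 2 + b ^ 2 + c ^ 2 + d ^ 2) := by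
  calc (a + b + c + d) ^ 2 ≤ 4 * (4 * (4 * (a ^ 2 + b ^ 2) + c ^ 2) + d ^ 2) := by
        refine (ENNReal_add_sq_le _ _).trans ?_
        gcongr
        refine (ENNReal_add_sq_le _ _).trans ?_
        gcongr
        exact ENNReal_add_sq_le _ _
    _ ≤ 4 * (4 * (4 * (a ^ 2 + b ^ 2) + 4 * c ^ 2) + 16 * d ^ 2) := by
        gcongr
        · exact le_mul_of_one_le_left' (by norm_num)
        · exact le_mul_of_one_le_left' (by norm_num)
    _ = _ := by ring

/-- Cauchy–Schwarz with a weight. -/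
theorem lintegral_mul_sq_le {α : Type*} [MeasurableSpace α] (ν : Measure α) {w F : α → ℝ≥0∞}
    (hw : Measurable w) (hF : Measurable F) :
    (∫⁻ a, w a * F a ∂ν) ^ 2 ≤ (∫⁻ a, w a ∂ν) * ∫⁻ a, w a * F a ^ 2 ∂ν := by
  have h := ENNReal.lintegral_mul_le_Lp_mul_Lq ν Real.HolderConjugate.two_two
    (f := fun a => w a ^ (1 / 2 : ℝ)) (g := fun a => w a ^ (1 / 2 : ℝ) * F a)
    (by fun_prop) (by fun_prop)
  have e1 : ∀ a, w a ^ (1 / 2 : ℝ) * w a ^ (1 / 2 : ℝ) = w a := fun a => by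
    rw [← ENNReal.rpow_add_of_nonneg _ _ (by norm_num) (by norm_num)]; norm_num
  simp only [Pi.mul_apply, ← mul_assoc, e1] at h
  have e2 : ∀ a, (w a ^ (1 / 2 : ℝ)) ^ (2 : ℝ) = w a := fun a => by
    rw [← ENNReal.rpow_mul]; norm_num
  simp only [ENNReal.mul_rpow_of_nonneg _ _ (zero_le_two : (0 : ℝ) ≤ 2), e2,
    ENNReal.rpow_two] at h
  calc _ ≤ _ := pow_le_pow_left' h 2
    _ = _ := by
      rw [mul_pow, ← ENNReal.rpow_two, ← ENNReal.rpow_mul, ← ENNReal.rpow_two, ← ENNReal.rpow_mul]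
      norm_num

/-- The measure `dξ_* dω` over which the collision integral at `ξ` is taken. -/
abbrev part : Measure (V3 × Metric.sphere (0 : V3) 1) :=
  (volume : Measure V3).prod (volume : Measure V3).toSphere

theorem lintegral_coll {F : V3 × V3 × Metric.sphere (0 : V3) 1 → ℝ≥0∞} (hF : Measurable F) :
    ∫⁻ z, F z ∂coll = ∫⁻ ξ, ∫⁻ p, F (ξ, p) ∂part := by
  rw [coll, lintegral_prod _ hF.aemeasurable]

/-- Area of the unit sphere. -/
def area : ℝ≥0∞ := (volume : Measure V3).toSphere Set.univ

theorem area_lt_top : area < ⊤ := measure_lt_top _ _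

theorem lintegral_part_fst {X : V3 → ℝ≥0∞} (hX : Measurable X) :
    ∫⁻ p, X p.1 ∂part = area * ∫⁻ ξ, X ξ := by
  rw [lintegral_prod _ (by fun_prop)]
  simp only [lintegral_const]
  rw [lintegral_mul_const _ hX, mul_comm]; rfl

theorem lintegral_coll_mul {X Y : V3 → ℝ≥0∞} (hX : Measurable X) (hY : Measurable Y) :
    ∫⁻ z, X z.1 * Y z.2.1 ∂coll = area * ((∫⁻ ξ, X ξ) * ∫⁻ ξ, Y ξ) := by
  rw [lintegral_coll (by fun_prop)]
  have : ∀ ξ : V3, ∫⁻ p : V3 × Metric.sphere (0 : V3) 1, X ξ * Y p.1 ∂part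
      = X ξ * (area * ∫⁻ ξ, Y ξ) := fun ξ => by
    rw [lintegral_const_mul _ (by fun_prop), lintegral_part_fst hY]
  simp only [this]
  rw [lintegral_mul_const _ hX]; ring

/-- Weights which are comparable at velocities of comparable size. -/
structure SlowWeight (m : V3 → ℝ) : Prop where
  meas : Measurable m
  pos : ∀ ξ, 0 < m ξ
  slow : ∀ ζ ξ η : V3, ‖ζ‖ ≤ ‖ξ‖ + ‖η‖ → m ξ ≤ wt η ^ 2 * m ζ

/-- The collision integral of `Γ(h, k)` with all its terms replaced by their absolute values. -/
def Gas.gAbs (G : Gas) (h k : V3 → ℝ) (ξ : V3) : ℝ≥0∞ :=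
  ∫⁻ p : V3 × Metric.sphere (0 : V3) 1,
    ENNReal.ofReal (G.w0 p.1 * |(inner ℝ (ξ - p.1) (p.2 : V3) : ℝ)|) *
      (‖h (post ξ p.1 p.2)‖ₑ * ‖k (postStar ξ p.1 p.2)‖ₑ
        + ‖h (postStar ξ p.1 p.2)‖ₑ * ‖k (post ξ p.1 p.2)‖ₑ
        + ‖h ξ‖ₑ * ‖k p.1‖ₑ + ‖h p.1‖ₑ * ‖k ξ‖ₑ) ∂part


theorem lintegral_mul_sq_le_of_bound {β : ℝ} {A : ℝ≥0∞} {h : V3 → ℝ}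
    (hA : ∀ᵐ ξ, ‖h ξ‖ₑ ≤ A * ENNReal.ofReal (wt ξ ^ (-β))) :
    ∫⁻ ξ, ENNReal.ofReal (wt ξ) * ‖h ξ‖ₑ ^ 2
      ≤ A ^ 2 * ∫⁻ ξ, ENNReal.ofReal (wt ξ ^ (-(2 * β - 1))) := by
  rw [← lintegral_const_mul _ (by fun_prop)]
  refine lintegral_mono_ae ?_
  filter_upwards [hA] with ξ hξ
  calc _ ≤ ENNReal.ofReal (wt ξ) * (A * ENNReal.ofReal (wt ξ ^ (-β))) ^ 2 := by gcongr
    _ = A ^ 2 * (ENNReal.ofReal (wt ξ) * ENNReal.ofReal (wt ξ ^ (-β)) ^ 2) := by ring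
    _ = _ := by
      have hw := wt_pos ξ
      rw [← ENNReal.ofReal_pow (by positivity), ← ENNReal.ofReal_mul hw.le]
      congr 2
      rw [← Real.rpow_natCast (wt ξ ^ (-β)), ← Real.rpow_mul hw.le]
      nth_rewrite 1 [← Real.rpow_one (wt ξ)]
      rw [← Real.rpow_add hw]
      congr 1; push_cast; ring

/-- The weighted `L²` bound for `Γ(h, k)` with `h ∈ L^∞_β`: Cauchy–Schwarz, the involution
`(ξ, ξ_*) ↦ (ξ', ξ_*')`, and conservation of energy to compare the weights. -/
theorem Gas.Admissible.lintegral_gAbs_sq_le (hG : G.Admissible) {β : ℝ} (hβ : 2 < β) :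
    ∃ C : ℝ≥0∞, C < ⊤ ∧ ∀ m : V3 → ℝ, SlowWeight m → ∀ (A : ℝ≥0∞) (h k : V3 → ℝ),
      Measurable h → Measurable k → (∀ᵐ ξ, ‖h ξ‖ₑ ≤ A * ENNReal.ofReal (wt ξ ^ (-β))) →
      ∫⁻ ξ, ENNReal.ofReal (m ξ / wt ξ) * G.gAbs h k ξ ^ 2
        ≤ C * A ^ 2 * ∫⁻ ξ, ENNReal.ofReal (wt ξ * m ξ) * ‖k ξ‖ₑ ^ 2 := by
  obtain ⟨C2, hC2, hW2⟩ := hG.w0_decay 2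
  obtain ⟨C5, hC5, hW5⟩ := hG.w0_decay 5
  set K : ℝ≥0∞ := area * ∫⁻ ξ : V3, ENNReal.ofReal (C5 * wt ξ ^ (-4 : ℝ))
  have hK : K < ⊤ := by
    refine ENNReal.mul_lt_top area_lt_top ?_
    simp only [ENNReal.ofReal_mul hC5.le]
    rw [lintegral_const_mul _ (by fun_prop)]
    exact ENNReal.mul_lt_top ENNReal.ofReal_lt_top (lintegral_wt_rpow_lt_top (by norm_num))
  set N : ℝ≥0∞ := ∫⁻ ξ : V3, ENNReal.ofReal (wt ξ ^ (-(2 * β - 1)))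
  have hN : N < ⊤ := lintegral_wt_rpow_lt_top (by linarith)
  have hW : ∀ ξ, G.w0 ξ ≤ C2 * (wt ξ ^ 2)⁻¹ := fun ξ => by
    have := wt_pos ξ
    rw [← div_eq_mul_inv, le_div_iff₀ (by positivity)]; exact hW2 ξ
  refine ⟨64 * K * (4 * (ENNReal.ofReal C2 * (area * N))), ?_, ?_⟩
  · have := area_lt_top
    exact ENNReal.mul_lt_top (ENNReal.mul_lt_top (by norm_num) hK) (ENNReal.mul_lt_top (by norm_num)
      (ENNReal.mul_lt_top ENNReal.ofReal_lt_top (ENNReal.mul_lt_top this hN)))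
  intro m hm A h k hh hk hA
  have hmm := hm.meas
  set D := ∫⁻ ξ, ENNReal.ofReal (wt ξ * m ξ) * ‖k ξ‖ₑ ^ 2
  -- the frequency `∫ W₀(ξ_*) |(ξ - ξ_*) · ω|` grows at most linearly
  have hfreq : ∀ ξ : V3, ∫⁻ p : V3 × Metric.sphere (0 : V3) 1,
      ENNReal.ofReal (G.w0 p.1 * |(inner ℝ (ξ - p.1) (p.2 : V3) : ℝ)|) ∂part
      ≤ ENNReal.ofReal (wt ξ) * K := by
    intro ξ
    simp only [K]
    rw [← lintegral_part_fst (by fun_prop), ← lintegral_const_mul _ (by fun_prop)]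
    refine lintegral_mono fun p => ?_
    have hp := wt_pos p.1
    rw [← ENNReal.ofReal_mul (wt_pos ξ).le]
    refine ENNReal.ofReal_le_ofReal ?_
    have e : wt p.1 ^ (-4 : ℝ) = wt p.1 * (wt p.1 ^ 5)⁻¹ := by
      rw [Real.rpow_neg hp.le]; norm_cast; field_simp
    calc _ ≤ (C5 * (wt p.1 ^ 5)⁻¹) * (wt ξ * wt p.1) := by
          gcongr
          · rw [← div_eq_mul_inv, le_div_iff₀ (by positivity)]; exact hW5 p.1
          · exact abs_inner_sphere_le _ _ _
      _ = _ := by rw [e]; ring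
  let g : V3 × V3 × Metric.sphere (0 : V3) 1 → ℝ≥0∞ := fun z =>
    ENNReal.ofReal (m z.1 * (G.w0 z.2.1 * hs z))
  have hg : Measurable g := by fun_prop
  let S : V3 × V3 × Metric.sphere (0 : V3) 1 → ℝ≥0∞ := fun z =>
    ‖h (post z.1 z.2.1 z.2.2)‖ₑ ^ 2 * ‖k (postStar z.1 z.2.1 z.2.2)‖ₑ ^ 2
      + ‖h (postStar z.1 z.2.1 z.2.2)‖ₑ ^ 2 * ‖k (post z.1 z.2.1 z.2.2)‖ₑ ^ 2
      + ‖h z.1‖ₑ ^ 2 * ‖k z.2.1‖ₑ ^ 2 + ‖h z.2.1‖ₑ ^ 2 * ‖k z.1‖ₑ ^ 2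
  have hS : Measurable S := by fun_prop
  have step1 : ∀ ξ, ENNReal.ofReal (m ξ / wt ξ) * G.gAbs h k ξ ^ 2
      ≤ 64 * K * ∫⁻ p, g (ξ, p) * S (ξ, p) ∂part := by
    intro ξ
    have hξ := wt_pos ξ
    have hmξ := hm.pos ξ
    let B : V3 × Metric.sphere (0 : V3) 1 → ℝ≥0∞ := fun p =>
      ENNReal.ofReal (G.w0 p.1 * |(inner ℝ (ξ - p.1) (p.2 : V3) : ℝ)|)
    have hB : Measurable B := by fun_prop
    have h1 : G.gAbs h k ξ ^ 2 ≤ (∫⁻ p, B p ∂part) * ∫⁻ p, B p * (64 * S (ξ, p)) ∂part := by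
      refine (lintegral_mul_sq_le part (w := B) hB (by fun_prop)).trans ?_
      gcongr with p
      refine (ENNReal_add_four_sq_le _ _ _ _).trans (le_of_eq ?_)
      simp only [S, mul_pow]
    calc _ ≤ ENNReal.ofReal (m ξ / wt ξ) * (ENNReal.ofReal (wt ξ) * K *
          ∫⁻ p, B p * (64 * S (ξ, p)) ∂part) := by
          gcongr
          exact h1.trans (by gcongr; exact hfreq ξ)
      _ = ENNReal.ofReal (m ξ / wt ξ * wt ξ) * K * ∫⁻ p, B p * (64 * S (ξ, p)) ∂part := by
          rw [ENNReal.ofReal_mul (by positivity)]; ring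
      _ = ENNReal.ofReal (m ξ) * K * (64 * ∫⁻ p, B p * S (ξ, p) ∂part) := by
          rw [div_mul_cancel₀ _ hξ.ne']
          simp only [mul_left_comm (B _) 64]
          rw [lintegral_const_mul _ (by fun_prop)]
      _ = 64 * K * (ENNReal.ofReal (m ξ) * ∫⁻ p, B p * S (ξ, p) ∂part) := by ring
      _ = _ := by
          rw [← lintegral_const_mul _ (by fun_prop)]
          congr 2
          funext p
          simp only [g]
          rw [ENNReal.ofReal_mul hmξ.le, mul_assoc]; rfl
  have hXint : ∫⁻ ξ, ENNReal.ofReal (wt ξ) * ‖h ξ‖ₑ ^ 2 ≤ A ^ 2 * N :=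
    lintegral_mul_sq_le_of_bound hA
  -- the common bound of the four terms
  have base : ∫⁻ z, ENNReal.ofReal C2 * ((ENNReal.ofReal (wt z.1) * ‖h z.1‖ₑ ^ 2) *
      (ENNReal.ofReal (wt z.2.1 * m z.2.1) * ‖k z.2.1‖ₑ ^ 2)) ∂coll
      ≤ ENNReal.ofReal C2 * (area * N) * A ^ 2 * D := by
    rw [lintegral_const_mul _ (by fun_prop), lintegral_coll_mul
      (X := fun ξ => ENNReal.ofReal (wt ξ) * ‖h ξ‖ₑ ^ 2)
      (Y := fun ξ => ENNReal.ofReal (wt ξ * m ξ) * ‖k ξ‖ₑ ^ 2) (by fun_prop) (by fun_prop)]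
    calc _ ≤ ENNReal.ofReal C2 * (area * ((A ^ 2 * N) * D)) := by gcongr
      _ = _ := by ring
  have dom : ∀ (x y : ℝ) (z : V3 × V3 × Metric.sphere (0 : V3) 1), x * y ≤ C2 * m z.2.1 →
      ENNReal.ofReal (x * (y * hs z)) * (‖h z.1‖ₑ ^ 2 * ‖k z.2.1‖ₑ ^ 2) ≤
      ENNReal.ofReal C2 * ((ENNReal.ofReal (wt z.1) * ‖h z.1‖ₑ ^ 2) *
      (ENNReal.ofReal (wt z.2.1 * m z.2.1) * ‖k z.2.1‖ₑ ^ 2)) := by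
    intro x y z hx
    have h1 := wt_pos z.1
    have h2 := wt_pos z.2.1
    have h3 := hm.pos z.2.1
    calc _ ≤ ENNReal.ofReal (C2 * (wt z.1 * (wt z.2.1 * m z.2.1))) *
          (‖h z.1‖ₑ ^ 2 * ‖k z.2.1‖ₑ ^ 2) := by
          gcongr ENNReal.ofReal ?_ * _
          calc x * (y * hs z) = (x * y) * hs z := by ring
            _ ≤ (C2 * m z.2.1) * (wt z.1 * wt z.2.1) :=
                mul_le_mul hx (hs_le z) (hs_nonneg z) (by positivity)
            _ = _ := by ring
      _ = _ := by
          rw [ENNReal.ofReal_mul hC2.le, ENNReal.ofReal_mul h1.le]; ring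
  have wm : ∀ ξ η ζ : V3, ‖ζ‖ ≤ ‖ξ‖ + ‖η‖ → m ξ * G.w0 η ≤ C2 * m ζ := by
    intro ξ η ζ hz
    have := wt_pos η
    have h3 := hm.pos ζ
    have h4 := hm.pos ξ
    calc _ ≤ (wt η ^ 2 * m ζ) * (C2 * (wt η ^ 2)⁻¹) := by
          gcongr
          · exact G.w0_nonneg _
          · exact hm.slow _ _ _ hz
          · exact hW η
      _ = _ := by field_simp
  -- the collision map and the exchange of the particles preserve `coll` and the factor
  -- `|(ξ - ξ_*) · ω|`, so each of the four terms is the integral `base` up to the placement of the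
  -- weight `m`, which `wm` moves to the argument of `k`
  have t1 : ∫⁻ z, g z * (‖h (post z.1 z.2.1 z.2.2)‖ₑ ^ 2 *
      ‖k (postStar z.1 z.2.1 z.2.2)‖ₑ ^ 2) ∂coll
      ≤ ENNReal.ofReal C2 * (area * N) * A ^ 2 * D := by
    rw [← measurePreserving_scatter.lintegral_comp (by fun_prop)]
    refine le_trans (lintegral_mono fun z => ?_) base
    simp only [g, hs_scatter]
    simp only [scatter, post_post, postStar_post]
    exact dom _ _ z (wm _ _ _ (norm_star_le_post_add _ _ _))
  have t2 : ∫⁻ z, g z * (‖h (postStar z.1 z.2.1 z.2.2)‖ₑ ^ 2 *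
      ‖k (post z.1 z.2.1 z.2.2)‖ₑ ^ 2) ∂coll
      ≤ ENNReal.ofReal C2 * (area * N) * A ^ 2 * D := by
    rw [← (measurePreserving_scatter.comp measurePreserving_exch).lintegral_comp (by fun_prop)]
    refine le_trans (lintegral_mono fun z => ?_) base
    simp only [g, Function.comp, hs_scatter, hs_exch]
    simp only [scatter, post_post, postStar_post, exch]
    exact dom _ _ z (wm _ _ _ (norm_le_post_add _ _ _))
  have t3 : ∫⁻ z, g z * (‖h z.1‖ₑ ^ 2 * ‖k z.2.1‖ₑ ^ 2) ∂coll
      ≤ ENNReal.ofReal C2 * (area * N) * A ^ 2 * D := by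
    refine le_trans (lintegral_mono fun z => ?_) base
    simp only [g]
    exact dom _ _ z (wm z.1 z.2.1 z.2.1 (by linarith [norm_nonneg z.1]))
  have t4 : ∫⁻ z, g z * (‖h z.2.1‖ₑ ^ 2 * ‖k z.1‖ₑ ^ 2) ∂coll
      ≤ ENNReal.ofReal C2 * (area * N) * A ^ 2 * D := by
    rw [← measurePreserving_exch.lintegral_comp (by fun_prop)]
    refine le_trans (lintegral_mono fun z => ?_) base
    simp only [g, hs_exch]
    simp only [exch]
    exact dom _ _ z (wm z.2.1 z.1 z.2.1 (by linarith [norm_nonneg z.1]))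
  calc _ ≤ ∫⁻ ξ, 64 * K * ∫⁻ p, g (ξ, p) * S (ξ, p) ∂part := lintegral_mono step1
    _ = 64 * K * ∫⁻ z, g z * S z ∂coll := by
        rw [lintegral_const_mul _ (Measurable.lintegral_prod_right' (f := fun z => g z * S z)
          (by fun_prop)), lintegral_coll (by fun_prop)]
    _ ≤ 64 * K * (4 * (ENNReal.ofReal C2 * (area * N) * A ^ 2 * D)) := by
        gcongr
        simp only [S, mul_add]
        rw [lintegral_add_right _ (by fun_prop), lintegral_add_right _ (by fun_prop),
          lintegral_add_right _ (by fun_prop)]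
        refine (add_le_add (add_le_add (add_le_add t1 t2) t3) t4).trans (le_of_eq ?_)
        ring
    _ = _ := by ring

/-! ### A convolution bound for the nonlocal part -/


theorem exists_pow_mul_exp_neg_sq_le {a : ℝ} (ha : 0 < a) (n : ℕ) :
    ∃ C : ℝ, 0 < C ∧ ∀ r : ℝ, 0 ≤ r → (1 + r) ^ n * Real.exp (-(r ^ 2 / a)) ≤ C := by
  refine ⟨n.factorial * Real.exp (1 + a), by positivity, fun r hr => ?_⟩
  have h2 : (1 + r) ^ n ≤ n.factorial * Real.exp (1 + r) := by
    have := Real.pow_div_factorial_le_exp (1 + r) (by positivity) n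
    rwa [div_le_iff₀ (by positivity), mul_comm] at this
  have h3 : r ≤ a + r ^ 2 / a := by
    rw [← sub_nonneg]
    have : a + r ^ 2 / a - r = ((r - a / 2) ^ 2 + 3 / 4 * a ^ 2) / a := by field_simp; ring
    rw [this]; positivity
  calc _ ≤ n.factorial * Real.exp (1 + r) * Real.exp (-(r ^ 2 / a)) := by gcongr
    _ = n.factorial * Real.exp (1 + r - r ^ 2 / a) := by
        rw [mul_assoc, ← Real.exp_add]; rfl
    _ ≤ _ := by gcongr; linarith

/-- The singular convolution kernel `|p|⁻¹ ⟨p⟩⁻³`, which lies in `L¹ ∩ L²`. -/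
def ker0 (p : V3) : ℝ≥0∞ := ENNReal.ofReal (‖p‖⁻¹ * (wt p ^ 3)⁻¹)

@[fun_prop] theorem measurable_ker0 : Measurable ker0 := by unfold ker0; fun_prop

theorem lintegral_radial_lt_top {f : ℝ → ℝ} (hf : Measurable f)
    (hb : ∀ r, 0 < r → r ^ 2 * f r ≤ (1 + r) ^ (-2 : ℝ)) :
    ∫⁻ p : V3, ENNReal.ofReal (f ‖p‖) < ⊤ := by
  rw [lintegral_V3_polar _ (by fun_prop)]
  have h1 : ∫⁻ r : ℝ, ENNReal.ofReal ((1 + ‖r‖) ^ (-2 : ℝ)) < ⊤ :=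
    finite_integral_one_add_norm (by simp)
  calc _ ≤ ∫⁻ _ω : Metric.sphere (0 : V3) 1, ∫⁻ r : ℝ, ENNReal.ofReal ((1 + ‖r‖) ^ (-2 : ℝ))
        ∂volume ∂(volume : Measure V3).toSphere := by
        refine lintegral_mono fun ω => ?_
        refine le_trans ?_ (setLIntegral_le_lintegral (Set.Ioi 0) _)
        refine setLIntegral_mono (by fun_prop) fun r hr => ?_
        have hr' : 0 < r := hr
        rw [← ENNReal.ofReal_mul (by positivity), norm_smul, norm_eq_of_mem_sphere, mul_one,
          Real.norm_eq_abs, abs_of_pos hr']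
        exact ENNReal.ofReal_le_ofReal (hb r hr')
    _ < ⊤ := by
        rw [lintegral_const]; exact ENNReal.mul_lt_top h1 (measure_lt_top _ _)

theorem lintegral_ker0_lt_top : ∫⁻ p, ker0 p < ⊤ := by
  refine lintegral_radial_lt_top (f := fun r => r⁻¹ * ((1 + r) ^ 3)⁻¹) (by fun_prop) fun r hr => ?_
  rw [Real.rpow_neg (by positivity)]
  norm_cast
  have : r ^ 2 * r⁻¹ = r := by field_simp
  rw [← mul_assoc, this, ← div_eq_mul_inv, inv_eq_one_div,
    div_le_div_iff₀ (by positivity) (by positivity)]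
  nlinarith [sq_nonneg (1 + r)]

theorem lintegral_ker0_sq_lt_top : ∫⁻ p, ker0 p ^ 2 < ⊤ := by
  have := lintegral_radial_lt_top (f := fun r => (r⁻¹ * ((1 + r) ^ 3)⁻¹) ^ 2) (by fun_prop)
    fun r hr => by
      rw [Real.rpow_neg (by positivity)]
      norm_cast
      have : r ^ 2 * (r⁻¹ * ((1 + r) ^ 3)⁻¹) ^ 2 = ((1 + r) ^ 6)⁻¹ := by field_simp
      rw [this]
      gcongr
      · linarith
      · norm_num
  refine lt_of_eq_of_lt ?_ this
  refine lintegral_congr fun p => ?_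
  rw [ker0, ENNReal.ofReal_pow (by have := wt_pos p; positivity)]; rfl

/-- Young's inequality `‖k * F‖₂ ≤ ‖k‖₁ ‖F‖₂`. -/
theorem lintegral_conv_sq_le {k F : V3 → ℝ≥0∞} (hk : Measurable k) (hF : Measurable F) :
    ∫⁻ ξ, (∫⁻ η, k (η - ξ) * F η) ^ 2 ≤ (∫⁻ p, k p) ^ 2 * ∫⁻ η, F η ^ 2 := by
  have e : ∀ ξ, ∫⁻ η, k (η - ξ) = ∫⁻ p, k p := fun ξ => lintegral_sub_right_eq_self k ξ
  have e' : ∀ η, ∫⁻ ξ, k (η - ξ) = ∫⁻ p, k p := fun η => lintegral_sub_left_eq_self k η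
  calc _ ≤ ∫⁻ ξ, (∫⁻ p, k p) * ∫⁻ η, k (η - ξ) * F η ^ 2 := by
        refine lintegral_mono fun ξ => ?_
        refine (lintegral_mul_sq_le volume (by fun_prop) hF).trans ?_
        rw [e]
    _ = (∫⁻ p, k p) * ∫⁻ η, ∫⁻ ξ, k (η - ξ) * F η ^ 2 := by
        rw [lintegral_const_mul _ (Measurable.lintegral_prod_right'
          (f := fun z : V3 × V3 => k (z.2 - z.1) * F z.2 ^ 2) (by fun_prop)),
          lintegral_lintegral_swap]
        exact Measurable.aemeasurable (by fun_prop)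
    _ = _ := by
        have : ∀ η, ∫⁻ ξ, k (η - ξ) * F η ^ 2 = (∫⁻ p, k p) * F η ^ 2 := fun η => by
          rw [lintegral_mul_const _ (by fun_prop), e']
        simp only [this]
        rw [lintegral_const_mul _ (by fun_prop), ← mul_assoc, sq]

/-- The pointwise bound for a convolution with a square integrable kernel. -/
theorem conv_sq_le {k F : V3 → ℝ≥0∞} (hk : Measurable k) (hF : Measurable F) (ξ : V3) :
    (∫⁻ η, k (η - ξ) * F η) ^ 2 ≤ (∫⁻ p, k p ^ 2) * ∫⁻ η, F η ^ 2 := by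
  have e : ∫⁻ η, k (η - ξ) ^ 2 = ∫⁻ p, k p ^ 2 :=
    lintegral_sub_right_eq_self (fun p => k p ^ 2) ξ
  have h := ENNReal.lintegral_mul_le_Lp_mul_Lq volume Real.HolderConjugate.two_two
    (f := fun η => k (η - ξ)) (g := F) (by fun_prop) (by fun_prop)
  simp only [Pi.mul_apply, ENNReal.rpow_two] at h
  calc _ ≤ _ := pow_le_pow_left' h 2
    _ = _ := by
      rw [mul_pow, ← ENNReal.rpow_two, ← ENNReal.rpow_mul, ← ENNReal.rpow_two, ← ENNReal.rpow_mul, e]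
      norm_num

/-- Integrating a Gaussian over the planes orthogonal to a unit vector. -/
theorem lintegral_inner_mul_gaussian (ω : V3) (hω : ‖ω‖ = 1) (c : V3) {a : ℝ}
    {f : ℝ → ℝ≥0∞} (hf : Measurable f) :
    ∫⁻ V : V3, f (inner ℝ V ω) *
        ENNReal.ofReal (Real.exp (-((‖V + c‖ ^ 2 - (inner ℝ (V + c) ω : ℝ) ^ 2) / a)))
      = (∫⁻ s, f s) * ∫⁻ y : ℝ × ℝ, ENNReal.ofReal (Real.exp (-((y.1 ^ 2 + y.2 ^ 2) / a))) := by
  obtain ⟨R, rfl⟩ := exists_isometry_map ω hω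
  rw [← R.measurePreserving.lintegral_comp (by fun_prop)]
  obtain ⟨d, rfl⟩ := R.surjective c
  have e1 : ∀ y : V3, (‖R y + R d‖ ^ 2 - (inner ℝ (R y + R d) (R (EuclideanSpace.single 0 1)) : ℝ) ^ 2)
      = (y 1 + d 1) ^ 2 + (y 2 + d 2) ^ 2 := by
    intro y
    rw [← map_add, R.norm_map, R.inner_map_map, EuclideanSpace.norm_sq_eq, Fin.sum_univ_three,
      EuclideanSpace.inner_single_right]
    simp; ring
  have e2 : ∀ y : V3, (inner ℝ (R y) (R (EuclideanSpace.single 0 1)) : ℝ) = y 0 := by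
    intro y
    rw [R.inner_map_map, EuclideanSpace.inner_single_right]; simp
  simp only [e1, e2]
  rw [lintegral_coords (fun w : ℝ × ℝ × ℝ => f w.1 * ENNReal.ofReal
    (Real.exp (-(((w.2.1 + d 1) ^ 2 + (w.2.2 + d 2) ^ 2) / a)))) (by fun_prop)]
  have e3 : ∀ s : ℝ, ∫⁻ y : ℝ × ℝ, f s * ENNReal.ofReal
      (Real.exp (-(((y.1 + d 1) ^ 2 + (y.2 + d 2) ^ 2) / a))) =
      f s * ∫⁻ y : ℝ × ℝ, ENNReal.ofReal (Real.exp (-((y.1 ^ 2 + y.2 ^ 2) / a))) := by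
    intro s
    rw [lintegral_const_mul _ (by fun_prop)]
    congr 1
    exact lintegral_add_right_eq_self (μ := (volume : Measure (ℝ × ℝ))) (fun y : ℝ × ℝ => ENNReal.ofReal
      (Real.exp (-((y.1 ^ 2 + y.2 ^ 2) / a)))) (d 1, d 2)
  simp only [e3]
  rw [lintegral_mul_const _ hf]

theorem lintegral_gaussian_plane_lt_top {a : ℝ} (ha : 0 < a) :
    ∫⁻ y : ℝ × ℝ, ENNReal.ofReal (Real.exp (-((y.1 ^ 2 + y.2 ^ 2) / a))) < ⊤ := by
  have h1 : ∫⁻ y : ℝ, ENNReal.ofReal (Real.exp (-(y ^ 2 / a))) < ⊤ := by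
    have := (integrable_exp_neg_mul_sq (b := a⁻¹) (by positivity)).lintegral_lt_top
    refine lt_of_eq_of_lt (lintegral_congr fun y => ?_) this
    congr 2; ring
  have : ∀ y : ℝ × ℝ, ENNReal.ofReal (Real.exp (-((y.1 ^ 2 + y.2 ^ 2) / a))) =
      ENNReal.ofReal (Real.exp (-(y.1 ^ 2 / a))) * ENNReal.ofReal (Real.exp (-(y.2 ^ 2 / a))) := by
    intro y
    rw [← ENNReal.ofReal_mul (Real.exp_pos _).le, ← Real.exp_add]
    congr 2; ring
  simp only [this]
  rw [Measure.volume_eq_prod, lintegral_prod_mul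
    (f := fun y : ℝ => ENNReal.ofReal (Real.exp (-(y ^ 2 / a))))
    (g := fun y : ℝ => ENNReal.ofReal (Real.exp (-(y ^ 2 / a)))) (by fun_prop) (by fun_prop)]
  exact ENNReal.mul_lt_top h1 h1

/-- Polar coordinates with lines through the origin instead of rays; each line is counted twice. -/
theorem lintegral_sphere_line (φ : ℝ → ℝ≥0∞) (hφ : Measurable φ) (F : V3 → ℝ≥0∞)
    (hF : Measurable F) :
    ∫⁻ ω : Metric.sphere (0 : V3) 1, ∫⁻ s : ℝ, φ |s| * F (s • (ω : V3))
        ∂volume ∂(volume : Measure V3).toSphere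
      = 2 * ∫⁻ p : V3, ENNReal.ofReal ((‖p‖ ^ 2)⁻¹) * φ ‖p‖ * F p := by
  have hpos : ∫⁻ ω : Metric.sphere (0 : V3) 1, ∫⁻ s in Set.Ioi (0 : ℝ), φ |s| * F (s • (ω : V3))
        ∂volume ∂(volume : Measure V3).toSphere
      = ∫⁻ p : V3, ENNReal.ofReal ((‖p‖ ^ 2)⁻¹) * φ ‖p‖ * F p := by
    rw [lintegral_V3_polar _ (by fun_prop)]
    refine lintegral_congr fun ω => setLIntegral_congr_fun measurableSet_Ioi fun r hr => ?_
    have hr' : 0 < r := hr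
    rw [norm_smul, norm_eq_of_mem_sphere, mul_one, Real.norm_eq_abs, abs_of_pos hr', ← mul_assoc,
      ← mul_assoc, ← ENNReal.ofReal_mul (by positivity), mul_inv_cancel₀ (by positivity)]
    simp
  have hm : ∀ S : Set ℝ, Measurable fun x : V3 => ∫⁻ s in S, φ |s| * F (s • x) := fun S =>
    Measurable.lintegral_prod_right' (f := fun z : V3 × ℝ => φ |z.2| * F (z.2 • z.1)) (by fun_prop)
  have hneg : ∫⁻ ω : Metric.sphere (0 : V3) 1, ∫⁻ s in Set.Iic (0 : ℝ), φ |s| * F (s • (ω : V3))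
        ∂volume ∂(volume : Measure V3).toSphere
      = ∫⁻ ω : Metric.sphere (0 : V3) 1, ∫⁻ s in Set.Ioi (0 : ℝ), φ |s| * F (s • (ω : V3))
        ∂volume ∂(volume : Measure V3).toSphere := by
    rw [← lintegral_sphere_comp_isometry (LinearIsometryEquiv.neg ℝ)
      (fun x => ∫⁻ s in Set.Iic (0 : ℝ), φ |s| * F (s • x)) (hm _)]
    refine lintegral_congr fun ω => ?_
    rw [setLIntegral_congr Iio_ae_eq_Iic.symm,
      ← (Measure.measurePreserving_neg (volume : Measure ℝ)).setLIntegral_comp_preimage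
      measurableSet_Iio (by fun_prop)]
    simp
  rw [← hpos, two_mul]
  nth_rewrite 1 [← hneg]
  refine Eq.trans (lintegral_congr fun ω => ?_)
    (lintegral_add_left ((hm (Set.Iic 0)).comp measurable_subtype_coe) _)
  simp only [Function.comp]
  rw [← lintegral_add_compl _ (measurableSet_Iic (a := (0 : ℝ))), Set.compl_Iic]

/-- The nonlocal part of the linearized operator with all its terms replaced by their absolute
values, and with an additional factor growing with the distance of the velocities involved. -/
def Gas.kAbs (G : Gas) (F : V3 → ℝ≥0∞) (ξ : V3) : ℝ≥0∞ :=
  ∫⁻ p : V3 × Metric.sphere (0 : V3) 1, ENNReal.ofReal |(inner ℝ (ξ - p.1) (p.2 : V3) : ℝ)| *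
    (ENNReal.ofReal (G.w0 p.1 * G.w0 (post ξ p.1 p.2) * wt (postStar ξ p.1 p.2 - ξ)) *
        F (postStar ξ p.1 p.2)
      + ENNReal.ofReal (G.w0 p.1 * G.w0 (postStar ξ p.1 p.2) * wt (post ξ p.1 p.2 - ξ)) *
        F (post ξ p.1 p.2)
      + ENNReal.ofReal (G.w0 ξ * G.w0 p.1 * wt (p.1 - ξ)) * F p.1) ∂part

theorem lintegral_part_translate {F : V3 × Metric.sphere (0 : V3) 1 → ℝ≥0∞} (hF : Measurable F)
    (ξ : V3) : ∫⁻ p, F p ∂part = ∫⁻ V : V3, ∫⁻ ω, F (ξ + V, ω) ∂(volume : Measure V3).toSphere := by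
  rw [lintegral_prod _ hF.aemeasurable]
  exact (lintegral_add_left_eq_self (fun V => ∫⁻ ω, F (V, ω) ∂(volume : Measure V3).toSphere) ξ).symm

theorem post_add (ξ V w : V3) : post ξ (ξ + V) w = ξ + (inner ℝ V w : ℝ) • w := by
  have : ξ - (ξ + V) = -V := by abel
  rw [post, this, inner_neg_left]; module

theorem postStar_add (ξ V w : V3) :
    postStar ξ (ξ + V) w = ξ + (V - (inner ℝ V w : ℝ) • w) := by
  have : ξ - (ξ + V) = -V := by abel
  rw [postStar, this, inner_neg_left]; module

/-- For a fixed `ω` the gain term depends on `V = ξ_* - ξ` through `V · ω` and a Gaussian in the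
components of `ξ_*` orthogonal to `ω`. These are integrated out; what remains is an integral over
the lines `ξ + s ω`, that is, a convolution in polar coordinates around `ξ`. -/
theorem Gas.Admissible.gain_kernel_le (hG : G.Admissible) :
    ∃ C : ℝ≥0∞, C < ⊤ ∧ ∀ F : V3 → ℝ≥0∞, Measurable F → ∀ ξ,
      ∫⁻ p : V3 × Metric.sphere (0 : V3) 1, ENNReal.ofReal |(inner ℝ (ξ - p.1) (p.2 : V3) : ℝ)| *
        (ENNReal.ofReal (G.w0 p.1 * G.w0 (postStar ξ p.1 p.2) * wt (post ξ p.1 p.2 - ξ)) *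
        F (post ξ p.1 p.2)) ∂part ≤ C * ∫⁻ η, ker0 (η - ξ) * F η := by
  have hT := hG.temp_pos
  have hc := hG.w0c_pos
  obtain ⟨C, hC, hexp⟩ := exists_pow_mul_exp_neg_sq_le (a := 8 * G.temp) (by positivity) 4
  set Kc := ∫⁻ y : ℝ × ℝ, ENNReal.ofReal (Real.exp (-((y.1 ^ 2 + y.2 ^ 2) / (2 * G.temp))))
  have hKc : Kc < ⊤ := lintegral_gaussian_plane_lt_top (by positivity)
  refine ⟨2 * Kc * ENNReal.ofReal (G.w0c ^ 2 * C), ENNReal.mul_lt_top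
    (ENNReal.mul_lt_top (by norm_num) hKc) ENNReal.ofReal_lt_top, fun F hF ξ => ?_⟩
  rw [lintegral_part_translate (by fun_prop) ξ, lintegral_lintegral_swap
    (Measurable.aemeasurable (by fun_prop))]
  let φ : ℝ → ℝ≥0∞ := fun s => ENNReal.ofReal (s * (G.w0c ^ 2 * (C * ((1 + s) ^ 3)⁻¹)))
  have hφ : Measurable φ := by fun_prop
  have key : ∀ ω : Metric.sphere (0 : V3) 1, ∀ V : V3,
      ENNReal.ofReal |(inner ℝ (ξ - (ξ + V)) (ω : V3) : ℝ)| * (ENNReal.ofReal (G.w0 (ξ + V) *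
        G.w0 (postStar ξ (ξ + V) ω) * wt (post ξ (ξ + V) ω - ξ)) * F (post ξ (ξ + V) ω))
      ≤ (fun s : ℝ => φ |s| * F (ξ + s • (ω : V3))) (inner ℝ V (ω : V3)) *
        ENNReal.ofReal (Real.exp (-((‖V + (ξ - G.u)‖ ^ 2
          - (inner ℝ (V + (ξ - G.u)) (ω : V3) : ℝ) ^ 2) / (2 * G.temp)))) := by
    intro ω V
    have e0 : ξ - (ξ + V) = -V := by abel
    rw [post_add, postStar_add, e0, inner_neg_left, abs_neg, add_sub_cancel_left]
    set s : ℝ := inner ℝ V (ω : V3)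
    set a : V3 := V + (ξ - G.u)
    have hn : wt (s • (ω : V3)) = 1 + |s| := by
      rw [wt, norm_smul, norm_eq_of_mem_sphere, mul_one, Real.norm_eq_abs]
    have h1 : G.w0 (ξ + V) * G.w0 (ξ + (V - s • (ω : V3))) ≤ G.w0c ^ 2 *
        (Real.exp (-(|s| ^ 2 / (8 * G.temp))) *
        Real.exp (-((‖a‖ ^ 2 - (inner ℝ a (ω : V3) : ℝ) ^ 2) / (2 * G.temp)))) := by
      have ea : ξ + V - G.u = a := by simp only [a]; abel
      have eb : ξ + (V - s • (ω : V3)) - G.u = a - s • (ω : V3) := by simp only [a]; abel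
      rw [G.w0_eq, G.w0_eq, ea, eb, mul_mul_mul_comm, ← Real.exp_add, ← sq, ← Real.exp_add]
      refine mul_le_mul_of_nonneg_left (Real.exp_le_exp.2 ?_) (by positivity)
      rw [norm_sub_sq_real, inner_smul_right, norm_smul, norm_eq_of_mem_sphere, mul_one,
        Real.norm_eq_abs, sq_abs]
      set α : ℝ := inner ℝ a (ω : V3)
      rw [← sub_nonneg]
      have : -(s ^ 2 / (8 * G.temp)) + -((‖a‖ ^ 2 - α ^ 2) / (2 * G.temp)) -
          (-(‖a‖ ^ 2 / (4 * G.temp)) + -((‖a‖ ^ 2 - 2 * (s * α) + s ^ 2) / (4 * G.temp)))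
          = (2 * α - s) ^ 2 / (8 * G.temp) := by field_simp; ring
      rw [this]; positivity
    have h2 : Real.exp (-(|s| ^ 2 / (8 * G.temp))) * (1 + |s|) ≤ C * ((1 + |s|) ^ 3)⁻¹ := by
      have hp : 0 < 1 + |s| := by positivity
      rw [← div_eq_mul_inv, le_div_iff₀ (by positivity)]
      refine le_trans (le_of_eq ?_) (hexp |s| (abs_nonneg s))
      ring
    have hF' : ∀ x : ℝ≥0∞, ∀ y : ℝ, x ≤ φ |s| * ENNReal.ofReal y → x * F (ξ + s • (ω : V3))
        ≤ φ |s| * F (ξ + s • (ω : V3)) * ENNReal.ofReal y := by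
      intro x y hx
      rw [mul_right_comm]; gcongr
    rw [← mul_assoc]
    refine hF' _ _ ?_
    rw [← ENNReal.ofReal_mul (abs_nonneg _), ← ENNReal.ofReal_mul (by positivity), hn]
    refine ENNReal.ofReal_le_ofReal ?_
    rw [mul_assoc (|s|)]
    refine mul_le_mul_of_nonneg_left ?_ (abs_nonneg s)
    calc _ ≤ G.w0c ^ 2 * (Real.exp (-(|s| ^ 2 / (8 * G.temp))) *
        Real.exp (-((‖a‖ ^ 2 - (inner ℝ a (ω : V3) : ℝ) ^ 2) / (2 * G.temp)))) * (1 + |s|) := by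
          gcongr
      _ = G.w0c ^ 2 * (Real.exp (-(|s| ^ 2 / (8 * G.temp))) * (1 + |s|)) *
        Real.exp (-((‖a‖ ^ 2 - (inner ℝ a (ω : V3) : ℝ) ^ 2) / (2 * G.temp))) := by ring
      _ ≤ _ := by gcongr
  calc _ ≤ ∫⁻ ω : Metric.sphere (0 : V3) 1, (∫⁻ s : ℝ, φ |s| * F (ξ + s • (ω : V3))) * Kc
        ∂(volume : Measure V3).toSphere := by
        refine lintegral_mono fun ω => ?_
        refine (lintegral_mono (key ω)).trans (le_of_eq ?_)
        exact lintegral_inner_mul_gaussian (ω : V3) (norm_eq_of_mem_sphere ω) (ξ - G.u)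
          (f := fun s : ℝ => φ |s| * F (ξ + s • (ω : V3))) (by fun_prop)
    _ = (2 * ∫⁻ p : V3, ENNReal.ofReal ((‖p‖ ^ 2)⁻¹) * φ ‖p‖ * F (ξ + p)) * Kc := by
        rw [lintegral_mul_const, lintegral_sphere_line φ hφ (fun x => F (ξ + x)) (by fun_prop)]
        exact (Measurable.lintegral_prod_right' (f := fun z : V3 × ℝ => φ |z.2| *
          F (ξ + z.2 • z.1)) (by fun_prop)).comp measurable_subtype_coe
    _ = (2 * ∫⁻ p : V3, ENNReal.ofReal (G.w0c ^ 2 * C) * (ker0 p * F (ξ + p))) * Kc := by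
        congr 2
        refine lintegral_congr fun p => ?_
        rw [← mul_assoc]
        congr 1
        rw [ker0, ← ENNReal.ofReal_mul (by positivity), ← ENNReal.ofReal_mul (by positivity)]
        congr 1
        rcases eq_or_ne ‖p‖ 0 with h0 | h0
        · simp [h0]
        · unfold wt; field_simp
    _ = _ := by
        rw [lintegral_const_mul _ (by fun_prop)]
        have : ∫⁻ p, ker0 p * F (ξ + p) = ∫⁻ η, ker0 (η - ξ) * F η := by
          rw [← lintegral_add_left_eq_self (fun η => ker0 (η - ξ) * F η) ξ]
          simp only [add_sub_cancel_left]
        rw [this]; ring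

/-- The nonlocal part of the linearized operator is dominated by a convolution operator. The
singularity `|p|⁻¹` comes from the polar coordinates around `ξ`, and the term with `ξ_*'` is turned
into the one with `ξ'` by `lintegral_sphere_exchange`. -/
theorem Gas.Admissible.kAbs_le (hG : G.Admissible) :
    ∃ C : ℝ≥0∞, C < ⊤ ∧ ∀ F : V3 → ℝ≥0∞, Measurable F → ∀ ξ,
      G.kAbs F ξ ≤ C * ∫⁻ η, ker0 (η - ξ) * F η := by
  have hT := hG.temp_pos
  have hc := hG.w0c_pos
  obtain ⟨C₁, hC₁, hgain⟩ := hG.gain_kernel_le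
  obtain ⟨C, hC, hexp⟩ := exists_pow_mul_exp_neg_sq_le (a := 8 * G.temp) (by positivity) 6
  refine ⟨C₁ + C₁ + area * ENNReal.ofReal (G.w0c ^ 2 * C), by
    simp only [ENNReal.add_lt_top, hC₁, true_and]
    exact ENNReal.mul_lt_top area_lt_top ENNReal.ofReal_lt_top, fun F hF ξ => ?_⟩
  rw [Gas.kAbs]
  simp only [mul_add]
  rw [lintegral_add_right _ (by fun_prop), lintegral_add_right _ (by fun_prop), add_mul, add_mul]
  refine add_le_add (add_le_add ?_ (hgain F hF ξ)) ?_
  · refine le_trans (le_of_eq ?_) (hgain F hF ξ)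
    rw [lintegral_part_translate (by fun_prop) ξ, lintegral_part_translate (by fun_prop) ξ]
    refine lintegral_congr fun V => ?_
    have e0 : ξ - (ξ + V) = -V := by abel
    simp only [post_add, postStar_add, e0, inner_neg_left, abs_neg, add_sub_cancel_left]
    have := lintegral_sphere_exchange (fun p => ENNReal.ofReal (G.w0 (ξ + V) *
      G.w0 (ξ + (V - p)) * wt p) * F (ξ + p)) (by fun_prop) V
    simp only [sub_sub_cancel] at this
    exact this.symm
  · have hW : ∀ η, G.w0 ξ * G.w0 η ≤ G.w0c ^ 2 * Real.exp (-(‖η - ξ‖ ^ 2 / (8 * G.temp))) := by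
      intro η
      rw [G.w0_eq, G.w0_eq, mul_mul_mul_comm, ← Real.exp_add, ← sq]
      gcongr
      have h1 : η - ξ = (η - G.u) - (ξ - G.u) := by abel
      have h2 := parallelogram_law_with_norm ℝ (η - G.u) (ξ - G.u)
      rw [← h1] at h2
      rw [← sub_nonneg]
      have : -(‖η - ξ‖ ^ 2 / (8 * G.temp)) - (-(‖ξ - G.u‖ ^ 2 / (4 * G.temp)) +
        -(‖η - G.u‖ ^ 2 / (4 * G.temp))) = (‖η - G.u + (ξ - G.u)‖ ^ 2) / (8 * G.temp) := by
        field_simp; linarith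
      rw [this]; positivity
    have hpt : ∀ p : V3 × Metric.sphere (0 : V3) 1,
        ENNReal.ofReal |(inner ℝ (ξ - p.1) (p.2 : V3) : ℝ)| *
          (ENNReal.ofReal (G.w0 ξ * G.w0 p.1 * wt (p.1 - ξ)) * F p.1)
        ≤ (fun η => ENNReal.ofReal (G.w0c ^ 2 * C) * (ker0 (η - ξ) * F η)) p.1 := by
      intro p
      simp only
      rw [← mul_assoc, ← mul_assoc]
      gcongr ?_ * _
      rw [show ker0 (p.1 - ξ) = ENNReal.ofReal (‖p.1 - ξ‖⁻¹ * (wt (p.1 - ξ) ^ 3)⁻¹) from rfl,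
        ← ENNReal.ofReal_mul (abs_nonneg _), ← ENNReal.ofReal_mul (by positivity)]
      refine ENNReal.ofReal_le_ofReal ?_
      have hi : |(inner ℝ (ξ - p.1) (p.2 : V3) : ℝ)| ≤ ‖p.1 - ξ‖ := by
        refine (abs_real_inner_le_norm _ _).trans ?_
        rw [norm_eq_of_mem_sphere, mul_one, norm_sub_rev]
      have hw := wt_pos (p.1 - ξ)
      have hwd : wt (p.1 - ξ) = 1 + ‖p.1 - ξ‖ := rfl
      have hx := hexp ‖p.1 - ξ‖ (norm_nonneg _)
      rcases eq_or_ne ‖p.1 - ξ‖ 0 with h0 | h0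
      · rw [h0] at hi ⊢
        have : |(inner ℝ (ξ - p.1) (p.2 : V3) : ℝ)| = 0 := le_antisymm hi (abs_nonneg _)
        rw [this]; simp
      have h0' : 0 < ‖p.1 - ξ‖ := lt_of_le_of_ne (norm_nonneg _) h0.symm
      set r := ‖p.1 - ξ‖
      calc _ ≤ r * ((G.w0c ^ 2 * Real.exp (-(r ^ 2 / (8 * G.temp)))) * wt (p.1 - ξ)) := by
            have h1 := G.w0_nonneg ξ
            have h2 := G.w0_nonneg p.1
            exact mul_le_mul hi (mul_le_mul_of_nonneg_right (hW _) hw.le) (by positivity)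
              (norm_nonneg _)
        _ = G.w0c ^ 2 * (r⁻¹ * (wt (p.1 - ξ) ^ 3)⁻¹) *
            (r ^ 2 * (wt (p.1 - ξ)) ^ 4 * Real.exp (-(r ^ 2 / (8 * G.temp)))) := by
            field_simp
        _ ≤ G.w0c ^ 2 * (r⁻¹ * (wt (p.1 - ξ) ^ 3)⁻¹) * C := by
            gcongr
            refine le_trans ?_ hx
            gcongr
            rw [hwd]
            have : r ^ 2 ≤ (1 + r) ^ 2 := by gcongr; linarith
            nlinarith [pow_pos (by positivity : 0 < 1 + r) 4]
        _ = _ := by ring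
    refine (lintegral_mono hpt).trans ?_
    rw [lintegral_part_fst (X := fun η => ENNReal.ofReal (G.w0c ^ 2 * C) * (ker0 (η - ξ) * F η))
      (by fun_prop), lintegral_const_mul _ (by fun_prop), mul_assoc]

/-! ### The linearized operator as frequency and nonlocal part -/

theorem Gas.measurable_kAbs {F : V3 → ℝ≥0∞} (hF : Measurable F) : Measurable (G.kAbs F) :=
  Measurable.lintegral_prod_right' (f := fun z : V3 × V3 × Metric.sphere (0 : V3) 1 =>
    ENNReal.ofReal |(inner ℝ (z.1 - z.2.1) (z.2.2 : V3) : ℝ)| *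
    (ENNReal.ofReal (G.w0 z.2.1 * G.w0 (post z.1 z.2.1 z.2.2) *
        wt (postStar z.1 z.2.1 z.2.2 - z.1)) * F (postStar z.1 z.2.1 z.2.2)
      + ENNReal.ofReal (G.w0 z.2.1 * G.w0 (postStar z.1 z.2.1 z.2.2) *
        wt (post z.1 z.2.1 z.2.2 - z.1)) * F (post z.1 z.2.1 z.2.2)
      + ENNReal.ofReal (G.w0 z.1 * G.w0 z.2.1 * wt (z.2.1 - z.1)) * F z.2.1)) (by fun_prop)

theorem Gas.Admissible.kAbs_bounds (hG : G.Admissible) :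
    ∃ C : ℝ≥0∞, C < ⊤ ∧ ∀ F : V3 → ℝ≥0∞, Measurable F →
      (∀ ξ, G.kAbs F ξ ^ 2 ≤ C * ∫⁻ η, F η ^ 2) ∧
      ∫⁻ ξ, G.kAbs F ξ ^ 2 ≤ C * ∫⁻ η, F η ^ 2 := by
  obtain ⟨C, hC, hk⟩ := hG.kAbs_le
  have h1 := lintegral_ker0_lt_top
  have h2 := lintegral_ker0_sq_lt_top
  refine ⟨C ^ 2 * ((∫⁻ p, ker0 p) ^ 2 + ∫⁻ p, ker0 p ^ 2), ?_, fun F hF => ⟨fun ξ => ?_, ?_⟩⟩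
  · exact ENNReal.mul_lt_top (ENNReal.pow_lt_top hC)
      (ENNReal.add_lt_top.2 ⟨ENNReal.pow_lt_top h1, h2⟩)
  · calc _ ≤ (C * ∫⁻ η, ker0 (η - ξ) * F η) ^ 2 := by gcongr; exact hk F hF ξ
      _ ≤ C ^ 2 * ((∫⁻ p, ker0 p ^ 2) * ∫⁻ η, F η ^ 2) := by
          rw [mul_pow]; gcongr; exact conv_sq_le (by fun_prop) hF ξ
      _ ≤ _ := by rw [← mul_assoc]; gcongr; exact le_add_self
  · calc _ ≤ ∫⁻ ξ, C ^ 2 * (∫⁻ η, ker0 (η - ξ) * F η) ^ 2 := by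
          refine lintegral_mono fun ξ => ?_
          rw [← mul_pow]; gcongr; exact hk F hF ξ
      _ ≤ C ^ 2 * ((∫⁻ p, ker0 p) ^ 2 * ∫⁻ η, F η ^ 2) := by
          rw [lintegral_const_mul']
          · gcongr; exact lintegral_conv_sq_le (by fun_prop) hF
          · exact (ENNReal.pow_lt_top hC).ne
      _ ≤ _ := by rw [← mul_assoc]; gcongr; exact le_self_add

/-- Integrand of the nonlocal part of the linearized operator. -/
def Gas.nlInt (G : Gas) (f : V3 → ℝ) (ξ : V3) (p : V3 × Metric.sphere (0 : V3) 1) : ℝ :=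
  |(inner ℝ (ξ - p.1) (p.2 : V3) : ℝ)| *
    (G.w0 p.1 * G.w0 (post ξ p.1 p.2) * f (postStar ξ p.1 p.2)
      + G.w0 p.1 * G.w0 (postStar ξ p.1 p.2) * f (post ξ p.1 p.2)
      - G.w0 ξ * G.w0 p.1 * f p.1)

/-- The nonlocal part of the linearized operator, up to the factor `ρ σ₀`. -/
def Gas.nl (G : Gas) (f : V3 → ℝ) (ξ : V3) : ℝ := ∫ p, G.nlInt f ξ p ∂part

/-- The collision frequency, up to the factor `ρ σ₀`. -/
def Gas.freq (G : Gas) (ξ : V3) : ℝ :=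
  ∫ p : V3 × Metric.sphere (0 : V3) 1, |(inner ℝ (ξ - p.1) (p.2 : V3) : ℝ)| * G.w0 p.1 ^ 2 ∂part

theorem Gas.measurable_uncurry_nlInt {f : V3 → ℝ} (hf : Measurable f) :
    Measurable (fun z : V3 × V3 × Metric.sphere (0 : V3) 1 => G.nlInt f z.1 z.2) := by
  unfold Gas.nlInt; fun_prop

theorem Gas.measurable_nlInt {f : V3 → ℝ} (hf : Measurable f) (ξ : V3) :
    Measurable (G.nlInt f ξ) := by
  unfold Gas.nlInt; fun_prop

theorem Gas.measurable_nl {f : V3 → ℝ} (hf : Measurable f) : Measurable (G.nl f) :=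
  (StronglyMeasurable.integral_prod_right' (f := fun z : V3 × V3 × Metric.sphere (0 : V3) 1 =>
    G.nlInt f z.1 z.2) (G.measurable_uncurry_nlInt hf).stronglyMeasurable).measurable

theorem Gas.lintegral_nlInt_le {f : V3 → ℝ} (ξ : V3) :
    ∫⁻ p, ‖G.nlInt f ξ p‖ₑ ∂part ≤ G.kAbs (fun η => ‖f η‖ₑ) ξ := by
  refine lintegral_mono fun p => ?_
  have hb : ∀ (x y t : ℝ) (ζ : V3), 0 ≤ x → 0 ≤ y → ‖x * y * t‖ₑ ≤ ENNReal.ofReal (x * y * wt ζ) * ‖t‖ₑ := by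
    intro x y t ζ hx hy
    rw [enorm_mul]
    gcongr
    rw [Real.enorm_of_nonneg (by positivity)]
    exact ENNReal.ofReal_le_ofReal (le_mul_of_one_le_right (by positivity) (one_le_wt ζ))
  rw [Gas.nlInt, enorm_mul, Real.enorm_of_nonneg (abs_nonneg _)]
  have hw := G.w0_nonneg
  gcongr
  refine enorm_sub_le.trans (add_le_add ((enorm_add_le _ _).trans (add_le_add ?_ ?_)) ?_)
  · exact hb _ _ _ _ (hw _) (hw _)
  · exact hb _ _ _ _ (hw _) (hw _)
  · exact hb _ _ _ _ (hw _) (hw _)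

theorem Gas.enorm_nl_le {f : V3 → ℝ} (ξ : V3) :
    ‖G.nl f ξ‖ₑ ≤ G.kAbs (fun η => ‖f η‖ₑ) ξ :=
  (enorm_integral_le_lintegral_enorm _).trans (G.lintegral_nlInt_le ξ)

theorem Gas.Admissible.integrable_nlInt (hG : G.Admissible) {f : V3 → ℝ} (hf : Measurable f)
    (h2 : ∫⁻ η, ‖f η‖ₑ ^ 2 < ⊤) (ξ : V3) : Integrable (G.nlInt f ξ) part := by
  obtain ⟨C, hC, hk⟩ := hG.kAbs_bounds
  refine ⟨(G.measurable_nlInt hf ξ).aestronglyMeasurable, (G.lintegral_nlInt_le ξ).trans_lt ?_⟩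
  have := ((hk (fun η => ‖f η‖ₑ) (by fun_prop)).1 ξ).trans_lt (ENNReal.mul_lt_top hC h2)
  by_contra h
  rw [not_lt, top_le_iff] at h
  rw [h] at this
  simp at this

theorem Gas.nlInt_add (f g : V3 → ℝ) (ξ : V3) (p) :
    G.nlInt (f + g) ξ p = G.nlInt f ξ p + G.nlInt g ξ p := by
  simp only [Gas.nlInt, Pi.add_apply]; ring

theorem Gas.nlInt_smul (c : ℝ) (f : V3 → ℝ) (ξ : V3) (p) :
    G.nlInt (c • f) ξ p = c * G.nlInt f ξ p := by
  simp only [Gas.nlInt, Pi.smul_apply, smul_eq_mul]; ring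

/-- Mean of `|ω₁|` over the sphere, up to normalization. -/
def meanAbs : ℝ≥0∞ := ∫⁻ ω : Metric.sphere (0 : V3) 1, ENNReal.ofReal |(ω : V3) 0|
  ∂(volume : Measure V3).toSphere

theorem lintegral_sphere_abs_inner (V : V3) :
    ∫⁻ ω : Metric.sphere (0 : V3) 1, ENNReal.ofReal |(inner ℝ V (ω : V3) : ℝ)|
      ∂(volume : Measure V3).toSphere = ENNReal.ofReal ‖V‖ * meanAbs := by
  by_cases hV : V = 0
  · simp [hV]
  have hV' : 0 < ‖V‖ := norm_pos_iff.2 hV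
  obtain ⟨R, hR⟩ := exists_isometry_map (‖V‖⁻¹ • V) (by simp [norm_smul, hV])
  have hVR : V = ‖V‖ • R (EuclideanSpace.single 0 1) := by
    rw [hR, smul_smul, mul_inv_cancel₀ hV'.ne', one_smul]
  have hin : ∀ ω : V3, |(inner ℝ V (R ω) : ℝ)| = ‖V‖ * |ω 0| := by
    intro ω
    conv_lhs => rw [hVR]
    rw [inner_smul_left, R.inner_map_map]
    simp [EuclideanSpace.inner_single_left, abs_mul]
  rw [← lintegral_sphere_comp_isometry R (fun ω => ENNReal.ofReal |(inner ℝ V ω : ℝ)|) (by fun_prop)]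
  simp only [hin, ENNReal.ofReal_mul hV'.le]
  have hm0 : Measurable fun x : V3 => x 0 := by fun_prop
  rw [lintegral_const_mul _ (by fun_prop)]; rfl

theorem meanAbs_pos : 0 < meanAbs := by
  rw [pos_iff_ne_zero, meanAbs, lintegral_sphere_eq (fun x => ENNReal.ofReal |x 0|)
    (by have hm0 : Measurable fun x : V3 => x 0 := by fun_prop
        fun_prop)]
  intro h
  have hm0 : Measurable fun x : V3 => x 0 := by fun_prop
  rw [mul_eq_zero, or_iff_right (by norm_num), lintegral_eq_zero_iff (by fun_prop)] at h
  have h1 := (ae_restrict_iff' measurableSet_ball).1 h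
  have h2 : ∀ᵐ x : V3, x ∉ {x : V3 | ‖x‖ < 1 ∧ 0 < x 0} := by
    filter_upwards [h1] with x hx hx'
    have := hx (by simpa using hx'.1)
    simp only [Pi.zero_apply, ENNReal.ofReal_eq_zero] at this
    have h4 : x 0 ≠ 0 := hx'.2.ne'
    have h3 : x ≠ 0 := by rintro rfl; simp at h4
    have : (‖x‖⁻¹ • x) 0 = 0 := abs_nonpos_iff.1 this
    simp [h3, h4] at this
  have ho : IsOpen {x : V3 | ‖x‖ < 1 ∧ 0 < x 0} :=
    (isOpen_lt continuous_norm continuous_const).inter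
      (isOpen_lt continuous_const (by fun_prop : Continuous fun x : V3 => x 0))
  have hne : {x : V3 | ‖x‖ < 1 ∧ 0 < x 0}.Nonempty :=
    ⟨EuclideanSpace.single 0 (1 / 2), by simp; norm_num⟩
  exact (ho.measure_pos volume hne).ne' (by simpa [ae_iff] using h2)

theorem Gas.lintegral_freq (ξ : V3) :
    ∫⁻ p : V3 × Metric.sphere (0 : V3) 1, ENNReal.ofReal (|(inner ℝ (ξ - p.1) (p.2 : V3) : ℝ)| *
      G.w0 p.1 ^ 2) ∂part = meanAbs * ∫⁻ η, ENNReal.ofReal (‖ξ - η‖ * G.w0 η ^ 2) := by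
  rw [lintegral_prod _ (by fun_prop), ← lintegral_const_mul _ (by fun_prop)]
  refine lintegral_congr fun η => ?_
  simp only [ENNReal.ofReal_mul (abs_nonneg _), ENNReal.ofReal_mul (norm_nonneg _)]
  rw [lintegral_mul_const _ (by fun_prop), lintegral_sphere_abs_inner]; ring

/-- The collision frequency of hard spheres grows exactly linearly. -/
theorem Gas.Admissible.freq_bounds (hG : G.Admissible) :
    ∃ c C : ℝ, 0 < c ∧ 0 < C ∧ ∀ ξ,
      (∫⁻ p : V3 × Metric.sphere (0 : V3) 1, ENNReal.ofReal
        (|(inner ℝ (ξ - p.1) (p.2 : V3) : ℝ)| * G.w0 p.1 ^ 2) ∂part = ENNReal.ofReal (G.freq ξ)) ∧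
      c * wt ξ ≤ G.freq ξ ∧ G.freq ξ ≤ C * wt ξ := by
  obtain ⟨C5, hC5, hW5⟩ := hG.w0_decay 5
  have hmA : meanAbs < ⊤ := by
    refine lt_of_le_of_lt (b := area * 1) ?_ (ENNReal.mul_lt_top area_lt_top (by simp))
    rw [mul_comm]
    refine (lintegral_mono fun ω => ?_).trans (le_of_eq (lintegral_const _))
    rw [ENNReal.ofReal_le_one]
    have := PiLp.norm_apply_le (ω : V3) 0
    rwa [norm_eq_of_mem_sphere, Real.norm_eq_abs] at this
  -- upper bound
  have hM : ∃ M : ℝ≥0∞, M < ⊤ ∧ ∀ ξ : V3, ∫⁻ η, ENNReal.ofReal (‖ξ - η‖ * G.w0 η ^ 2)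
      ≤ ENNReal.ofReal (wt ξ) * M := by
    refine ⟨∫⁻ η : V3, ENNReal.ofReal (C5 ^ 2) * ENNReal.ofReal (wt η ^ (-(9 : ℝ))), ?_, fun ξ => ?_⟩
    · rw [lintegral_const_mul _ (by fun_prop)]
      exact ENNReal.mul_lt_top ENNReal.ofReal_lt_top (lintegral_wt_rpow_lt_top (by norm_num))
    · rw [← lintegral_const_mul _ (by fun_prop)]
      refine lintegral_mono fun η => ?_
      have hη := wt_pos η
      have hξ := wt_pos ξ
      rw [← ENNReal.ofReal_mul (by positivity), ← ENNReal.ofReal_mul (by positivity)]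
      refine ENNReal.ofReal_le_ofReal ?_
      have h1 : ‖ξ - η‖ ≤ wt ξ * wt η := by
        refine (norm_sub_le _ _).trans ?_
        unfold wt; nlinarith [norm_nonneg ξ, norm_nonneg η]
      have h2 : G.w0 η ≤ C5 / wt η ^ 5 := by
        rw [le_div_iff₀ (by positivity)]; exact hW5 η
      have h0 := G.w0_nonneg η
      calc _ ≤ (wt ξ * wt η) * (C5 / wt η ^ 5) ^ 2 := by gcongr
        _ = _ := by
          rw [Real.rpow_neg hη.le]; norm_cast; field_simp
  obtain ⟨M, hM, hup⟩ := hM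
  -- lower bound by symmetrization around `u`
  set m0 : ℝ≥0∞ := ∫⁻ η, ENNReal.ofReal (G.w0 η ^ 2)
  set m1 : ℝ≥0∞ := ∫⁻ η, ENNReal.ofReal (‖η - G.u‖ * G.w0 η ^ 2)
  have hlow : ∀ ξ, ENNReal.ofReal ‖ξ - G.u‖ * m0 + m1 ≤
      2 * ∫⁻ η, ENNReal.ofReal (‖ξ - η‖ * G.w0 η ^ 2) := by
    intro ξ
    have hrefl : ∫⁻ η, ENNReal.ofReal (‖ξ - η‖ * G.w0 η ^ 2) =
        ∫⁻ η, ENNReal.ofReal (‖ξ - ((2 : ℝ) • G.u - η)‖ * G.w0 η ^ 2) := by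
      rw [← lintegral_sub_left_eq_self _ ((2 : ℝ) • G.u)]
      refine lintegral_congr fun η => ?_
      have : G.w0 ((2 : ℝ) • G.u - η) = G.w0 η := by
        rw [G.w0_eq, G.w0_eq]
        have : (2 : ℝ) • G.u - η - G.u = -(η - G.u) := by module
        rw [this, norm_neg]
      rw [this]
    rw [two_mul]
    nth_rewrite 2 [hrefl]
    rw [← lintegral_add_left (by fun_prop), ← lintegral_const_mul _ (by fun_prop),
      ← lintegral_add_left (by fun_prop)]
    refine lintegral_mono fun η => ?_
    have h0 := G.w0_nonneg η
    rw [← ENNReal.ofReal_mul (by positivity), ← ENNReal.ofReal_add (by positivity) (by positivity),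
      ← ENNReal.ofReal_add (by positivity) (by positivity)]
    refine ENNReal.ofReal_le_ofReal ?_
    rw [← add_mul, ← add_mul]
    refine mul_le_mul_of_nonneg_right ?_ (by positivity)
    have h1 : (2 : ℝ) • (ξ - G.u) = (ξ - η) + (ξ - ((2 : ℝ) • G.u - η)) := by module
    have h2 : (2 : ℝ) • (η - G.u) = (ξ - ((2 : ℝ) • G.u - η)) - (ξ - η) := by module
    have h3 := norm_add_le (ξ - η) (ξ - ((2 : ℝ) • G.u - η))
    have h4 := norm_sub_le (ξ - ((2 : ℝ) • G.u - η)) (ξ - η)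
    rw [← h1, norm_smul] at h3
    rw [← h2, norm_smul] at h4
    norm_num at h3 h4
    linarith
  have hfin : ∀ ξ, meanAbs * ∫⁻ η, ENNReal.ofReal (‖ξ - η‖ * G.w0 η ^ 2) < ⊤ := fun ξ =>
    ENNReal.mul_lt_top hmA ((hup ξ).trans_lt (ENNReal.mul_lt_top ENNReal.ofReal_lt_top hM))
  have heq : ∀ ξ, ∫⁻ p : V3 × Metric.sphere (0 : V3) 1, ENNReal.ofReal
        (|(inner ℝ (ξ - p.1) (p.2 : V3) : ℝ)| * G.w0 p.1 ^ 2) ∂part = ENNReal.ofReal (G.freq ξ) := by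
    intro ξ
    rw [Gas.freq, ofReal_integral_eq_lintegral_ofReal]
    · refine ⟨Measurable.aestronglyMeasurable (by fun_prop), ?_⟩
      have := hfin ξ
      rw [← G.lintegral_freq] at this
      refine lt_of_eq_of_lt (lintegral_congr fun p => ?_) this
      rw [Real.enorm_of_nonneg (by positivity)]
    · exact ae_of_all _ fun p => by positivity
  have hfpos : ∀ ξ, 0 ≤ G.freq ξ := fun ξ => integral_nonneg fun p => by positivity
  have hW0 := hG.w0_pos
  have hm0 : 0 < m0 := by
    rw [pos_iff_ne_zero]
    intro h
    rw [lintegral_eq_zero_iff (by fun_prop)] at h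
    obtain ⟨η, hη⟩ := h.exists
    simp only [Pi.zero_apply, ENNReal.ofReal_eq_zero] at hη
    have := hW0 η
    nlinarith
  have hm1 : 0 < m1 := by
    rw [pos_iff_ne_zero]
    intro h
    rw [lintegral_eq_zero_iff (by fun_prop)] at h
    have hne : ∀ᵐ η : V3, η ≠ G.u := by simp [ae_iff]
    obtain ⟨η, hη, hη'⟩ := (h.and hne).exists
    simp only [Pi.zero_apply, ENNReal.ofReal_eq_zero] at hη
    have := hW0 η
    have h2 : 0 < ‖η - G.u‖ := norm_pos_iff.2 (sub_ne_zero.2 hη')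
    have : 0 < ‖η - G.u‖ * G.w0 η ^ 2 := by positivity
    linarith
  have hm0t : m0 < ⊤ ∧ m1 < ⊤ := by
    have h2 : 2 * ∫⁻ η, ENNReal.ofReal (‖(EuclideanSpace.single 0 1 + G.u : V3) - η‖ * G.w0 η ^ 2) < ⊤ :=
      ENNReal.mul_lt_top (by norm_num) ((hup _).trans_lt (ENNReal.mul_lt_top ENNReal.ofReal_lt_top hM))
    have := (hlow (EuclideanSpace.single 0 1 + G.u)).trans_lt h2
    simpa [ENNReal.add_lt_top] using this
  set a := min m0.toReal m1.toReal
  have ha : 0 < a := lt_min (ENNReal.toReal_pos hm0.ne' hm0t.1.ne) (ENNReal.toReal_pos hm1.ne' hm0t.2.ne)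
  have hmpos : 0 < meanAbs.toReal := ENNReal.toReal_pos meanAbs_pos.ne' hmA.ne
  refine ⟨meanAbs.toReal * (a / (2 * (1 + ‖G.u‖))), meanAbs.toReal * (M.toReal + 1),
    by positivity, by positivity, fun ξ => ⟨heq ξ, ?_, ?_⟩⟩
  · have hξ := wt_pos ξ
    rw [← ENNReal.ofReal_le_ofReal_iff (hfpos ξ), ← heq, G.lintegral_freq, mul_assoc,
      ENNReal.ofReal_mul (by positivity), ENNReal.ofReal_toReal hmA.ne]
    gcongr
    have h2 : ENNReal.ofReal (a / (2 * (1 + ‖G.u‖)) * wt ξ) * ENNReal.ofReal 2 ≤ ENNReal.ofReal ‖ξ - G.u‖ * m0 + m1 := by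
      rw [← ENNReal.ofReal_mul (by positivity), ← ENNReal.ofReal_toReal hm0t.1.ne,
        ← ENNReal.ofReal_toReal hm0t.2.ne, ← ENNReal.ofReal_mul (by positivity),
        ← ENNReal.ofReal_add (by positivity) (by positivity)]
      refine ENNReal.ofReal_le_ofReal ?_
      have h1 : wt ξ ≤ (1 + ‖G.u‖) * (1 + ‖ξ - G.u‖) := by
        have := norm_add_le (ξ - G.u) G.u
        rw [sub_add_cancel] at this
        unfold wt; nlinarith [norm_nonneg G.u, norm_nonneg (ξ - G.u)]
      calc _ = a * (wt ξ / (1 + ‖G.u‖)) := by field_simp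
        _ ≤ a * (1 + ‖ξ - G.u‖) := by
            gcongr
            rw [div_le_iff₀ (by positivity), mul_comm]; exact h1
        _ = ‖ξ - G.u‖ * a + a := by ring
        _ ≤ _ := by
            gcongr
            · exact min_le_left _ _
            · exact min_le_right _ _
    have h3 := h2.trans (hlow ξ)
    rw [mul_comm, show ENNReal.ofReal 2 = 2 by norm_num] at h3
    exact (ENNReal.mul_le_mul_iff_right (by norm_num) (by norm_num)).1 h3
  · have hξ := wt_pos ξ
    rw [← ENNReal.ofReal_le_ofReal_iff (by positivity), ← heq, G.lintegral_freq, mul_assoc,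
      ENNReal.ofReal_mul (by positivity), ENNReal.ofReal_toReal hmA.ne]
    gcongr
    refine (hup ξ).trans ?_
    rw [mul_comm (M.toReal + 1), ENNReal.ofReal_mul hξ.le]
    gcongr
    rw [← ENNReal.ofReal_toReal hM.ne]
    exact ENNReal.ofReal_le_ofReal (by rw [ENNReal.toReal_ofReal (by positivity)]; linarith)

/-! ### Spectral gap of the linearized operator -/

theorem lintegral_mul_sq_le_mul {α : Type*} [MeasurableSpace α] (ν : Measure α) {f g : α → ℝ≥0∞}
    (hf : AEMeasurable f ν) (hg : AEMeasurable g ν) :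
    (∫⁻ a, f a * g a ∂ν) ^ 2 ≤ (∫⁻ a, f a ^ 2 ∂ν) * ∫⁻ a, g a ^ 2 ∂ν := by
  have h := ENNReal.lintegral_mul_le_Lp_mul_Lq ν Real.HolderConjugate.two_two hf hg
  simp only [Pi.mul_apply, ENNReal.rpow_two] at h
  calc _ ≤ _ := pow_le_pow_left' h 2
    _ = _ := by
      rw [mul_pow, ← ENNReal.rpow_two, ← ENNReal.rpow_mul, ← ENNReal.rpow_two, ← ENNReal.rpow_mul]
      norm_num

theorem Lp_norm_sq_eq {α : Type*} [MeasurableSpace α] {ν : Measure α} (f : Lp ℝ 2 ν) :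
    ENNReal.ofReal (‖f‖ ^ 2) = ∫⁻ a, ‖f a‖ₑ ^ 2 ∂ν := by
  rw [← real_inner_self_eq_norm_sq, L2.inner_def, ofReal_integral_eq_lintegral_ofReal
    (L2.integrable_inner f f) (ae_of_all _ fun a => real_inner_self_nonneg)]
  refine lintegral_congr fun a => ?_
  rw [real_inner_self_eq_norm_sq, ← ofReal_norm, ENNReal.ofReal_pow (norm_nonneg _)]

theorem L2_inner_eq {α : Type*} [MeasurableSpace α] {ν : Measure α} (f g : Lp ℝ 2 ν) :
    (inner ℝ f g : ℝ) = ∫ a, f a * g a ∂ν := by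
  rw [L2.inner_def]
  refine integral_congr_ae (ae_of_all _ fun a => ?_)
  change (inner ℝ (f a) (g a) : ℝ) = f a * g a
  rw [real_inner_comm]; rfl

theorem L2_integrable_mul {α : Type*} [MeasurableSpace α] {ν : Measure α} (f g : Lp ℝ 2 ν) :
    Integrable (fun a => f a * g a) ν :=
  (L2.integrable_inner (𝕜 := ℝ) g f).congr (ae_of_all _ fun _ => rfl)

theorem memLp_two_of_lintegral {α : Type*} [MeasurableSpace α] {ν : Measure α} {f : α → ℝ}
    (hf : AEStronglyMeasurable f ν) (h : ∫⁻ a, ‖f a‖ₑ ^ 2 ∂ν < ⊤) : MemLp f 2 ν := by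
  refine ⟨hf, ?_⟩
  rw [eLpNorm_lt_top_iff_lintegral_rpow_enorm_lt_top (by norm_num) (by norm_num)]
  simpa using h

theorem lintegral_lt_top_of_memLp_two {α : Type*} [MeasurableSpace α] {ν : Measure α} {f : α → ℝ}
    (h : MemLp f 2 ν) : ∫⁻ a, ‖f a‖ₑ ^ 2 ∂ν < ⊤ := by
  have := h.2
  rw [eLpNorm_lt_top_iff_lintegral_rpow_enorm_lt_top (by norm_num) (by norm_num)] at this
  simpa using this

/-- Square integrable functions of the velocity. An element `g` stands for the velocity distribution
`⟨ξ⟩^{-1/2} g`, so that its norm is `‖⟨ξ⟩^{1/2} f‖` for `f = ⟨ξ⟩^{-1/2} g`. -/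
abbrev VelL2 := Lp ℝ 2 (volume : Measure V3)

/-- Square integrable functions on the space of collisions. -/
abbrev CollL2 := Lp ℝ 2 coll

/-- The function `⟨ξ⟩^{-1/2} g`. -/
def unw (g : VelL2) (ξ : V3) : ℝ := (√(wt ξ))⁻¹ * g ξ

theorem VelL2_measurable (g : VelL2) : Measurable (g : V3 → ℝ) := (Lp.stronglyMeasurable g).measurable

@[fun_prop] theorem measurable_unw (g : VelL2) : Measurable (unw g) := by
  have := VelL2_measurable g
  unfold unw; fun_prop

theorem lintegral_mul_unw_sq (g : VelL2) (m : V3 → ℝ) (hm : ∀ ξ, 0 ≤ m ξ) :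
    ∫⁻ ξ, ENNReal.ofReal (m ξ) * ‖unw g ξ‖ₑ ^ 2 = ∫⁻ ξ, ENNReal.ofReal (m ξ / wt ξ) * ‖g ξ‖ₑ ^ 2 := by
  refine lintegral_congr fun ξ => ?_
  have := wt_pos ξ
  rw [unw, enorm_mul, mul_pow, ← mul_assoc]
  congr 1
  rw [Real.enorm_of_nonneg (by positivity), ← ENNReal.ofReal_pow (by positivity),
    ← ENNReal.ofReal_mul (hm ξ), inv_pow, Real.sq_sqrt this.le]
  rfl

theorem lintegral_unw_sq_le (g : VelL2) : ∫⁻ ξ, ‖unw g ξ‖ₑ ^ 2 ≤ ENNReal.ofReal (‖g‖ ^ 2) := by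
  have := lintegral_mul_unw_sq g (fun _ => 1) (by simp)
  simp only [ENNReal.ofReal_one, one_mul] at this
  rw [this, Lp_norm_sq_eq]
  refine lintegral_mono fun ξ => ?_
  refine mul_le_of_le_one_left zero_le ?_
  rw [ENNReal.ofReal_le_one]
  exact div_le_one_of_le₀ (one_le_wt ξ) (wt_pos ξ).le

theorem unw_add (g g' : VelL2) : unw (g + g') =ᵐ[volume] unw g + unw g' := by
  filter_upwards [Lp.coeFn_add g g'] with ξ h
  simp only [unw, Pi.add_apply, h]; ring

theorem unw_smul (c : ℝ) (g : VelL2) : unw (c • g) =ᵐ[volume] c • unw g := by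
  filter_upwards [Lp.coeFn_smul c g] with ξ h
  simp only [unw, Pi.smul_apply, h, smul_eq_mul]; ring

/-- The amplitude `|(ξ - ξ_*) · ω|^{1/2} W₀(ξ_*) f(ξ)`. -/
def Gas.amp (G : Gas) (f : V3 → ℝ) (z : V3 × V3 × Metric.sphere (0 : V3) 1) : ℝ :=
  √(hs z) * G.w0 z.2.1 * f z.1

theorem Gas.measurable_amp {f : V3 → ℝ} (hf : Measurable f) : Measurable (G.amp f) := by
  unfold Gas.amp; fun_prop

theorem Gas.Admissible.lintegral_amp_sq (hG : G.Admissible) {f : V3 → ℝ} (hf : Measurable f) :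
    ∫⁻ z, ‖G.amp f z‖ₑ ^ 2 ∂coll = ∫⁻ ξ, ENNReal.ofReal (G.freq ξ) * ‖f ξ‖ₑ ^ 2 := by
  have hm := G.measurable_amp hf
  obtain ⟨c, C, hc, hC, hfr⟩ := hG.freq_bounds
  rw [lintegral_coll (by fun_prop)]
  refine lintegral_congr fun ξ => ?_
  rw [← (hfr ξ).1, ← lintegral_mul_const _ (by fun_prop)]
  refine lintegral_congr fun p => ?_
  have hw := G.w0_nonneg p.1
  rw [Gas.amp, enorm_mul, mul_pow, Real.enorm_of_nonneg (by positivity),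
    ← ENNReal.ofReal_pow (by positivity), mul_pow, Real.sq_sqrt (hs_nonneg _)]
  rfl

theorem quasiMeasurePreserving_coll_fst :
    Measure.QuasiMeasurePreserving (fun z : V3 × V3 × Metric.sphere (0 : V3) 1 => z.1) coll volume :=
  Measure.quasiMeasurePreserving_fst

theorem Gas.Admissible.freq_nonneg (hG : G.Admissible) (ξ : V3) : 0 ≤ G.freq ξ := by
  obtain ⟨c, C, hc, hC, hfr⟩ := hG.freq_bounds
  exact (mul_pos hc (wt_pos ξ)).le.trans (hfr ξ).2.1

theorem Gas.Admissible.amp_unw_bounds (hG : G.Admissible) :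
    ∃ c C : ℝ, 0 < c ∧ 0 < C ∧ ∀ g : VelL2,
      ENNReal.ofReal (c * ‖g‖ ^ 2) ≤ ∫⁻ z, ‖G.amp (unw g) z‖ₑ ^ 2 ∂coll ∧
      ∫⁻ z, ‖G.amp (unw g) z‖ₑ ^ 2 ∂coll ≤ ENNReal.ofReal (C * ‖g‖ ^ 2) := by
  obtain ⟨c, C, hc, hC, hfr⟩ := hG.freq_bounds
  refine ⟨c, C, hc, hC, fun g => ?_⟩
  have hg := VelL2_measurable g
  rw [hG.lintegral_amp_sq (measurable_unw g), lintegral_mul_unw_sq g G.freq hG.freq_nonneg,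
    ENNReal.ofReal_mul hc.le, ENNReal.ofReal_mul hC.le, Lp_norm_sq_eq,
    ← lintegral_const_mul _ (by fun_prop), ← lintegral_const_mul _ (by fun_prop)]
  constructor
  · refine lintegral_mono fun ξ => ?_
    simp only
    gcongr
    rw [le_div_iff₀ (wt_pos ξ)]; exact (hfr ξ).2.1
  · refine lintegral_mono fun ξ => ?_
    simp only
    gcongr
    rw [div_le_iff₀ (wt_pos ξ)]; exact (hfr ξ).2.2

theorem Gas.Admissible.memLp_amp (hG : G.Admissible) (g : VelL2) : MemLp (G.amp (unw g)) 2 coll := by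
  obtain ⟨c, C, hc, hC, h⟩ := hG.amp_unw_bounds
  exact memLp_two_of_lintegral (G.measurable_amp (measurable_unw g)).aestronglyMeasurable
    ((h g).2.trans_lt ENNReal.ofReal_lt_top)

/-- The linear map underlying `Gas.Admissible.ampL`. -/
def Gas.Admissible.ampLin (hG : G.Admissible) : VelL2 →ₗ[ℝ] CollL2 where
  toFun g := (hG.memLp_amp g).toLp _
  map_add' g g' := by
    rw [← MemLp.toLp_add, MemLp.toLp_eq_toLp_iff]
    filter_upwards [quasiMeasurePreserving_coll_fst.ae (unw_add g g')] with z hz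
    simp only [Gas.amp, Pi.add_apply, hz]; ring
  map_smul' c g := by
    rw [RingHom.id_apply, ← MemLp.toLp_const_smul, MemLp.toLp_eq_toLp_iff]
    filter_upwards [quasiMeasurePreserving_coll_fst.ae (unw_smul c g)] with z hz
    simp only [Gas.amp, Pi.smul_apply, hz, smul_eq_mul]; ring

theorem Gas.Admissible.ampLin_coe (hG : G.Admissible) (g : VelL2) :
    hG.ampLin g =ᵐ[coll] G.amp (unw g) := (hG.memLp_amp g).coeFn_toLp

theorem Gas.Admissible.ampLin_norm_sq (hG : G.Admissible) (g : VelL2) :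
    ENNReal.ofReal (‖hG.ampLin g‖ ^ 2) = ∫⁻ z, ‖G.amp (unw g) z‖ₑ ^ 2 ∂coll := by
  rw [Lp_norm_sq_eq]
  refine lintegral_congr_ae ?_
  filter_upwards [hG.ampLin_coe g] with z hz
  rw [hz]

theorem Gas.Admissible.ampLin_bound (hG : G.Admissible) :
    ∃ C : ℝ, ∀ g : VelL2, ‖hG.ampLin g‖ ≤ C * ‖g‖ := by
  obtain ⟨c, C, hc, hC, h⟩ := hG.amp_unw_bounds
  refine ⟨√C, fun g => ?_⟩
  refine (abs_le_of_sq_le_sq' ?_ (by positivity)).2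
  rw [← ENNReal.ofReal_le_ofReal_iff (by positivity), hG.ampLin_norm_sq, mul_pow, Real.sq_sqrt hC.le]
  exact (h g).2

/-- The amplitude as a bounded operator. -/
def Gas.Admissible.ampL (hG : G.Admissible) : VelL2 →L[ℝ] CollL2 :=
  hG.ampLin.mkContinuousOfExistsBound hG.ampLin_bound

theorem Gas.Admissible.ampL_coe (hG : G.Admissible) (g : VelL2) :
    hG.ampL g =ᵐ[coll] G.amp (unw g) := hG.ampLin_coe g

theorem Gas.Admissible.ampL_norm_sq (hG : G.Admissible) (g : VelL2) :
    ENNReal.ofReal (‖hG.ampL g‖ ^ 2) = ∫⁻ z, ‖G.amp (unw g) z‖ₑ ^ 2 ∂coll := hG.ampLin_norm_sq g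

/-- Composition with the exchange of particles. -/
def exchL : CollL2 →ₗᵢ[ℝ] CollL2 := Lp.compMeasurePreservingₗᵢ ℝ exch measurePreserving_exch
/-- Composition with the collision map. -/
def scatL : CollL2 →ₗᵢ[ℝ] CollL2 := Lp.compMeasurePreservingₗᵢ ℝ scatter measurePreserving_scatter

theorem exchL_coe (t : CollL2) : exchL t =ᵐ[coll] t ∘ exch :=
  Lp.coeFn_compMeasurePreserving t measurePreserving_exch
theorem scatL_coe (t : CollL2) : scatL t =ᵐ[coll] t ∘ scatter :=
  Lp.coeFn_compMeasurePreserving t measurePreserving_scatter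

theorem exchL_exchL (t : CollL2) : exchL (exchL t) = t := by
  refine Lp.ext ?_
  filter_upwards [exchL_coe (exchL t),
    measurePreserving_exch.quasiMeasurePreserving.ae_eq_comp (exchL_coe t)] with z h1 h2
  rw [h1, h2]; simp [exch]

theorem scatL_scatL (t : CollL2) : scatL (scatL t) = t := by
  refine Lp.ext ?_
  filter_upwards [scatL_coe (scatL t),
    measurePreserving_scatter.quasiMeasurePreserving.ae_eq_comp (scatL_coe t)] with z h1 h2
  rw [h1, h2]; simp [scatter_scatter]

theorem exchL_scatL (t : CollL2) : exchL (scatL t) = scatL (exchL t) := by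
  refine Lp.ext ?_
  filter_upwards [exchL_coe (scatL t), scatL_coe (exchL t),
    measurePreserving_scatter.quasiMeasurePreserving.ae_eq_comp (exchL_coe t),
    measurePreserving_exch.quasiMeasurePreserving.ae_eq_comp (scatL_coe t)] with z h1 h2 h3 h4
  rw [h1, h2, h3, h4]; simp [exch_scatter]

theorem inner_exchL (s t : CollL2) : inner ℝ (exchL s) t = (inner ℝ s (exchL t) : ℝ) := by
  rw [← exchL.inner_map_map s, exchL_exchL]
theorem inner_scatL (s t : CollL2) : inner ℝ (scatL s) t = (inner ℝ s (scatL t) : ℝ) := by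
  rw [← scatL.inner_map_map s, scatL_scatL]

/-- The operator `f ↦ f̂ + f̂_* - f̂' - f̂_*'` whose squared norm is the dissipation. -/
def Gas.Admissible.diss (hG : G.Admissible) : VelL2 →L[ℝ] CollL2 :=
  (ContinuousLinearMap.id ℝ CollL2 - scatL.toContinuousLinearMap).comp
    ((ContinuousLinearMap.id ℝ CollL2 + exchL.toContinuousLinearMap).comp hG.ampL)

theorem Gas.Admissible.diss_apply (hG : G.Admissible) (g : VelL2) :
    hG.diss g = hG.ampL g + exchL (hG.ampL g) - scatL (hG.ampL g) - scatL (exchL (hG.ampL g)) := by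
  simp [Gas.Admissible.diss]; abel

/-- The quadratic form of the nonlocal part. -/
def Gas.Admissible.nlForm (hG : G.Admissible) (g : VelL2) : ℝ :=
  inner ℝ (hG.ampL g) (scatL (hG.ampL g) + scatL (exchL (hG.ampL g)) - exchL (hG.ampL g))

/-- The dissipation as frequency part minus nonlocal part: the expansion of the square, in which
`exchL` and `scatL` are commuting isometric involutions. -/
theorem Gas.Admissible.norm_diss_sq (hG : G.Admissible) (g : VelL2) :
    ‖hG.diss g‖ ^ 2 = 4 * (‖hG.ampL g‖ ^ 2 - hG.nlForm g) := by
  rw [hG.diss_apply, Gas.Admissible.nlForm, ← real_inner_self_eq_norm_sq, ← real_inner_self_eq_norm_sq]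
  set t := hG.ampL g
  simp only [inner_sub_left, inner_add_left, inner_sub_right, inner_add_right, inner_exchL,
    inner_scatL, exchL_exchL, exchL_scatL, scatL.inner_map_map, exchL.inner_map_map]
  ring

theorem Gas.Admissible.nlForm_eq (hG : G.Admissible) (g : VelL2) :
    hG.nlForm g = ∫ ξ, unw g ξ * G.nl (unw g) ξ := by
  set f := unw g
  have hf : Measurable f := measurable_unw g
  set X : CollL2 := scatL (hG.ampL g) + scatL (exchL (hG.ampL g)) - exchL (hG.ampL g) with hXd
  have hX : ∀ᵐ z ∂coll, hG.ampL g z * X z = f z.1 * G.nlInt f z.1 z.2 := by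
    have q1 := measurePreserving_exch.quasiMeasurePreserving
    have q2 := measurePreserving_scatter.quasiMeasurePreserving
    filter_upwards [hG.ampL_coe g, Lp.coeFn_sub (scatL (hG.ampL g) + scatL (exchL (hG.ampL g)))
      (exchL (hG.ampL g)), Lp.coeFn_add (scatL (hG.ampL g)) (scatL (exchL (hG.ampL g))),
      scatL_coe (hG.ampL g), scatL_coe (exchL (hG.ampL g)), exchL_coe (hG.ampL g),
      q2.ae_eq_comp (exchL_coe (hG.ampL g)), q1.ae_eq_comp (hG.ampL_coe g),
      q2.ae_eq_comp (hG.ampL_coe g), (q1.comp q2).ae_eq_comp (hG.ampL_coe g)]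
      with z h1 h2 h3 h4 h5 h6 h7 h8 h9 h10
    simp only [Function.comp] at h4 h5 h6 h7 h8 h9 h10
    rw [hXd, h2, Pi.sub_apply, h3, Pi.add_apply, h4, h5, h6, h7, h8, h9, h10, h1]
    simp only [Gas.amp, hs_exch, hs_scatter, Gas.nlInt]
    simp only [exch, scatter]
    have : √(hs z) * √(hs z) = |(inner ℝ (z.1 - z.2.1) (z.2.2 : V3) : ℝ)| :=
      Real.mul_self_sqrt (hs_nonneg z)
    rw [← this]; ring
  have e1 : hG.nlForm g = ∫ z, hG.ampL g z * X z ∂coll := L2_inner_eq _ _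
  have hint : Integrable (fun z => f z.1 * G.nlInt f z.1 z.2) coll :=
    (L2_integrable_mul (hG.ampL g) X).congr hX
  rw [e1, integral_congr_ae hX, coll, integral_prod _ hint]
  refine integral_congr_ae (ae_of_all _ fun ξ => ?_)
  simp only
  rw [integral_const_mul]; rfl


/-- Bounded sequences in a separable Hilbert space have weakly convergent subsequences. -/
theorem exists_weak_subseq {H : Type*} [NormedAddCommGroup H] [InnerProductSpace ℝ H]
    [CompleteSpace H] [TopologicalSpace.SeparableSpace H] (x : ℕ → H) (hx : ∀ n, ‖x n‖ ≤ 1) :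
    ∃ (a : H) (φ : ℕ → ℕ), StrictMono φ ∧
      ∀ v, Tendsto (fun n => inner ℝ (x (φ n)) v) atTop (𝓝 (inner ℝ a v : ℝ)) := by
  obtain ⟨a, -, φ, hφ, h⟩ := WeakDual.isSeqCompact_closedBall (𝕜 := ℝ) (E := H) 0 1
    (x := fun n => StrongDual.toWeakDual (InnerProductSpace.toDual ℝ H (x n)))
    (fun n => by simpa using hx n)
  refine ⟨(InnerProductSpace.toDual ℝ H).symm (WeakDual.toStrongDual a), φ, hφ, fun v => ?_⟩
  have := ((WeakDual.eval_continuous (𝕜 := ℝ) v).tendsto a).comp h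
  rw [InnerProductSpace.toDual_symm_apply]
  exact this

instance : Fact ((2 : ℝ≥0∞) ≠ ⊤) := ⟨by norm_num⟩

theorem VelL2_lintegral_lt_top (g : VelL2) : ∫⁻ ξ, ‖unw g ξ‖ₑ ^ 2 < ⊤ :=
  (lintegral_unw_sq_le g).trans_lt ENNReal.ofReal_lt_top

theorem Gas.Admissible.nl_add (hG : G.Admissible) {f g : V3 → ℝ} (hf : Measurable f)
    (hg : Measurable g) (h2f : ∫⁻ η, ‖f η‖ₑ ^ 2 < ⊤) (h2g : ∫⁻ η, ‖g η‖ₑ ^ 2 < ⊤) (ξ : V3) :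
    G.nl (f + g) ξ = G.nl f ξ + G.nl g ξ := by
  rw [Gas.nl, Gas.nl, Gas.nl, ← integral_add (hG.integrable_nlInt hf h2f ξ)
    (hG.integrable_nlInt hg h2g ξ)]
  simp only [Gas.nlInt_add]

theorem Gas.nl_smul (c : ℝ) (f : V3 → ℝ) (ξ : V3) : G.nl (c • f) ξ = c * G.nl f ξ := by
  simp only [Gas.nl, Gas.nlInt_smul, integral_const_mul]

theorem Gas.Admissible.nl_congr (hG : G.Admissible) {f g : V3 → ℝ} (hf : Measurable f)
    (hg : Measurable g) (h2g : ∫⁻ η, ‖g η‖ₑ ^ 2 < ⊤) (h : f =ᵐ[volume] g) (ξ : V3) :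
    G.nl f ξ = G.nl g ξ := by
  have h0 : ∫⁻ η, ‖(f - g) η‖ₑ ^ 2 = 0 := by
    rw [lintegral_eq_zero_iff (by fun_prop)]
    filter_upwards [h] with η hη
    simp [hη]
  have h1 : G.nl (f - g) ξ = 0 := by
    obtain ⟨C, hC, hk⟩ := hG.kAbs_bounds
    have := (hk (fun η => ‖(f - g) η‖ₑ) (by fun_prop)).1 ξ
    rw [h0, mul_zero, nonpos_iff_eq_zero, pow_eq_zero_iff two_ne_zero] at this
    have h2 := G.enorm_nl_le (f := f - g) ξ
    rw [this, nonpos_iff_eq_zero, enorm_eq_zero] at h2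
    exact h2
  have := hG.nl_add (f := f - g) (by fun_prop) hg (by rw [h0]; simp) h2g ξ
  rw [sub_add_cancel, h1, zero_add] at this
  exact this

/-- The value at `ξ` of the nonlocal part, as a bounded functional of the weighted function. -/
theorem Gas.Admissible.exists_nl_functional (hG : G.Admissible) (ξ : V3) :
    ∃ v : VelL2, ∀ g : VelL2, G.nl (unw g) ξ = inner ℝ g v := by
  obtain ⟨C, hC, hk⟩ := hG.kAbs_bounds
  let ℓ : VelL2 →ₗ[ℝ] ℝ :=
    { toFun := fun g => G.nl (unw g) ξ
      map_add' := fun g g' => by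
        rw [← hG.nl_add (measurable_unw g) (measurable_unw g') (VelL2_lintegral_lt_top g)
          (VelL2_lintegral_lt_top g')]
        exact hG.nl_congr (measurable_unw _) ((measurable_unw g).add (measurable_unw g'))
          ((lintegral_congr_ae (by filter_upwards [unw_add g g'] with η h; rw [h])).symm.trans_lt
            (VelL2_lintegral_lt_top (g + g'))) (unw_add g g') ξ
      map_smul' := fun c g => by
        rw [RingHom.id_apply, smul_eq_mul, ← G.nl_smul]
        exact hG.nl_congr (measurable_unw _) ((measurable_unw g).const_smul c)
          ((lintegral_congr_ae (by filter_upwards [unw_smul c g] with η h; rw [h])).symm.trans_lt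
            (VelL2_lintegral_lt_top (c • g))) (unw_smul c g) ξ }
  have hb : ∀ g, ‖ℓ g‖ ≤ √C.toReal * ‖g‖ := fun g => by
    refine (abs_le_of_sq_le_sq' ?_ (by positivity)).2
    rw [mul_pow, Real.sq_sqrt ENNReal.toReal_nonneg,
      ← ENNReal.ofReal_le_ofReal_iff (by positivity), ENNReal.ofReal_mul ENNReal.toReal_nonneg,
      ENNReal.ofReal_toReal hC.ne, ENNReal.ofReal_pow (norm_nonneg _), ofReal_norm]
    calc ‖G.nl (unw g) ξ‖ₑ ^ 2 ≤ G.kAbs (fun η => ‖unw g η‖ₑ) ξ ^ 2 := by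
          gcongr; exact G.enorm_nl_le ξ
      _ ≤ C * ∫⁻ η, ‖unw g η‖ₑ ^ 2 := (hk _ (by fun_prop)).1 ξ
      _ ≤ _ := by gcongr; exact lintegral_unw_sq_le g
  refine ⟨(InnerProductSpace.toDual ℝ VelL2).symm (ℓ.mkContinuous _ hb), fun g => ?_⟩
  rw [real_inner_comm, InnerProductSpace.toDual_symm_apply]; rfl

theorem Gas.Admissible.nlForm_sq_le (hG : G.Admissible) (g : VelL2) :
    ENNReal.ofReal (hG.nlForm g ^ 2) ≤ ENNReal.ofReal (‖g‖ ^ 2) *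
      ∫⁻ ξ, ENNReal.ofReal (wt ξ)⁻¹ * ‖G.nl (unw g) ξ‖ₑ ^ 2 := by
  have hm := G.measurable_nl (measurable_unw g)
  have hg := VelL2_measurable g
  have hw := measurable_wt
  have e : ENNReal.ofReal (hG.nlForm g ^ 2) = ‖hG.nlForm g‖ₑ ^ 2 := by
    rw [← sq_abs, ENNReal.ofReal_pow (abs_nonneg _), ← Real.norm_eq_abs, ofReal_norm]
  rw [e, hG.nlForm_eq, Lp_norm_sq_eq]
  refine le_trans (pow_le_pow_left' (enorm_integral_le_lintegral_enorm _) 2) ?_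
  have := lintegral_mul_sq_le_mul volume (f := fun ξ => ‖g ξ‖ₑ)
    (g := fun ξ => ENNReal.ofReal (√(wt ξ))⁻¹ * ‖G.nl (unw g) ξ‖ₑ) (by fun_prop) (by fun_prop)
  refine le_trans (le_of_eq ?_) (this.trans (le_of_eq ?_))
  · congr 1
    refine lintegral_congr fun ξ => ?_
    rw [unw, enorm_mul, enorm_mul, Real.enorm_of_nonneg (by have := wt_pos ξ; positivity)]
    ring
  · congr 1
    refine lintegral_congr fun ξ => ?_
    have := wt_pos ξ
    rw [mul_pow, ← ENNReal.ofReal_pow (by positivity), inv_pow, Real.sq_sqrt this.le]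

/-- The quadratic form of the nonlocal part is weakly continuous at `0`. -/
theorem Gas.Admissible.tendsto_nlForm (hG : G.Admissible) (g : ℕ → VelL2)
    (hg : ∀ n, ‖g n‖ ≤ 1) (h0 : ∀ v, Tendsto (fun n => inner ℝ (g n) v) atTop (𝓝 (0 : ℝ))) :
    Tendsto (fun n => hG.nlForm (g n)) atTop (𝓝 0) := by
  obtain ⟨C, hC, hk⟩ := hG.kAbs_bounds
  have hu : ∀ n, ∫⁻ η, ‖unw (g n) η‖ₑ ^ 2 ≤ 1 := fun n => (lintegral_unw_sq_le (g n)).trans (by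
    rw [ENNReal.ofReal_le_one]; exact pow_le_one₀ (norm_nonneg _) (hg n))
  have hp : ∀ n ξ, ‖G.nl (unw (g n)) ξ‖ₑ ^ 2 ≤ C := fun n ξ =>
    (pow_le_pow_left' (G.enorm_nl_le ξ) 2).trans (((hk _ (by fun_prop)).1 ξ).trans
      (mul_le_of_le_one_right zero_le (hu n)))
  have hi : ∀ n, ∫⁻ ξ, ‖G.nl (unw (g n)) ξ‖ₑ ^ 2 ≤ C := fun n =>
    (lintegral_mono fun ξ => pow_le_pow_left' (G.enorm_nl_le ξ) 2).trans
      (((hk _ (by fun_prop)).2).trans (mul_le_of_le_one_right zero_le (hu n)))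
  have hm : ∀ n, Measurable (G.nl (unw (g n))) := fun n => G.measurable_nl (measurable_unw _)
  have hw := measurable_wt
  have key : Tendsto (fun n => ∫⁻ ξ, ENNReal.ofReal (wt ξ)⁻¹ * ‖G.nl (unw (g n)) ξ‖ₑ ^ 2)
      atTop (𝓝 0) := by
    rw [ENNReal.tendsto_nhds_zero]
    intro ε hε
    have hε2 : 0 < ε / 2 := ENNReal.half_pos hε.ne'
    -- dominated convergence on the ball of radius `N`; outside, `⟨ξ⟩⁻¹ ≤ N⁻¹`
    obtain ⟨N, hN0, hN⟩ := ENNReal.exists_nat_pos_inv_mul_lt hC.ne hε2.ne'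
    have hdom : Tendsto (fun n => ∫⁻ ξ in Metric.closedBall 0 N, ‖G.nl (unw (g n)) ξ‖ₑ ^ 2)
        atTop (𝓝 (∫⁻ ξ in Metric.closedBall (0 : V3) N, 0)) := by
      refine tendsto_lintegral_of_dominated_convergence (fun _ => C) (fun n => by fun_prop)
        (fun n => ae_of_all _ (hp n)) ?_ (ae_of_all _ fun ξ => ?_)
      · rw [setLIntegral_const]
        exact (ENNReal.mul_lt_top hC measure_closedBall_lt_top).ne
      · obtain ⟨v, hv⟩ := hG.exists_nl_functional ξ
        have : Tendsto (fun n => ‖G.nl (unw (g n)) ξ‖ₑ ^ 2) atTop (𝓝 (‖(0 : ℝ)‖ₑ ^ 2)) := by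
          simp only [hv]
          exact ((ENNReal.continuous_pow 2).tendsto _).comp
            ((continuous_enorm.tendsto _).comp (h0 v))
        simpa using this
    rw [lintegral_zero, ENNReal.tendsto_nhds_zero] at hdom
    filter_upwards [hdom _ hε2] with n hn
    rw [← lintegral_add_compl _ (Metric.isClosed_closedBall (x := (0 : V3)) (ε := N)).measurableSet,
      ← ENNReal.add_halves ε]
    refine add_le_add (le_trans (lintegral_mono fun ξ => ?_) hn) ?_
    · refine mul_le_of_le_one_left zero_le ?_
      rw [ENNReal.ofReal_le_one]
      exact inv_le_one_of_one_le₀ (one_le_wt ξ)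
    · calc _ ≤ ∫⁻ ξ in (Metric.closedBall 0 N)ᶜ, (N : ℝ≥0∞)⁻¹ * ‖G.nl (unw (g n)) ξ‖ₑ ^ 2 := by
            refine setLIntegral_mono' Metric.isClosed_closedBall.measurableSet.compl fun ξ hξ => ?_
            gcongr
            have hN' : (0 : ℝ) < N := by exact_mod_cast hN0
            rw [← ENNReal.ofReal_natCast, ← ENNReal.ofReal_inv_of_pos hN']
            refine ENNReal.ofReal_le_ofReal (inv_anti₀ hN' ?_)
            have : (N : ℝ) < ‖ξ‖ := by simpa using hξ
            rw [wt]; linarith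
        _ ≤ ∫⁻ ξ, (N : ℝ≥0∞)⁻¹ * ‖G.nl (unw (g n)) ξ‖ₑ ^ 2 := setLIntegral_le_lintegral _ _
        _ ≤ (N : ℝ≥0∞)⁻¹ * C := by
            rw [lintegral_const_mul _ (by have := hm n; fun_prop)]
            gcongr; exact hi n
        _ ≤ ε / 2 := hN.le
  have h2 : Tendsto (fun n => ENNReal.ofReal (hG.nlForm (g n) ^ 2)) atTop (𝓝 0) := by
    refine tendsto_of_tendsto_of_tendsto_of_le_of_le tendsto_const_nhds key (fun n => zero_le)
      fun n => (hG.nlForm_sq_le (g n)).trans (mul_le_of_le_one_left zero_le ?_)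
    rw [ENNReal.ofReal_le_one]; exact pow_le_one₀ (norm_nonneg _) (hg n)
  have h3 := (ENNReal.tendsto_toReal ENNReal.zero_ne_top).comp h2
  have h4 : Tendsto (fun n => √(hG.nlForm (g n) ^ 2)) atTop (𝓝 0) := by
    have := (Real.continuous_sqrt.tendsto _).comp h3
    simpa [Function.comp_def, ENNReal.toReal_ofReal (sq_nonneg _)] using this
  simp only [Real.sqrt_sq_eq_abs] at h4
  exact (tendsto_zero_iff_abs_tendsto_zero _).2 h4

theorem Gas.Admissible.ampL_norm_sq_ge (hG : G.Admissible) :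
    ∃ c : ℝ, 0 < c ∧ ∀ g : VelL2, c * ‖g‖ ^ 2 ≤ ‖hG.ampL g‖ ^ 2 := by
  obtain ⟨c, C, hc, hC, h⟩ := hG.amp_unw_bounds
  refine ⟨c, hc, fun g => ?_⟩
  rw [← ENNReal.ofReal_le_ofReal_iff (by positivity), hG.ampL_norm_sq]
  exact (h g).1

/-- The dissipation controls the component orthogonal to its kernel: otherwise a normalized
sequence with vanishing dissipation converges weakly to an element of the kernel, which is `0`, and
then the nonlocal part vanishes in the limit while the collision frequency does not. -/
theorem Gas.Admissible.spectral_gap (hG : G.Admissible) :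
    ∃ c : ℝ, 0 < c ∧ ∀ g ∈ (LinearMap.ker hG.diss.toLinearMap)ᗮ, c * ‖g‖ ^ 2 ≤ ‖hG.diss g‖ ^ 2 := by
  by_contra! hcon
  have hex : ∀ n : ℕ, ∃ g ∈ (LinearMap.ker hG.diss.toLinearMap)ᗮ, ‖g‖ = 1 ∧
      ‖hG.diss g‖ ^ 2 < 1 / ((n : ℝ) + 1) := by
    intro n
    obtain ⟨g, hg, hlt⟩ := hcon (1 / ((n : ℝ) + 1)) (by positivity)
    have hg0 : g ≠ 0 := by
      rintro rfl
      simp at hlt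
    have hgn : 0 < ‖g‖ := norm_pos_iff.2 hg0
    refine ⟨‖g‖⁻¹ • g, Submodule.smul_mem _ _ hg, ?_, ?_⟩
    · rw [norm_smul, norm_inv, norm_norm, inv_mul_cancel₀ hgn.ne']
    · rw [map_smul, norm_smul, norm_inv, norm_norm, mul_pow, inv_pow, inv_mul_lt_iff₀ (by positivity)]
      linarith
  choose g hgK hg1 hgd using hex
  obtain ⟨a, φ, hφ, hw⟩ := exists_weak_subseq g (fun n => (hg1 n).le)
  have hd0 : Tendsto (fun n => hG.diss (g (φ n))) atTop (𝓝 0) := by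
    rw [tendsto_zero_iff_norm_tendsto_zero]
    have h1 : Tendsto (fun n => ‖hG.diss (g (φ n))‖ ^ 2) atTop (𝓝 0) := by
      refine squeeze_zero (fun n => sq_nonneg _) (fun n => (hgd (φ n)).le) ?_
      exact tendsto_one_div_add_atTop_nhds_zero_nat.comp hφ.tendsto_atTop
    have h2 := (Real.continuous_sqrt.tendsto _).comp h1
    simpa [Function.comp_def, Real.sqrt_sq (norm_nonneg _)] using h2
  have haK : a ∈ LinearMap.ker hG.diss.toLinearMap := by
    rw [LinearMap.mem_ker]
    change hG.diss a = 0
    rw [← inner_self_eq_zero (𝕜 := ℝ)]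
    have h1 := hw (hG.diss.adjoint (hG.diss a))
    simp only [ContinuousLinearMap.adjoint_inner_right] at h1
    have h2 : Tendsto (fun n => (inner ℝ (hG.diss (g (φ n))) (hG.diss a) : ℝ)) atTop (𝓝 0) := by
      have := hd0.inner (tendsto_const_nhds (x := hG.diss a)) (𝕜 := ℝ)
      simpa using this
    exact tendsto_nhds_unique h1 h2
  have ha0 : a = 0 := by
    rw [← inner_self_eq_zero (𝕜 := ℝ)]
    have h1 := hw a
    have h2 : ∀ n, (inner ℝ (g (φ n)) a : ℝ) = 0 := fun n =>
      Submodule.inner_left_of_mem_orthogonal haK (hgK (φ n))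
    simp only [h2] at h1
    exact tendsto_nhds_unique h1 tendsto_const_nhds
  obtain ⟨c, hc, hca⟩ := hG.ampL_norm_sq_ge
  have hn := hG.tendsto_nlForm (fun n => g (φ n)) (fun n => (hg1 _).le) (fun v => by
    simpa [ha0] using hw v)
  have hl : ∀ n, 4 * (c - hG.nlForm (g (φ n))) ≤ ‖hG.diss (g (φ n))‖ ^ 2 := fun n => by
    rw [hG.norm_diss_sq]
    have := hca (g (φ n))
    rw [hg1] at this
    linarith
  have h5 : (4 * (c - 0) : ℝ) ≤ ‖(0 : CollL2)‖ ^ 2 :=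
    le_of_tendsto_of_tendsto' ((tendsto_const_nhds.sub hn).const_mul 4) ((hd0.norm).pow 2) hl
  simp at h5
  linarith

variable {G : Gas}

/-! ### Collision invariants -/

/-- `ψ` is a summational invariant at the collision `z`. -/
def InvAt (ψ : V3 → ℝ) (z : V3 × V3 × Metric.sphere (0 : V3) 1) : Prop :=
  ψ z.1 + ψ z.2.1 = ψ (post z.1 z.2.1 z.2.2) + ψ (postStar z.1 z.2.1 z.2.2)

/-- In the collision of `a` and `a + p + z` along `p` the outgoing velocities are `a + p` and `a + z`. -/
theorem InvAt.rectangle {ψ : V3 → ℝ} (h : ∀ z, InvAt ψ z) (a p z : V3)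
    (hpz : (inner ℝ p z : ℝ) = 0) : ψ a + ψ (a + p + z) = ψ (a + p) + ψ (a + z) := by
  by_cases hp : p = 0
  · simp [hp]
  have hp' : 0 < ‖p‖ := norm_pos_iff.2 hp
  let w : Metric.sphere (0 : V3) 1 := ⟨‖p‖⁻¹ • p, by simp [norm_smul, hp]⟩
  have h1 := h (a, a + p + z, w)
  have e : (inner ℝ (a - (a + p + z)) (w : V3) : ℝ) = - ‖p‖ := by
    have : a - (a + p + z) = -(p + z) := by abel
    rw [this, inner_neg_left, inner_add_left, inner_smul_right, inner_smul_right,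
      real_inner_self_eq_norm_sq, real_inner_comm, hpz]
    field_simp; simp
  have e2 : ‖p‖ • (w : V3) = p := by
    change ‖p‖ • (‖p‖⁻¹ • p) = p
    rw [smul_smul, mul_inv_cancel₀ hp'.ne', one_smul]
  have e3 : post a (a + p + z) w = a + p := by
    rw [post, e, neg_smul, e2, sub_neg_eq_add]
  have e4 : postStar a (a + p + z) w = a + z := by
    rw [postStar, e, neg_smul, e2]; abel
  simp only [InvAt] at h1
  rw [e3, e4] at h1
  exact h1

/-- A continuous function of one variable whose second differences do not depend on the base point
is a quadratic polynomial. -/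
theorem quadratic_of_second_difference {g : ℝ → ℝ} (hg : Continuous g)
    (h : ∀ a s t, g (a + s + t) - g (a + s) - g (a + t) + g a = g (s + t) - g s - g t) :
    ∃ b c, ∀ s, g s = b * s + c * s ^ 2 := by
  have hadd : ∀ f : ℝ → ℝ, Continuous f → (∀ x y, f (x + y) = f x + f y) → ∀ s, f s = s * f 1 := by
    intro f hf hfa s
    have : f (s • 1) = s • f 1 :=
      (AddMonoidHom.toRealLinearMap (AddMonoidHom.mk' f hfa) hf).map_smul s 1
    simpa using this
  have hc : ∀ t s, g (s + t) - g s - g t = s * (g (1 + t) - g 1 - g t) := fun t =>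
    hadd (fun s => g (s + t) - g s - g t) (by fun_prop) fun x y => by
      have := h x y t
      linarith
  have hc1 : ∀ t, g (1 + t) - g 1 - g t = t * (g (1 + 1) - g 1 - g 1) := fun t => by
    have := hc 1 t
    rw [add_comm t 1] at this
    linarith
  obtain ⟨c, hcd⟩ : ∃ c, g (1 + 1) - g 1 - g 1 = 2 * c :=
    ⟨(g (1 + 1) - g 1 - g 1) / 2, by ring⟩
  have hl := hadd (fun s => g s - c * s ^ 2) (by fun_prop) fun x y => by
    have h1 := hc y x
    rw [hc1 y, hcd] at h1
    linear_combination h1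
  refine ⟨g 1 - c, c, fun s => ?_⟩
  linear_combination hl s

/-- Continuous collision invariants are spanned by `1`, the coordinates and `|ξ|²`. -/
theorem InvAt.exists_eq {ψ : V3 → ℝ} (hψ : Continuous ψ) (h : ∀ z, InvAt ψ z) :
    ∃ (α : ℝ) (b : V3) (γ : ℝ), ∀ ξ, ψ ξ = α + inner ℝ b ξ + γ * ‖ξ‖ ^ 2 := by
  have rect := InvAt.rectangle h
  let e : Fin 3 → V3 := fun i => EuclideanSpace.single i 1
  have he : ∀ i j, (inner ℝ (e i) (e j) : ℝ) = if i = j then 1 else 0 := fun i j => by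
    simp [e, EuclideanSpace.inner_single_left]
  let g : Fin 3 → ℝ → ℝ := fun i s => ψ (s • e i) - ψ 0
  have hg0 : ∀ i, g i 0 = 0 := fun i => by simp [g]
  have hgc : ∀ i, Continuous (g i) := fun i => by fun_prop
  have two : ∀ i j, i ≠ j → ∀ s t, ψ (s • e i + t • e j) = ψ 0 + g i s + g j t := by
    intro i j hij s t
    have := rect 0 (s • e i) (t • e j) (by simp [inner_smul_left, inner_smul_right, he, hij])
    simp only [zero_add] at this
    simp only [g]; linarith
  have mixed : ∀ i j, i ≠ j → ∀ a b s t,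
      g i (a + s + t) - g i (a + s) - g i (a + t) + g i a
        = -(g j (b + s - t) - g j (b + s) - g j (b - t) + g j b) := by
    intro i j hij a b s t
    have := rect (a • e i + b • e j) (s • e i + s • e j) (t • e i + (-t) • e j) (by
      simp only [inner_add_left, inner_add_right, inner_smul_left, inner_smul_right, he]
      simp [hij, hij.symm])
    have e1 : a • e i + b • e j + (s • e i + s • e j) + (t • e i + (-t) • e j)
      = (a + s + t) • e i + (b + s - t) • e j := by module
    have e2 : a • e i + b • e j + (s • e i + s • e j) = (a + s) • e i + (b + s) • e j := by module
    have e3 : a • e i + b • e j + (t • e i + (-t) • e j) = (a + t) • e i + (b - t) • e j := by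
      module
    rw [e1, e2, e3, two i j hij, two i j hij, two i j hij, two i j hij] at this
    linarith
  have quad : ∀ i, ∃ b c, ∀ s, g i s = b * s + c * s ^ 2 := by
    intro i
    obtain ⟨j, hij⟩ := exists_ne i
    refine quadratic_of_second_difference (hgc i) fun a s t => ?_
    have h1 := mixed i j hij.symm a 0 s t
    have h2 := mixed i j hij.symm 0 0 s t
    simp only [zero_add, hg0] at h1 h2
    linarith
  choose b c hbc using quad
  have hcc : ∀ i, c i = c 0 := by
    intro i
    by_cases hi : i = 0
    · rw [hi]
    have := mixed i 0 hi 0 0 1 1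
    simp only [hbc] at this
    linarith
  refine ⟨ψ 0, b 0 • e 0 + b 1 • e 1 + b 2 • e 2, c 0, fun ξ => ?_⟩
  have hξ : ξ = ξ 0 • e 0 + (ξ 1 • e 1 + ξ 2 • e 2) := by
    ext i; fin_cases i <;> simp [e]
  have h1 := rect 0 (ξ 0 • e 0) (ξ 1 • e 1 + ξ 2 • e 2) (by
    simp [inner_smul_left, inner_smul_right, inner_add_right, he])
  simp only [zero_add] at h1
  rw [← hξ, two 1 2 (by decide)] at h1
  have h2 : g 0 (ξ 0) = ψ (ξ 0 • e 0) - ψ 0 := rfl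
  have h3 : ‖ξ‖ ^ 2 = ξ 0 ^ 2 + ξ 1 ^ 2 + ξ 2 ^ 2 := by
    rw [EuclideanSpace.norm_sq_eq, Fin.sum_univ_three]; simp
  have h4 : (inner ℝ (b 0 • e 0 + b 1 • e 1 + b 2 • e 2) ξ : ℝ)
      = b 0 * ξ 0 + b 1 * ξ 1 + b 2 * ξ 2 := by
    simp [e, inner_add_left, inner_smul_left, EuclideanSpace.inner_single_left]
  rw [h3, h4]
  simp only [hbc, hcc 1, hcc 2] at h1 h2
  linarith

theorem post_sub_sub (ξ ξs w t : V3) : post (ξ - t) (ξs - t) w = post ξ ξs w - t := by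
  simp only [post, sub_sub_sub_cancel_right]; abel
theorem postStar_sub_sub (ξ ξs w t : V3) : postStar (ξ - t) (ξs - t) w = postStar ξ ξs w - t := by
  simp only [postStar, sub_sub_sub_cancel_right]; abel

theorem InvAt.ae_translate {φ : V3 → ℝ} (h : ∀ᵐ z ∂coll, InvAt φ z) :
    ∀ᵐ p ∂part, ∀ᵐ ξ, InvAt φ (ξ, ξ + p.1, p.2) := by
  have h1 : MeasurePreserving (fun z : V3 × V3 × Metric.sphere (0 : V3) 1 =>
      (z.1, z.1 + z.2.1, z.2.2)) (volume.prod part) (volume.prod part) := by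
    refine MeasurePreserving.skew_product (f := id) (g := fun ξ (p : V3 × Metric.sphere (0 : V3) 1)
      => (ξ + p.1, p.2)) (MeasurePreserving.id _) (by fun_prop) (ae_of_all _ fun ξ => ?_)
    exact ((measurePreserving_add_left volume ξ).prod (MeasurePreserving.id _)).map_eq
  have h2 := h1.quasiMeasurePreserving.ae h
  have h3 := (Measure.measurePreserving_swap (μ := part)
    (ν := (volume : Measure V3))).quasiMeasurePreserving.ae h2
  exact Measure.ae_ae_of_ae_prod h3

open scoped Convolution in
theorem InvAt.mollify {φ : V3 → ℝ} (hφ : LocallyIntegrable φ) (h : ∀ᵐ z ∂coll, InvAt φ z)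
    (ρ : ContDiffBump (0 : V3)) :
    ∀ z, InvAt (ρ.normed volume ⋆[ContinuousLinearMap.lsmul ℝ ℝ, volume] φ) z := by
  set ψ := (ρ.normed volume ⋆[ContinuousLinearMap.lsmul ℝ ℝ, volume] φ) with hψ
  have hex : ∀ x, Integrable (fun t => ρ.normed volume t * φ (x - t)) := fun x =>
    ρ.hasCompactSupport_normed.convolutionExists_left (L := ContinuousLinearMap.lsmul ℝ ℝ)
      (ρ.continuous_normed (μ := volume)) hφ x
  have hval : ∀ x, ψ x = ∫ t, ρ.normed volume t * φ (x - t) := fun x => rfl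
  have hcont : Continuous ψ :=
    ρ.hasCompactSupport_normed.continuous_convolution_left _ ρ.continuous_normed hφ
  have hae : ∀ᵐ p ∂part, ∀ ξ, InvAt ψ (ξ, ξ + p.1, p.2) := by
    filter_upwards [InvAt.ae_translate h] with p hp ξ
    simp only [InvAt, hval]
    rw [← integral_add (hex _) (hex _), ← integral_add (hex _) (hex _)]
    refine integral_congr_ae ?_
    have h1 := (Measure.measurePreserving_sub_left volume ξ).quasiMeasurePreserving.ae hp
    filter_upwards [h1] with t ht
    simp only [InvAt] at ht
    have e : ξ - t + p.1 = ξ + p.1 - t := by abel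
    rw [e, post_sub_sub, postStar_sub_sub] at ht
    rw [← mul_add, ← mul_add, ht]
  rintro ⟨ξ, ξs, w⟩
  have h2 : (fun p : V3 × Metric.sphere (0 : V3) 1 => ψ ξ + ψ (ξ + p.1))
      = fun p => ψ (post ξ (ξ + p.1) p.2) + ψ (postStar ξ (ξ + p.1) p.2) := by
    refine Measure.eq_of_ae_eq (μ := part) ?_ (by fun_prop) ?_
    · filter_upwards [hae] with p hp
      exact hp ξ
    · unfold post postStar; fun_prop
  have h3 := congrFun h2 (ξs - ξ, w)
  simpa [InvAt] using h3

/-- The functions `α + β · (ξ - u) + γ |ξ - u|²`, as a linear map in the coefficients. -/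
def quadMap (u : V3) : (ℝ × V3 × ℝ) →ₗ[ℝ] (V3 → ℝ) where
  toFun c ξ := c.1 + inner ℝ c.2.1 (ξ - u) + c.2.2 * ‖ξ - u‖ ^ 2
  map_add' c c' := by
    ext ξ; simp only [Prod.fst_add, Prod.snd_add, inner_add_left, Pi.add_apply]; ring
  map_smul' r c := by
    ext ξ; simp only [Prod.smul_fst, Prod.smul_snd, inner_smul_left, Pi.smul_apply, smul_eq_mul,
      RingHom.id_apply, conj_trivial]; ring

/-- The mollifications of `φ` are continuous invariants, hence of the form `quadMap`; on the set where
they converge to `φ`, the limit stays in this space because it is finite-dimensional, hence closed. -/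
theorem InvAt.ae_eq_quadMap {φ : V3 → ℝ} (hφ : LocallyIntegrable φ) (h : ∀ᵐ z ∂coll, InvAt φ z)
    (u : V3) : ∃ c, φ =ᵐ[volume] quadMap u c := by
  let ρ : ℕ → ContDiffBump (0 : V3) := fun n =>
    ⟨1 / ((n : ℝ) + 1), 2 / ((n : ℝ) + 1), by positivity, by gcongr; norm_num⟩
  have hlim := ContDiffBump.ae_convolution_tendsto_right_of_locallyIntegrable (φ := ρ) (l := atTop)
    (K := 2) (by
      have := (tendsto_one_div_add_atTop_nhds_zero_nat (𝕜 := ℝ)).const_mul 2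
      simpa only [mul_zero, mul_one_div] using this)
    (Eventually.of_forall fun n => le_of_eq (by simp only [ρ]; ring)) hφ
  set A : Set V3 := {x | Tendsto (fun i => (convolution ((ρ i).normed volume) φ
    (ContinuousLinearMap.lsmul ℝ ℝ) volume) x) atTop (𝓝 (φ x))} with hA
  let res : (V3 → ℝ) →ₗ[ℝ] (A → ℝ) := LinearMap.funLeft ℝ ℝ Subtype.val
  let E : Submodule ℝ (A → ℝ) := LinearMap.range (res.comp (quadMap u))
  have hE : IsClosed (E : Set (A → ℝ)) := E.closed_of_finiteDimensional
  have hmem : res φ ∈ E := by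
    refine hE.mem_of_tendsto (f := fun n => res (convolution ((ρ n).normed volume) φ
      (ContinuousLinearMap.lsmul ℝ ℝ) volume)) (b := atTop) ?_ (Eventually.of_forall fun n => ?_)
    · rw [tendsto_pi_nhds]
      exact fun x => x.2
    · obtain ⟨α, b, γ, hq⟩ := InvAt.exists_eq
        ((ρ n).hasCompactSupport_normed.continuous_convolution_left (ContinuousLinearMap.lsmul ℝ ℝ)
          ((ρ n).continuous_normed (μ := volume)) hφ) (InvAt.mollify hφ h (ρ n))
      refine ⟨(α + inner ℝ b u + γ * ‖u‖ ^ 2, b + (2 * γ) • u, γ), ?_⟩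
      ext x
      simp only [LinearMap.comp_apply, res, LinearMap.funLeft_apply, quadMap, LinearMap.coe_mk,
        AddHom.coe_mk]
      rw [hq, inner_add_left, inner_smul_left, norm_sub_sq_real, inner_sub_right, inner_sub_right,
        real_inner_self_eq_norm_sq, real_inner_comm (x : V3) u]
      simp only [conj_trivial]; ring
  obtain ⟨c, hc⟩ := hmem
  refine ⟨c, ?_⟩
  filter_upwards [hlim] with x hx
  exact (congrFun hc ⟨x, hx⟩).symm

/-- The kernel of the dissipation consists of the collision invariants times `W₀`. -/
theorem Gas.Admissible.unw_eq_of_diss_eq_zero (hG : G.Admissible) {g : VelL2} (h : hG.diss g = 0) :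
    ∃ c, unw g =ᵐ[volume] fun ξ => G.w0 ξ * quadMap G.u c ξ := by
  have hw : ∀ ξ, 0 < G.w0 ξ := hG.w0_pos
  set φ : V3 → ℝ := fun ξ => (G.w0 ξ)⁻¹ * unw g ξ with hφ
  have hloc : LocallyIntegrable φ := by
    have h1 : LocallyIntegrable (unw g) :=
      (memLp_two_of_lintegral (measurable_unw g).aestronglyMeasurable
        (VelL2_lintegral_lt_top g)).locallyIntegrable (by norm_num)
    have h2 : Continuous fun ξ => (G.w0 ξ)⁻¹ := G.continuous_w0.inv₀ fun ξ => (hw ξ).ne'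
    rw [locallyIntegrable_iff] at h1 ⊢
    intro k hk
    exact (h1 k hk).continuousOn_mul h2.continuousOn hk
  have hinv : ∀ᵐ z ∂coll, InvAt φ z := by
    set t := hG.ampL g with ht
    have q1 := measurePreserving_exch.quasiMeasurePreserving
    have q2 := measurePreserving_scatter.quasiMeasurePreserving
    have hd := hG.diss_apply g
    rw [h] at hd
    have hd' : t + exchL t = scatL t + scatL (exchL t) := by
      rw [← sub_eq_zero, hd]; abel
    filter_upwards [hG.ampL_coe g, Lp.coeFn_add t (exchL t), Lp.coeFn_add (scatL t) (scatL (exchL t)),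
      scatL_coe t, scatL_coe (exchL t), exchL_coe t,
      q2.ae_eq_comp (exchL_coe t), q1.ae_eq_comp (hG.ampL_coe g),
      q2.ae_eq_comp (hG.ampL_coe g), (q1.comp q2).ae_eq_comp (hG.ampL_coe g)]
      with z h1 h2 h3 h4 h5 h6 h7 h8 h9 h10
    simp only [Function.comp] at h4 h5 h6 h7 h8 h9 h10
    have e : (t + exchL t : CollL2) z = (scatL t + scatL (exchL t) : CollL2) z := by rw [hd']
    rw [h2, h3, Pi.add_apply, Pi.add_apply, h4, h5, h6, h7, h8, h9, h10, h1] at e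
    simp only [Gas.amp, hs_exch, hs_scatter] at e
    simp only [exch, scatter] at e
    have hf : ∀ ξ, unw g ξ = G.w0 ξ * φ ξ := fun ξ => by
      rw [hφ]; exact (mul_inv_cancel_left₀ (hw ξ).ne' _).symm
    simp only [hf] at e
    by_cases hz : hs z = 0
    · have hz' : (inner ℝ (z.1 - z.2.1) (z.2.2 : V3) : ℝ) = 0 := abs_eq_zero.1 hz
      simp [InvAt, post, postStar, hz']
    have hs0 : 0 < √(hs z) := Real.sqrt_pos.2 (lt_of_le_of_ne (hs_nonneg z) (Ne.symm hz))
    have hpost := w0_post_mul (G := G) z.1 z.2.1 z.2.2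
    have hne : √(hs z) * (G.w0 z.1 * G.w0 z.2.1) ≠ 0 :=
      (mul_pos hs0 (mul_pos (hw _) (hw _))).ne'
    refine mul_left_cancel₀ hne ?_
    linear_combination e + √(hs z) * (φ (post z.1 z.2.1 z.2.2) + φ (postStar z.1 z.2.1 z.2.2)) * hpost
  obtain ⟨c, hc⟩ := InvAt.ae_eq_quadMap hloc hinv G.u
  refine ⟨c, ?_⟩
  filter_upwards [hc] with ξ hξ
  rw [← hξ, hφ]
  exact (mul_inv_cancel_left₀ (hw ξ).ne' _).symm

variable {G : Gas}

/-! ### Gaussian moments of the collision invariants -/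

theorem integrable_pow_mul_gaussian {T : ℝ} (hT : 0 < T) (n : ℕ) :
    Integrable fun x : ℝ => x ^ n * Real.exp (-(x ^ 2 / (2 * T))) := by
  have := integrable_rpow_mul_exp_neg_mul_sq (b := 1 / (2 * T)) (by positivity)
    (s := n) (by have : (0 : ℝ) ≤ n := n.cast_nonneg
                 linarith)
  refine this.congr (ae_of_all _ fun x => ?_)
  simp only [Real.rpow_natCast]
  congr 2; ring

theorem integral_pow_add_two_mul_gaussian {T : ℝ} (hT : 0 < T) (n : ℕ) :
    ∫ x : ℝ, x ^ (n + 2) * Real.exp (-(x ^ 2 / (2 * T)))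
      = T * (n + 1) * ∫ x : ℝ, x ^ n * Real.exp (-(x ^ 2 / (2 * T))) := by
  have h0 := integrable_pow_mul_gaussian hT n
  have h2 := integrable_pow_mul_gaussian hT (n + 2)
  have h := integral_eq_zero_of_hasDerivAt_of_integrable
    (f := fun x : ℝ => x ^ (n + 1) * Real.exp (-(x ^ 2 / (2 * T))))
    (f' := fun x : ℝ => (n + 1) * (x ^ n * Real.exp (-(x ^ 2 / (2 * T))))
      - (1 / T) * (x ^ (n + 2) * Real.exp (-(x ^ 2 / (2 * T)))))
    (fun x => by
      have h2 : HasDerivAt (fun x : ℝ => Real.exp (-(x ^ 2 / (2 * T))))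
          (Real.exp (-(x ^ 2 / (2 * T))) * -(2 * x / (2 * T))) x := by
        simpa using ((hasDerivAt_pow 2 x).div_const (2 * T)).fun_neg.exp
      refine ((hasDerivAt_pow (n + 1) x).mul h2).congr_deriv ?_
      simp only [Nat.add_sub_cancel]
      push_cast
      field_simp
      ring)
    ((h0.const_mul _).sub (h2.const_mul _)) (integrable_pow_mul_gaussian hT (n + 1))
  rw [integral_sub (h0.const_mul _) (h2.const_mul _), integral_const_mul, integral_const_mul] at h
  field_simp at h
  linarith

theorem integral_mul_gaussian_eq_zero (T : ℝ) :
    ∫ x : ℝ, x ^ 1 * Real.exp (-(x ^ 2 / (2 * T))) = 0 := by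
  have h := integral_neg_eq_self (fun x : ℝ => x ^ 1 * Real.exp (-(x ^ 2 / (2 * T)))) volume
  simp only [pow_one, neg_mul, neg_sq, integral_neg] at h ⊢
  linarith

/-- Moments of order at most five of a centred Gaussian. -/
theorem integral_poly_mul_gaussian {T : ℝ} (hT : 0 < T) {p : ℝ → ℝ} {a b c d e f : ℝ}
    (hp : ∀ x, p x = a + b * x + c * x ^ 2 + d * x ^ 3 + e * x ^ 4 + f * x ^ 5) :
    ∫ x : ℝ, p x * Real.exp (-(x ^ 2 / (2 * T)))
      = (a + c * T + 3 * e * T ^ 2) * ∫ x : ℝ, Real.exp (-(x ^ 2 / (2 * T))) := by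
  have i := integrable_pow_mul_gaussian hT
  have h1 := integral_mul_gaussian_eq_zero T
  have h2 := integral_pow_add_two_mul_gaussian hT 0
  have h3 := integral_pow_add_two_mul_gaussian hT 1
  have h4 := integral_pow_add_two_mul_gaussian hT 2
  have h5 := integral_pow_add_two_mul_gaussian hT 3
  norm_num at h2 h3 h4 h5
  norm_num at h1
  rw [h1, mul_zero] at h3
  rw [h3, mul_zero] at h5
  rw [h2] at h4
  calc _ = ∫ x : ℝ, ∑ k : Fin 6, ![a, b, c, d, e, f] k *
        (x ^ (k : ℕ) * Real.exp (-(x ^ 2 / (2 * T)))) := by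
          congr 1; ext x
          rw [hp]
          simp [Fin.sum_univ_six]
          ring
    _ = _ := by
      have hk : ∀ k ∈ (Finset.univ : Finset (Fin 6)), Integrable (fun x : ℝ =>
        ![a, b, c, d, e, f] k * (x ^ (k : ℕ) * Real.exp (-(x ^ 2 / (2 * T))))) :=
          fun k _ => (i k).const_mul _
      rw [integral_finsetSum _ hk]
      simp only [integral_const_mul]
      simp [Fin.sum_univ_six, h1, h2, h3, h4, h5]
      ring

theorem integral_coords {F : ℝ × ℝ × ℝ → ℝ} (hF : Continuous F)
    (hi : Integrable fun x : V3 => F (x 0, x 1, x 2)) :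
    ∫ x : V3, F (x 0, x 1, x 2) = ∫ a, ∫ b, ∫ c, F (a, b, c) := by
  have hm := measurePreserving_coords
  have hi' : Integrable F := (hm.integrable_comp hF.aestronglyMeasurable).1 hi
  have h1 : ∫ x : V3, F (x 0, x 1, x 2) = ∫ y, F y := by
    rw [← hm.map_eq, integral_map hm.measurable.aemeasurable hF.aestronglyMeasurable]
  rw [h1, Measure.volume_eq_prod, integral_prod _ hi']
  refine integral_congr_ae ?_
  filter_upwards [Integrable.prod_right_ae hi'] with a ha
  rw [Measure.volume_eq_prod, integral_prod _ ha]

theorem Gas.Admissible.integrable_of_le_wt_pow (hG : G.Admissible) {f : V3 → ℝ} (hf : Continuous f)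
    {C : ℝ} {n : ℕ} (h : ∀ ξ, |f ξ| ≤ C * wt ξ ^ n * G.w0 ξ) : Integrable f := by
  obtain ⟨D, hD, hd⟩ := hG.w0_decay (n + 4)
  have hC : 0 ≤ C := by
    have := (abs_nonneg _).trans (h 0)
    have h2 := hG.w0_pos 0
    have h3 : 0 < wt (0 : V3) ^ n := by have := wt_pos (0 : V3); positivity
    by_contra hc
    nlinarith [mul_pos h3 h2, mul_pos (neg_pos.2 (not_le.1 hc)) (mul_pos h3 h2)]
  refine ⟨hf.aestronglyMeasurable, ?_⟩
  have key : ∀ ξ, ‖f ξ‖ₑ ≤ ENNReal.ofReal (C * D) * ENNReal.ofReal (wt ξ ^ (-(4 : ℝ))) := fun ξ => by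
    rw [← ofReal_norm, ← ENNReal.ofReal_mul (by positivity)]
    refine ENNReal.ofReal_le_ofReal ((h ξ).trans ?_)
    have hw := wt_pos ξ
    have h4 : wt ξ ^ (-(4 : ℝ)) = (wt ξ ^ 4)⁻¹ := by
      rw [Real.rpow_neg hw.le]; norm_cast
    rw [h4, mul_assoc, mul_assoc]
    refine mul_le_mul_of_nonneg_left ?_ hC
    rw [← div_eq_mul_inv, le_div_iff₀ (by positivity)]
    calc _ = G.w0 ξ * wt ξ ^ (n + 4) := by rw [pow_add]; ring
      _ ≤ D := hd ξ
  refine (lintegral_mono key).trans_lt ?_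
  rw [lintegral_const_mul _ (by have := measurable_wt; fun_prop)]
  exact ENNReal.mul_lt_top ENNReal.ofReal_lt_top (lintegral_wt_rpow_lt_top (by norm_num))

/-- The quadratic form which a collision invariant has as its mass and which bounds its flux. -/
def invForm (T : ℝ) (c : ℝ × V3 × ℝ) : ℝ :=
  (c.1 + 3 * T * c.2.2) ^ 2 + T * ‖c.2.1‖ ^ 2 + 6 * T ^ 2 * c.2.2 ^ 2

theorem invForm_nonneg {T : ℝ} (hT : 0 < T) (c : ℝ × V3 × ℝ) : 0 ≤ invForm T c := by
  unfold invForm; positivity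

theorem continuous_quadMap (u : V3) (c : ℝ × V3 × ℝ) : Continuous (quadMap u c) := by
  change Continuous fun ξ : V3 => c.1 + inner ℝ c.2.1 (ξ - u) + c.2.2 * ‖ξ - u‖ ^ 2
  fun_prop

/-- Bound of a collision invariant by its quadratic form. -/
theorem exists_quadMap_sq_le {T : ℝ} (hT : 0 < T) (u : V3) :
    ∃ C : ℝ, 0 < C ∧ ∀ c ξ, quadMap u c ξ ^ 2 ≤ C * wt ξ ^ 4 * invForm T c := by
  refine ⟨3 * (1 + wt u ^ 2 / T + (wt u ^ 2 + 3 * T) ^ 2 / (6 * T ^ 2)), by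
    have := wt_pos u; positivity, fun c ξ => ?_⟩
  obtain ⟨α, b, γ⟩ := c
  set y := ξ - u with hy
  have hyw : ‖y‖ ^ 2 ≤ wt u ^ 2 * wt ξ ^ 2 := by
    rw [← mul_pow]
    gcongr
    have h1 := norm_sub_le ξ u
    have h2 := norm_nonneg ξ
    have h3 := norm_nonneg u
    simp only [wt]; nlinarith
  have hw1 : 1 ≤ wt ξ ^ 2 := one_le_pow₀ (one_le_wt ξ)
  have hb : (inner ℝ b y : ℝ) ^ 2 ≤ ‖b‖ ^ 2 * ‖y‖ ^ 2 := by
    rw [← mul_pow]; exact sq_le_sq' (by have := abs_real_inner_le_norm b y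
                                        linarith [neg_abs_le (inner ℝ b y : ℝ)])
                      (real_inner_le_norm b y)
  have hq : quadMap u (α, b, γ) ξ = (α + 3 * T * γ) + inner ℝ b y + γ * (‖y‖ ^ 2 - 3 * T) := by
    change α + inner ℝ b y + γ * ‖y‖ ^ 2 = _
    ring
  have h3 : ∀ p q r : ℝ, (p + q + r) ^ 2 ≤ 3 * (p ^ 2 + q ^ 2 + r ^ 2) := fun p q r => by
    nlinarith [sq_nonneg (p - q), sq_nonneg (p - r), sq_nonneg (q - r)]
  rw [hq]
  refine (h3 _ _ _).trans ?_
  have e1 : (α + 3 * T * γ) ^ 2 ≤ wt ξ ^ 4 * invForm T (α, b, γ) := by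
    have : (α + 3 * T * γ) ^ 2 ≤ invForm T (α, b, γ) := by
      simp only [invForm]
      have : 0 ≤ T * ‖b‖ ^ 2 + 6 * T ^ 2 * γ ^ 2 := by positivity
      linarith
    exact this.trans (le_mul_of_one_le_left ((sq_nonneg _).trans this) (one_le_pow₀ (one_le_wt ξ)))
  have e2 : (inner ℝ b y : ℝ) ^ 2 ≤ wt u ^ 2 / T * wt ξ ^ 4 * invForm T (α, b, γ) := by
    have h4 : T * ‖b‖ ^ 2 ≤ invForm T (α, b, γ) := by
      simp only [invForm]
      have : 0 ≤ (α + 3 * T * γ) ^ 2 + 6 * T ^ 2 * γ ^ 2 := by positivity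
      linarith
    have h5 : ‖b‖ ^ 2 ≤ invForm T (α, b, γ) / T := by rw [le_div_iff₀ hT]; linarith
    have h0 : 0 ≤ invForm T (α, b, γ) := (by positivity : 0 ≤ T * ‖b‖ ^ 2).trans h4
    calc _ ≤ ‖b‖ ^ 2 * ‖y‖ ^ 2 := hb
      _ ≤ (invForm T (α, b, γ) / T) * (wt u ^ 2 * (wt ξ ^ 2 * wt ξ ^ 2)) := by
        gcongr
        exact hyw.trans (by gcongr; nlinarith)
      _ = _ := by ring
  have e3 : (γ * (‖y‖ ^ 2 - 3 * T)) ^ 2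
      ≤ (wt u ^ 2 + 3 * T) ^ 2 / (6 * T ^ 2) * wt ξ ^ 4 * invForm T (α, b, γ) := by
    have h4 : 6 * T ^ 2 * γ ^ 2 ≤ invForm T (α, b, γ) := by
      simp only [invForm]
      have : 0 ≤ (α + 3 * T * γ) ^ 2 + T * ‖b‖ ^ 2 := by positivity
      linarith
    have h0 := invForm_nonneg hT (α, b, γ)
    have h5 : γ ^ 2 ≤ invForm T (α, b, γ) / (6 * T ^ 2) := by
      rw [le_div_iff₀ (by positivity)]; linarith
    have h6 : |‖y‖ ^ 2 - 3 * T| ≤ (wt u ^ 2 + 3 * T) * wt ξ ^ 2 := by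
      rw [abs_le]
      constructor <;> nlinarith [sq_nonneg ‖y‖, sq_nonneg (wt u)]
    have h7 : (‖y‖ ^ 2 - 3 * T) ^ 2 ≤ ((wt u ^ 2 + 3 * T) * wt ξ ^ 2) ^ 2 := by
      rw [← sq_abs]; gcongr
    calc _ = γ ^ 2 * (‖y‖ ^ 2 - 3 * T) ^ 2 := by ring
      _ ≤ (invForm T (α, b, γ) / (6 * T ^ 2)) * ((wt u ^ 2 + 3 * T) * wt ξ ^ 2) ^ 2 := by gcongr
      _ = _ := by ring
  linarith

/-- The momentum flux of a collision invariant, by the moments of the Gaussian. -/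
theorem Gas.Admissible.integral_flux (hG : G.Admissible) :
    ∃ Z : ℝ, 0 < Z ∧ ∀ c, ∫ ξ, ξ 0 * (G.w0 ξ * quadMap G.u c ξ) ^ 2
      = Z * (G.u 0 * invForm G.temp c
        + 2 * G.temp * c.2.1 0 * (c.1 + 3 * G.temp * c.2.2 + 2 * G.temp * c.2.2)) := by
  have hT := hG.temp_pos
  set T := G.temp with hTd
  have hc := hG.w0c_pos
  set z := ∫ x : ℝ, Real.exp (-(x ^ 2 / (2 * T))) with hz
  have hzpos : 0 < z := by
    have : z = √(Real.pi / (1 / (2 * T))) := by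
      rw [hz, ← integral_gaussian]; congr 1; ext x; congr 1; ring
    rw [this]; have := Real.pi_pos; positivity
  refine ⟨G.w0c ^ 2 * z ^ 3, by positivity, fun c => ?_⟩
  obtain ⟨C, hC, hq⟩ := exists_quadMap_sq_le hT G.u
  obtain ⟨C0, hC0, hw0⟩ := hG.w0_decay 0
  have hq' := continuous_quadMap G.u c
  have hint : Integrable fun ξ : V3 => ξ 0 * (G.w0 ξ * quadMap G.u c ξ) ^ 2 := by
    refine hG.integrable_of_le_wt_pow (C := C * invForm T c * C0) (n := 5) (by fun_prop) fun ξ => ?_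
    have h1 : |ξ 0| ≤ wt ξ := by
      have := EuclideanSpace.norm_eq ξ
      have h2 : ‖ξ 0‖ ≤ ‖ξ‖ := PiLp.norm_apply_le ξ 0
      rw [Real.norm_eq_abs] at h2
      rw [wt]; linarith
    have hw := G.w0_nonneg ξ
    have hI := invForm_nonneg hT c
    have h5 := hw0 ξ
    rw [pow_zero, mul_one] at h5
    have hwt := wt_pos ξ
    rw [abs_mul, abs_of_nonneg (sq_nonneg (G.w0 ξ * quadMap G.u c ξ)), mul_pow]
    calc _ ≤ wt ξ * ((C0 * G.w0 ξ) * (C * wt ξ ^ 4 * invForm T c)) := by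
          gcongr
          · rw [sq]; gcongr
          · exact hq c ξ
      _ = _ := by ring
  obtain ⟨α, b, γ⟩ := c
  let F : ℝ × ℝ × ℝ → ℝ := fun p => (G.u 0 + p.1) *
    (α + (b 0 * p.1 + b 1 * p.2.1 + b 2 * p.2.2) + γ * (p.1 ^ 2 + p.2.1 ^ 2 + p.2.2 ^ 2)) ^ 2 *
    (Real.exp (-(p.1 ^ 2 / (2 * T))) * Real.exp (-(p.2.1 ^ 2 / (2 * T))) *
      Real.exp (-(p.2.2 ^ 2 / (2 * T))))
  have hFc : Continuous F := by fun_prop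
  have hsub : ∫ ξ, ξ 0 * (G.w0 ξ * quadMap G.u (α, b, γ) ξ) ^ 2
      = ∫ y : V3, G.w0c ^ 2 * F (y 0, y 1, y 2) ∧
      Integrable fun y : V3 => G.w0c ^ 2 * F (y 0, y 1, y 2) := by
    have e : ∀ y : V3, (fun ξ : V3 => ξ 0 * (G.w0 ξ * quadMap G.u (α, b, γ) ξ) ^ 2) (G.u + y)
      = G.w0c ^ 2 * F (y 0, y 1, y 2) := by
      intro y
      have h3 : ‖y‖ ^ 2 = y 0 ^ 2 + y 1 ^ 2 + y 2 ^ 2 := by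
        rw [EuclideanSpace.norm_sq_eq, Fin.sum_univ_three]; simp
      have h4 : (inner ℝ b y : ℝ) = b 0 * y 0 + b 1 * y 1 + b 2 * y 2 := by
        rw [PiLp.inner_apply, Fin.sum_univ_three]; simp [mul_comm]
      have h5 : quadMap G.u (α, b, γ) (G.u + y)
          = α + inner ℝ b y + γ * ‖y‖ ^ 2 := by
        change α + inner ℝ b (G.u + y - G.u) + γ * ‖G.u + y - G.u‖ ^ 2 = _
        rw [add_sub_cancel_left]
      have h6 : G.w0 (G.u + y) ^ 2 = G.w0c ^ 2 * (Real.exp (-(y 0 ^ 2 / (2 * T))) *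
          Real.exp (-(y 1 ^ 2 / (2 * T))) * Real.exp (-(y 2 ^ 2 / (2 * T)))) := by
        rw [G.w0_eq, add_sub_cancel_left, mul_pow, ← Real.exp_nat_mul, ← Real.exp_add,
          ← Real.exp_add, h3]
        congr 2; rw [← hTd]; push_cast; field_simp; ring
      simp only [PiLp.add_apply, F]
      rw [mul_pow, h6, h5, h3, h4]; ring
    constructor
    · rw [← integral_add_left_eq_self _ G.u]
      exact integral_congr_ae (ae_of_all _ e)
    · exact (hint.comp_add_left G.u).congr (ae_of_all _ e)
  have hcI : Integrable fun y : V3 => F (y 0, y 1, y 2) := by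
    refine (hsub.2.const_mul (G.w0c ^ 2)⁻¹).congr (ae_of_all _ fun y => ?_)
    exact inv_mul_cancel_left₀ (by positivity) _
  rw [hsub.1, integral_const_mul, integral_coords hFc hcI]
  have s1 : ∀ x y : ℝ, ∫ w : ℝ, F (x, y, w)
      = ((G.u 0 + x) * z * Real.exp (-(x ^ 2 / (2 * T)))) *
        (((α + b 0 * x + γ * x ^ 2 + b 1 * y + γ * y ^ 2) ^ 2
          + (b 2 ^ 2 + 2 * (α + b 0 * x + γ * x ^ 2 + b 1 * y + γ * y ^ 2) * γ) * T
          + 3 * γ ^ 2 * T ^ 2) * Real.exp (-(y ^ 2 / (2 * T)))) := by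
    intro x y
    have := integral_poly_mul_gaussian hT (p := fun w =>
      (α + (b 0 * x + b 1 * y + b 2 * w) + γ * (x ^ 2 + y ^ 2 + w ^ 2)) ^ 2)
      (a := (α + b 0 * x + γ * x ^ 2 + b 1 * y + γ * y ^ 2) ^ 2)
      (b := 2 * (α + b 0 * x + γ * x ^ 2 + b 1 * y + γ * y ^ 2) * b 2)
      (c := b 2 ^ 2 + 2 * (α + b 0 * x + γ * x ^ 2 + b 1 * y + γ * y ^ 2) * γ)
      (d := 2 * b 2 * γ) (e := γ ^ 2) (f := 0) (fun w => by ring)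
    rw [← hz] at this
    calc _ = ∫ w : ℝ, ((G.u 0 + x) * (Real.exp (-(x ^ 2 / (2 * T))) * Real.exp (-(y ^ 2 / (2 * T)))))
          * ((α + (b 0 * x + b 1 * y + b 2 * w) + γ * (x ^ 2 + y ^ 2 + w ^ 2)) ^ 2 *
          Real.exp (-(w ^ 2 / (2 * T)))) := by
            congr 1; ext w; simp only [F]; ring
      _ = _ := by rw [integral_const_mul, this]; ring
  have s2 : ∀ x : ℝ, ∫ y : ℝ, ((α + b 0 * x + γ * x ^ 2 + b 1 * y + γ * y ^ 2) ^ 2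
          + (b 2 ^ 2 + 2 * (α + b 0 * x + γ * x ^ 2 + b 1 * y + γ * y ^ 2) * γ) * T
          + 3 * γ ^ 2 * T ^ 2) * Real.exp (-(y ^ 2 / (2 * T)))
      = ((α + b 0 * x + γ * x ^ 2) ^ 2 + 4 * γ * T * (α + b 0 * x + γ * x ^ 2)
        + T * (b 1 ^ 2 + b 2 ^ 2) + 8 * T ^ 2 * γ ^ 2) * z := by
    intro x
    rw [integral_poly_mul_gaussian hT
      (a := (α + b 0 * x + γ * x ^ 2) ^ 2 + 2 * γ * T * (α + b 0 * x + γ * x ^ 2) + T * b 2 ^ 2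
        + 3 * T ^ 2 * γ ^ 2)
      (b := 2 * (α + b 0 * x + γ * x ^ 2) * b 1 + 2 * γ * T * b 1)
      (c := b 1 ^ 2 + 2 * (α + b 0 * x + γ * x ^ 2) * γ + 2 * γ ^ 2 * T)
      (d := 2 * b 1 * γ) (e := γ ^ 2) (f := 0) (fun w => by ring)]
    rw [← hz]; ring
  simp only [s1, integral_const_mul, s2]
  have s3 := integral_poly_mul_gaussian hT (p := fun x => (G.u 0 + x) *
      ((α + b 0 * x + γ * x ^ 2) ^ 2 + 4 * γ * T * (α + b 0 * x + γ * x ^ 2)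
        + T * (b 1 ^ 2 + b 2 ^ 2) + 8 * T ^ 2 * γ ^ 2))
    (a := G.u 0 * (α ^ 2 + 4 * γ * T * α + T * (b 1 ^ 2 + b 2 ^ 2) + 8 * T ^ 2 * γ ^ 2))
    (b := G.u 0 * (2 * α * b 0 + 4 * γ * T * b 0)
      + (α ^ 2 + 4 * γ * T * α + T * (b 1 ^ 2 + b 2 ^ 2) + 8 * T ^ 2 * γ ^ 2))
    (c := G.u 0 * (b 0 ^ 2 + 2 * α * γ + 4 * γ ^ 2 * T) + (2 * α * b 0 + 4 * γ * T * b 0))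
    (d := G.u 0 * (2 * b 0 * γ) + (b 0 ^ 2 + 2 * α * γ + 4 * γ ^ 2 * T))
    (e := G.u 0 * γ ^ 2 + 2 * b 0 * γ) (f := γ ^ 2) (fun x => by ring)
  have hb2 : ‖b‖ ^ 2 = b 0 ^ 2 + b 1 ^ 2 + b 2 ^ 2 := by
    rw [EuclideanSpace.norm_sq_eq, Fin.sum_univ_three]; simp
  rw [← hz] at s3
  calc _ = G.w0c ^ 2 * ∫ x : ℝ, z ^ 2 * (((G.u 0 + x) *
      ((α + b 0 * x + γ * x ^ 2) ^ 2 + 4 * γ * T * (α + b 0 * x + γ * x ^ 2)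
        + T * (b 1 ^ 2 + b 2 ^ 2) + 8 * T ^ 2 * γ ^ 2)) * Real.exp (-(x ^ 2 / (2 * T)))) := by
        congr 2; ext x; ring
    _ = _ := by
      rw [integral_const_mul, s3]
      simp only [invForm, hb2]; ring

variable {G : Gas}

/-! ### Flux and coercivity -/

theorem abs_coord_le_wt (ξ : V3) (i : Fin 3) : |ξ i| ≤ wt ξ := by
  have h2 : ‖ξ i‖ ≤ ‖ξ‖ := PiLp.norm_apply_le ξ i
  rw [Real.norm_eq_abs] at h2
  rw [wt]; linarith

theorem VelL2_integrable_sq (g : VelL2) : Integrable fun ξ => g ξ ^ 2 := by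
  simpa only [sq] using L2_integrable_mul g g

theorem VelL2_norm_sq (g : VelL2) : ‖g‖ ^ 2 = ∫ ξ, g ξ ^ 2 := by
  rw [← real_inner_self_eq_norm_sq, L2_inner_eq]; simp only [sq]

/-- The momentum flux `∫ ξ₁ f²` of `f = ⟨ξ⟩^{-1/2} g`. -/
def flux (g : VelL2) : ℝ := ∫ ξ : V3, ξ 0 / wt ξ * g ξ ^ 2

theorem flux_weight_le (ξ : V3) : |ξ 0 / wt ξ| ≤ 1 := by
  rw [abs_div, abs_of_pos (wt_pos ξ)]
  exact div_le_one_of_le₀ (abs_coord_le_wt ξ 0) (wt_pos ξ).le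

theorem flux_integrable (g : VelL2) : Integrable fun ξ : V3 => ξ 0 / wt ξ * g ξ ^ 2 := by
  refine (VelL2_integrable_sq g).bdd_mul (c := 1) ?_ (ae_of_all _ flux_weight_le)
  have hm0 : Measurable fun x : V3 => x 0 := by fun_prop
  have := measurable_wt
  exact (by fun_prop : Measurable fun ξ : V3 => ξ 0 / wt ξ).aestronglyMeasurable

/-- Incoming flow with Mach number below `-1` makes the flux negative on collision invariants. -/
theorem Gas.Admissible.flux_le_of_diss_eq_zero (hG : G.Admissible) :
    ∃ c : ℝ, 0 < c ∧ ∀ g : VelL2, hG.diss g = 0 → flux g ≤ - (c * ‖g‖ ^ 2) := by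
  obtain ⟨Z, hZ, hflux⟩ := hG.integral_flux
  have hT := hG.temp_pos
  obtain ⟨C, hC, hq⟩ := exists_quadMap_sq_le hT G.u
  obtain ⟨D, hD, hw⟩ := hG.w0_decay 9
  obtain ⟨C0, hC0, hw0⟩ := hG.w0_decay 0
  set I := ∫ ξ : V3, wt ξ ^ (-(4 : ℝ)) with hI
  have hIi : Integrable fun ξ : V3 => wt ξ ^ (-(4 : ℝ)) :=
    integrable_one_add_norm (by simp; norm_num)
  have hI0 : 0 ≤ I := integral_nonneg fun ξ => Real.rpow_nonneg (wt_pos ξ).le _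
  set s := √(5 * G.temp / 3) with hs
  have hs0 : 0 < s := Real.sqrt_pos.2 (by positivity)
  have hs2 : s ^ 2 = 5 * G.temp / 3 := Real.sq_sqrt (by positivity)
  -- the Mach number is below `-1`
  have hd : 0 < -G.u 0 - s := by
    have := hG.mach_lt
    rw [Gas.mach, div_lt_iff₀ hs0] at this
    linarith
  refine ⟨(-G.u 0 - s) * Z / (C * C0 * D * I + 1), by positivity, fun g hg => ?_⟩
  obtain ⟨c, hc⟩ := hG.unw_eq_of_diss_eq_zero hg
  have hgc : ∀ᵐ ξ, g ξ ^ 2 = wt ξ * (G.w0 ξ * quadMap G.u c ξ) ^ 2 := by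
    filter_upwards [hc] with ξ hξ
    rw [← hξ, unw, mul_pow, inv_pow, Real.sq_sqrt (wt_pos ξ).le, mul_inv_cancel_left₀ (wt_pos ξ).ne']
  have e1 : flux g = ∫ ξ, ξ 0 * (G.w0 ξ * quadMap G.u c ξ) ^ 2 := by
    refine integral_congr_ae ?_
    filter_upwards [hgc] with ξ hξ
    rw [hξ, ← mul_assoc, div_mul_cancel₀ _ (wt_pos ξ).ne']
  have hS := invForm_nonneg hT c
  have e2 : flux g ≤ - ((-G.u 0 - s) * Z * invForm G.temp c) := by
    rw [e1, hflux]
    have hb : c.2.1 0 ^ 2 ≤ ‖c.2.1‖ ^ 2 := by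
      rw [← sq_abs]
      gcongr
      exact PiLp.norm_apply_le c.2.1 0
    have key : 2 * G.temp * c.2.1 0 * (c.1 + 3 * G.temp * c.2.2 + 2 * G.temp * c.2.2)
        ≤ s * invForm G.temp c := by
      simp only [invForm]
      set A := c.1 + 3 * G.temp * c.2.2
      set γ := c.2.2
      set b := c.2.1 0
      have h1 : s * (2 * G.temp * b * (A + 2 * G.temp * γ)) ≤
          s * (s * (A ^ 2 + G.temp * ‖c.2.1‖ ^ 2 + 6 * G.temp ^ 2 * γ ^ 2)) := by
        have : s * (s * (A ^ 2 + G.temp * ‖c.2.1‖ ^ 2 + 6 * G.temp ^ 2 * γ ^ 2))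
          = 5 * G.temp / 3 * (A ^ 2 + G.temp * ‖c.2.1‖ ^ 2 + 6 * G.temp ^ 2 * γ ^ 2) := by
          rw [← hs2]; ring
        rw [this]
        have h3 : 2 * (s * b) * (A + 2 * G.temp * γ) ≤
            (s * b) ^ 2 + (A + 2 * G.temp * γ) ^ 2 := two_mul_le_add_sq _ _
        have h4 : (A + 2 * G.temp * γ) ^ 2 ≤ 5 / 3 * (A ^ 2 + 6 * G.temp ^ 2 * γ ^ 2) := by
          nlinarith [sq_nonneg (2 * A - 6 * G.temp * γ)]
        rw [mul_pow, hs2] at h3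
        have h5 := mul_le_mul_of_nonneg_left (h3.trans (add_le_add_right h4 _)) hT.le
        have h6 := mul_le_mul_of_nonneg_left hb (by positivity : 0 ≤ 5 * G.temp ^ 2 / 3)
        linarith
      exact le_of_mul_le_mul_left h1 hs0
    have := mul_le_mul_of_nonneg_left key hZ.le
    linarith
  have e3 : ‖g‖ ^ 2 ≤ (C * C0 * D * I) * invForm G.temp c := by
    rw [VelL2_norm_sq, integral_congr_ae hgc]
    calc _ ≤ ∫ ξ : V3, (C * C0 * D * invForm G.temp c) * wt ξ ^ (-(4 : ℝ)) := by
          refine integral_mono_ae ((VelL2_integrable_sq g).congr hgc) (hIi.const_mul _)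
            (ae_of_all _ fun ξ => ?_)
          have hwp := wt_pos ξ
          have h0 := G.w0_nonneg ξ
          have h4 : wt ξ ^ (-(4 : ℝ)) = (wt ξ ^ 4)⁻¹ := by
            rw [Real.rpow_neg hwp.le]; norm_cast
          have h5 := hw0 ξ
          rw [pow_zero, mul_one] at h5
          simp only
          rw [h4, ← div_eq_mul_inv, le_div_iff₀ (by positivity)]
          calc _ = G.w0 ξ * (G.w0 ξ * wt ξ ^ 5) * quadMap G.u c ξ ^ 2 := by ring
            _ ≤ C0 * (G.w0 ξ * wt ξ ^ 5) * (C * wt ξ ^ 4 * invForm G.temp c) := by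
              gcongr; exact hq c ξ
            _ = C * C0 * (G.w0 ξ * wt ξ ^ 9) * invForm G.temp c := by ring
            _ ≤ C * C0 * D * invForm G.temp c := by gcongr; exact hw ξ
      _ = _ := by rw [integral_const_mul]; ring
  refine e2.trans (neg_le_neg ?_)
  rw [div_mul_eq_mul_div, div_le_iff₀ (by positivity), mul_assoc _ (invForm G.temp c)]
  refine mul_le_mul_of_nonneg_left (e3.trans ?_) (by positivity)
  nlinarith

/-- For small `σ` the sum of the flux term and the linearized collision term is coercive. -/
theorem Gas.Admissible.coercive (hG : G.Admissible) {κ : ℝ} (hκ : 0 < κ) :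
    ∃ σ₁ : ℝ, 0 < σ₁ ∧ ∀ σ, 0 < σ → σ ≤ σ₁ → ∃ c : ℝ, 0 < c ∧ ∀ g : VelL2,
      σ * flux g - κ * ‖hG.diss g‖ ^ 2 ≤ - (c * ‖g‖ ^ 2) := by
  obtain ⟨l, hl, hgap⟩ := hG.spectral_gap
  obtain ⟨c, hc, hker⟩ := hG.flux_le_of_diss_eq_zero
  set K := 2 / c + 1 with hK
  have hK0 : 0 < K := by positivity
  refine ⟨κ * l / (2 * K), by positivity, fun σ hσ hσ1 => ⟨min (σ * (c / 2)) (κ * l / 2),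
    by positivity, fun g => ?_⟩⟩
  set N := LinearMap.ker hG.diss.toLinearMap with hN
  have hNc : IsClosed (N : Set VelL2) := hG.diss.isClosed_ker
  have : CompleteSpace N := hNc.completeSpace_coe
  obtain ⟨q, hq, r, hr, rfl⟩ := N.exists_add_mem_mem_orthogonal g
  have hq0 : hG.diss q = 0 := hq
  have hpyth : ‖q + r‖ ^ 2 = ‖q‖ ^ 2 + ‖r‖ ^ 2 := by
    have := norm_add_sq_eq_norm_sq_add_norm_sq_of_inner_eq_zero q r
      (Submodule.inner_right_of_mem_orthogonal hq hr)
    simpa only [sq] using this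
  -- the mixed term is absorbed with half of the negative flux on the kernel; the rest is controlled
  -- by the spectral gap when `σ` is small
  have hflux : flux (q + r) ≤ flux q + c / 2 * ‖q‖ ^ 2 + K * ‖r‖ ^ 2 := by
    rw [VelL2_norm_sq, VelL2_norm_sq, ← integral_const_mul, ← integral_const_mul, flux, flux,
      ← integral_add (flux_integrable q) ((VelL2_integrable_sq q).const_mul _),
      ← integral_add (f := fun ξ => ξ 0 / wt ξ * q ξ ^ 2 + c / 2 * q ξ ^ 2)
        ((flux_integrable q).add ((VelL2_integrable_sq q).const_mul _))
        ((VelL2_integrable_sq r).const_mul _)]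
    refine integral_mono_ae (flux_integrable _) (((flux_integrable q).add
      ((VelL2_integrable_sq q).const_mul _)).add ((VelL2_integrable_sq r).const_mul _)) ?_
    filter_upwards [Lp.coeFn_add q r] with ξ hξ
    simp only [hξ, Pi.add_apply]
    have hm := abs_le.1 (flux_weight_le ξ)
    set m := ξ 0 / wt ξ
    set a := q ξ
    set b := r ξ
    have h1 : 2 * |a * b| ≤ c / 2 * a ^ 2 + 2 / c * b ^ 2 := by
      have h3 : 0 ≤ (c * |a| - 2 * |b|) ^ 2 / (2 * c) := by positivity
      have h4 : (c * |a| - 2 * |b|) ^ 2 / (2 * c)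
          = c / 2 * a ^ 2 + 2 / c * b ^ 2 - 2 * |a * b| := by
        rw [abs_mul, ← sq_abs a, ← sq_abs b]; field_simp; ring
      linarith
    have h2 : m * (a * b) ≤ |a * b| := by
      refine (le_abs_self _).trans ?_
      rw [abs_mul]
      exact mul_le_of_le_one_left (abs_nonneg _) (flux_weight_le ξ)
    have h3 : m * b ^ 2 ≤ b ^ 2 := mul_le_of_le_one_left (sq_nonneg _) hm.2
    rw [hK]
    linarith [(by ring : m * (a + b) ^ 2 = m * a ^ 2 + 2 * (m * (a * b)) + m * b ^ 2)]
  have hd : hG.diss (q + r) = hG.diss r := by rw [map_add, hq0, zero_add]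
  have h1 := hgap r hr
  have h2 := hker q hq0
  rw [hd, hpyth]
  have h3 := mul_le_mul_of_nonneg_left hflux hσ.le
  have h4 := mul_le_mul_of_nonneg_left h2 hσ.le
  have h5 := mul_le_mul_of_nonneg_left h1 hκ.le
  have h6 : σ * (K * ‖r‖ ^ 2) ≤ κ * l / 2 * ‖r‖ ^ 2 := by
    rw [← mul_assoc]
    refine mul_le_mul_of_nonneg_right ?_ (sq_nonneg _)
    rw [le_div_iff₀ (by positivity)] at hσ1
    linarith
  have h7 := mul_le_mul_of_nonneg_right (min_le_left (σ * (c / 2)) (κ * l / 2)) (sq_nonneg ‖q‖)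
  have h8 := mul_le_mul_of_nonneg_right (min_le_right (σ * (c / 2)) (κ * l / 2)) (sq_nonneg ‖r‖)
  linarith

/-- The linearized operator is its nonlocal part minus the multiplication by the collision
frequency. -/
theorem Gas.Admissible.lin_eq (hG : G.Admissible) {f : V3 → ℝ} (hf : Measurable f)
    (h2 : ∫⁻ η, ‖f η‖ₑ ^ 2 < ⊤) (ξ : V3) :
    G.Lin f ξ = G.rho * G.sigma * (G.nl f ξ - G.freq ξ * f ξ) := by
  have hw := hG.w0_pos
  have hi := hG.integrable_nlInt hf h2 ξ
  have hfi : Integrable (fun p : V3 × Metric.sphere (0 : V3) 1 =>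
      |(inner ℝ (ξ - p.1) (p.2 : V3) : ℝ)| * G.w0 p.1 ^ 2) part := by
    obtain ⟨c, C, hc, hC, h⟩ := hG.freq_bounds
    refine ⟨by fun_prop, ?_⟩
    have e := (h ξ).1
    refine lt_of_le_of_lt (le_of_eq ?_) (e.trans_lt ENNReal.ofReal_lt_top)
    exact lintegral_congr fun p => Real.enorm_of_nonneg (by positivity)
  have key : ∀ F K : V3 → ℝ, (∀ p : V3 × Metric.sphere (0 : V3) 1,
      F (post ξ p.1 p.2) * K (postStar ξ p.1 p.2) + F (postStar ξ p.1 p.2) * K (post ξ p.1 p.2)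
      - F ξ * K p.1 - F p.1 * K ξ = (G.rho * G.w0 ξ) *
        (G.w0 p.1 * G.w0 (post ξ p.1 p.2) * f (postStar ξ p.1 p.2)
      + G.w0 p.1 * G.w0 (postStar ξ p.1 p.2) * f (post ξ p.1 p.2)
      - G.w0 ξ * G.w0 p.1 * f p.1 - G.w0 p.1 ^ 2 * f ξ)) →
      G.Q F K ξ = 1 / 2 * (G.rho * G.w0 ξ * G.sigma * (G.nl f ξ - G.freq ξ * f ξ)) := by
    intro F K h
    have e : G.nl f ξ - G.freq ξ * f ξ = ∫ p : V3 × Metric.sphere (0 : V3) 1,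
        (G.nlInt f ξ p - |(inner ℝ (ξ - p.1) (p.2 : V3) : ℝ)| * G.w0 p.1 ^ 2 * f ξ) ∂part := by
      rw [integral_sub hi (hfi.mul_const _), integral_mul_const]; rfl
    rw [Gas.Q, e]
    congr 1
    rw [← integral_const_mul]
    refine integral_congr_ae (ae_of_all _ fun p => ?_)
    simp only [h p, Gas.nlInt]; ring
  rw [Gas.Lin, key, key]
  · have := (hw ξ).ne'
    field_simp; ring
  · intro p
    have := w0_post_mul (G := G) ξ p.1 p.2
    simp only [hG.minf_eq]
    linear_combination G.rho * (G.w0 (post ξ p.1 p.2) * f (postStar ξ p.1 p.2)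
      + G.w0 (postStar ξ p.1 p.2) * f (post ξ p.1 p.2)) * this
  · intro p
    have := w0_post_mul (G := G) ξ p.1 p.2
    simp only [hG.minf_eq]
    linear_combination G.rho * (G.w0 (post ξ p.1 p.2) * f (postStar ξ p.1 p.2)
      + G.w0 (postStar ξ p.1 p.2) * f (post ξ p.1 p.2)) * this

variable {G : Gas}

/-! ### The quadratic collision term -/

/-- The integrand of `Γ(h, k)`, up to the factor `σ₀ / 2`. -/
def Gas.gInt (G : Gas) (h k : V3 → ℝ) (ξ : V3) (p : V3 × Metric.sphere (0 : V3) 1) : ℝ :=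
  G.w0 p.1 * |(inner ℝ (ξ - p.1) (p.2 : V3) : ℝ)| *
    (h (post ξ p.1 p.2) * k (postStar ξ p.1 p.2) + h (postStar ξ p.1 p.2) * k (post ξ p.1 p.2)
      - h ξ * k p.1 - h p.1 * k ξ)

theorem Gas.Admissible.gam_eq (hG : G.Admissible) (h k : V3 → ℝ) (ξ : V3) :
    G.Gam h k ξ = G.sigma / 2 * ∫ p, G.gInt h k ξ p ∂part := by
  have hw := (hG.w0_pos ξ).ne'
  have : G.Q (fun v => G.w0 v * h v) (fun v => G.w0 v * k v) ξ
      = 1 / 2 * (G.w0 ξ * G.sigma * ∫ p, G.gInt h k ξ p ∂part) := by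
    rw [Gas.Q]
    congr 1
    rw [← integral_const_mul]
    refine integral_congr_ae (ae_of_all _ fun p => ?_)
    have := w0_post_mul (G := G) ξ p.1 p.2
    simp only [Gas.gInt]
    linear_combination (h (post ξ p.1 p.2) * k (postStar ξ p.1 p.2)
      + h (postStar ξ p.1 p.2) * k (post ξ p.1 p.2)) *
      (G.sigma * |(inner ℝ (ξ - p.1) (p.2 : V3) : ℝ)|) * this
  rw [Gas.Gam, this]
  field_simp

theorem Gas.enorm_gInt_le (h k : V3 → ℝ) (ξ : V3) :
    ∫⁻ p, ‖G.gInt h k ξ p‖ₑ ∂part ≤ G.gAbs h k ξ := by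
  refine lintegral_mono fun p => ?_
  have := G.w0_nonneg p.1
  rw [Gas.gInt, enorm_mul, Real.enorm_of_nonneg (by positivity)]
  refine mul_le_mul_right ?_ _
  refine enorm_sub_le.trans ?_
  rw [enorm_mul (h p.1)]
  gcongr
  refine enorm_sub_le.trans ?_
  rw [enorm_mul (h ξ)]
  gcongr
  refine (enorm_add_le _ _).trans ?_
  rw [enorm_mul, enorm_mul]

@[fun_prop] theorem Gas.measurable_gInt {h k : V3 → ℝ} (hh : Measurable h) (hk : Measurable k)
    (ξ : V3) : Measurable (G.gInt h k ξ) := by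
  unfold Gas.gInt; fun_prop

theorem Gas.Admissible.enorm_gam_le (hG : G.Admissible) (h k : V3 → ℝ) (ξ : V3) :
    ‖G.Gam h k ξ‖ₑ ≤ ENNReal.ofReal G.sigma * G.gAbs h k ξ := by
  have hs := hG.sigma_pos
  rw [hG.gam_eq, enorm_mul, Real.enorm_of_nonneg (by positivity)]
  refine mul_le_mul' (ENNReal.ofReal_le_ofReal (by linarith)) ?_
  exact (enorm_integral_le_lintegral_enorm _).trans (G.enorm_gInt_le h k ξ)

theorem Gas.integrable_gInt {h k : V3 → ℝ} (hh : Measurable h) (hk : Measurable k) {ξ : V3}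
    (hf : G.gAbs h k ξ < ⊤) : Integrable (G.gInt h k ξ) part :=
  ⟨(G.measurable_gInt hh hk ξ).aestronglyMeasurable, (G.enorm_gInt_le h k ξ).trans_lt hf⟩

theorem Gas.Admissible.gam_add_right (hG : G.Admissible) {h k k' : V3 → ℝ} (hh : Measurable h)
    (hk : Measurable k) (hk' : Measurable k') {ξ : V3} (h1 : G.gAbs h k ξ < ⊤)
    (h2 : G.gAbs h k' ξ < ⊤) : G.Gam h (k + k') ξ = G.Gam h k ξ + G.Gam h k' ξ := by
  rw [hG.gam_eq, hG.gam_eq, hG.gam_eq, ← mul_add, ← integral_add (G.integrable_gInt hh hk h1)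
    (G.integrable_gInt hh hk' h2)]
  congr 2; ext p; simp only [Gas.gInt, Pi.add_apply]; ring

theorem Gas.Admissible.gam_smul_right (hG : G.Admissible) (c : ℝ) (h k : V3 → ℝ) (ξ : V3) :
    G.Gam h (c • k) ξ = c * G.Gam h k ξ := by
  rw [hG.gam_eq, hG.gam_eq, mul_left_comm, ← integral_const_mul c]
  congr 2; ext p; simp only [Gas.gInt, Pi.smul_apply, smul_eq_mul]; ring

theorem Gas.Admissible.gam_comm (hG : G.Admissible) (h k : V3 → ℝ) (ξ : V3) :
    G.Gam h k ξ = G.Gam k h ξ := by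
  rw [hG.gam_eq, hG.gam_eq]
  congr 2; ext p; simp only [Gas.gInt]; ring

theorem measurable_gAbs_param {X : Type*} [MeasurableSpace X] {h k : X × V3 → ℝ}
    (hh : Measurable h) (hk : Measurable k) :
    Measurable fun z : X × V3 => G.gAbs (fun v => h (z.1, v)) (fun v => k (z.1, v)) z.2 := by
  unfold Gas.gAbs
  refine Measurable.lintegral_prod_right' (f := fun y : (X × V3) × V3 × Metric.sphere (0 : V3) 1 =>
    ENNReal.ofReal (G.w0 y.2.1 * |(inner ℝ (y.1.2 - y.2.1) (y.2.2 : V3) : ℝ)|) *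
      (‖h (y.1.1, post y.1.2 y.2.1 y.2.2)‖ₑ * ‖k (y.1.1, postStar y.1.2 y.2.1 y.2.2)‖ₑ
        + ‖h (y.1.1, postStar y.1.2 y.2.1 y.2.2)‖ₑ * ‖k (y.1.1, post y.1.2 y.2.1 y.2.2)‖ₑ
        + ‖h (y.1.1, y.1.2)‖ₑ * ‖k (y.1.1, y.2.1)‖ₑ
        + ‖h (y.1.1, y.2.1)‖ₑ * ‖k (y.1.1, y.1.2)‖ₑ)) ?_
  fun_prop

theorem measurable_gam_param {X : Type*} [MeasurableSpace X] (hG : G.Admissible) {h k : X × V3 → ℝ}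
    (hh : Measurable h) (hk : Measurable k) :
    Measurable fun z : X × V3 => G.Gam (fun v => h (z.1, v)) (fun v => k (z.1, v)) z.2 := by
  simp only [hG.gam_eq]
  refine Measurable.const_mul ?_ _
  refine (StronglyMeasurable.integral_prod_right' (f := fun y : (X × V3) × V3 ×
    Metric.sphere (0 : V3) 1 => G.gInt (fun v => h (y.1.1, v)) (fun v => k (y.1.1, v)) y.1.2 y.2)
    ?_).measurable
  unfold Gas.gInt
  exact (by fun_prop : Measurable _).stronglyMeasurable

theorem measurable_gam (hG : G.Admissible) {h k : V3 → ℝ} (hh : Measurable h)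
    (hk : Measurable k) : Measurable (G.Gam h k) :=
  (measurable_gam_param (X := Unit) hG (h := fun z => h z.2) (k := fun z => k z.2) (by fun_prop)
    (by fun_prop)).comp (g := fun z : Unit × V3 => G.Gam h k z.2) (f := fun ξ : V3 => ((), ξ)) (by fun_prop)

/-! ### The velocity weight -/

/-- The smooth weight `(1 + ε² |ξ|²)^{-1/2}`. -/
def mu (ε : ℝ) (ξ : V3) : ℝ := (√(1 + ε ^ 2 * ‖ξ‖ ^ 2))⁻¹

theorem mu_pos (ε : ℝ) (ξ : V3) : 0 < mu ε ξ := by unfold mu; positivity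

theorem mu_le_one (ε : ℝ) (ξ : V3) : mu ε ξ ≤ 1 := by
  refine inv_le_one_of_one_le₀ ?_
  rw [Real.one_le_sqrt]
  have : 0 ≤ ε ^ 2 * ‖ξ‖ ^ 2 := by positivity
  linarith

theorem contDiff_mu (ε : ℝ) {n : WithTop ℕ∞} : ContDiff ℝ n (mu ε) := by
  unfold mu
  have h : ∀ ξ : V3, 0 < 1 + ε ^ 2 * ‖ξ‖ ^ 2 := fun ξ => by positivity
  exact ((contDiff_const.add (contDiff_const.mul (contDiff_norm_sq ℝ))).sqrt
    fun ξ => (h ξ).ne').inv fun ξ => (Real.sqrt_pos.2 (h ξ)).ne'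

@[fun_prop] theorem measurable_mu (ε : ℝ) : Measurable (mu ε) :=
  (contDiff_mu ε (n := 0)).continuous.measurable

theorem wt_mul_mu_le {ε : ℝ} (hε : 0 < ε) (ξ : V3) : wt ξ * mu ε ξ ≤ 1 + ε⁻¹ := by
  rw [mu, ← div_eq_mul_inv, div_le_iff₀ (by positivity), wt]
  have h1 : 1 ≤ √(1 + ε ^ 2 * ‖ξ‖ ^ 2) := by
    rw [Real.one_le_sqrt]
    have : 0 ≤ ε ^ 2 * ‖ξ‖ ^ 2 := by positivity
    linarith
  have h2 : ε * ‖ξ‖ ≤ √(1 + ε ^ 2 * ‖ξ‖ ^ 2) := by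
    refine Real.le_sqrt_of_sq_le ?_
    rw [mul_pow]; linarith
  have h3 : ‖ξ‖ ≤ ε⁻¹ * √(1 + ε ^ 2 * ‖ξ‖ ^ 2) := by
    rw [inv_mul_eq_div, le_div_iff₀ hε]; linarith
  linarith

theorem mu_sq (ε : ℝ) (ξ : V3) : mu ε ξ ^ 2 = (1 + ε ^ 2 * ‖ξ‖ ^ 2)⁻¹ := by
  rw [mu, inv_pow, Real.sq_sqrt (by positivity)]

theorem slowWeight_mu_sq {ε : ℝ} (h0 : 0 < ε) (h1 : ε ≤ 1) : SlowWeight fun ξ => mu ε ξ ^ 2 where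
  meas := by fun_prop
  pos ξ := pow_pos (mu_pos ε ξ) 2
  slow ζ ξ η h := by
    rw [mu_sq, mu_sq, ← div_eq_mul_inv, le_div_iff₀ (by positivity), inv_mul_le_iff₀ (by positivity),
      wt]
    have hx := norm_nonneg ξ
    have hy := norm_nonneg η
    have h2 : ‖ζ‖ ^ 2 ≤ (‖ξ‖ + ‖η‖) ^ 2 := by gcongr
    have h3 : ε ^ 2 ≤ 1 := pow_le_one₀ h0.le h1
    have h4 : ε ^ 2 * ‖ζ‖ ^ 2 ≤ ε ^ 2 * (‖ξ‖ + ‖η‖) ^ 2 := by gcongr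
    have h5 : ε ^ 2 * ‖ξ‖ ≤ 1 + ε ^ 2 * ‖ξ‖ ^ 2 := by
      nlinarith [sq_nonneg (ε * ‖ξ‖ - 1), sq_nonneg (ε * ‖ξ‖), mul_nonneg h0.le hx]
    have h6 : ε ^ 2 * ‖η‖ ^ 2 ≤ ‖η‖ ^ 2 := mul_le_of_le_one_left (sq_nonneg _) h3
    have h7 := mul_le_mul_of_nonneg_right h5 hy
    have h8 : 0 ≤ ε ^ 2 * ‖ξ‖ ^ 2 * ‖η‖ ^ 2 := by positivity
    nlinarith

theorem slowWeight_wt_inv : SlowWeight fun ξ => (wt ξ)⁻¹ where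
  meas := by have := measurable_wt; fun_prop
  pos ξ := inv_pos.2 (wt_pos ξ)
  slow ζ ξ η h := by
    have h1 := wt_pos ζ
    have h2 := wt_pos ξ
    have h3 := one_le_wt η
    rw [← div_eq_mul_inv, le_div_iff₀ h1, inv_mul_le_iff₀ h2]
    have h4 : wt ζ ≤ wt ξ * wt η := by
      simp only [wt] at *
      nlinarith [mul_nonneg (norm_nonneg ξ) (norm_nonneg η)]
    nlinarith [mul_pos h2 (wt_pos η)]

theorem abs_mu_sub_le {ε : ℝ} (hε : 0 < ε) (ξ η : V3) :
    |mu ε ξ - mu ε η| ≤ ε * mu ε η * wt (η - ξ) := by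
  have hs : ∀ a b : ℝ, 0 ≤ a → 0 ≤ b → √(1 + a ^ 2) - √(1 + b ^ 2) ≤ |a - b| := by
    intro a b ha hb
    rw [sub_le_iff_le_add]
    refine Real.sqrt_le_iff.2 ⟨by positivity, ?_⟩
    have h1 : b ≤ √(1 + b ^ 2) := Real.le_sqrt_of_sq_le (by linarith)
    have h2 : √(1 + b ^ 2) ^ 2 = 1 + b ^ 2 := Real.sq_sqrt (by positivity)
    have h3 := mul_le_mul_of_nonneg_left h1 (abs_nonneg (a - b))
    have h4 := mul_le_mul_of_nonneg_right (le_abs_self (a - b)) hb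
    nlinarith [sq_abs (a - b)]
  have hb : |√(1 + (ε * ‖ξ‖) ^ 2) - √(1 + (ε * ‖η‖) ^ 2)| ≤ ε * ‖η - ξ‖ := by
    have h1 : |ε * ‖ξ‖ - ε * ‖η‖| ≤ ε * ‖η - ξ‖ := by
      rw [← mul_sub, abs_mul, abs_of_pos hε, norm_sub_rev]
      gcongr
      exact abs_norm_sub_norm_le ξ η
    refine (abs_sub_le_iff.2 ⟨hs _ _ (by positivity) (by positivity), ?_⟩).trans h1
    rw [abs_sub_comm]
    exact hs _ _ (by positivity) (by positivity)
  have e : mu ε ξ - mu ε η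
      = mu ε ξ * mu ε η * (√(1 + (ε * ‖η‖) ^ 2) - √(1 + (ε * ‖ξ‖) ^ 2)) := by
    have h1 : 0 < √(1 + ε ^ 2 * ‖ξ‖ ^ 2) := by positivity
    have h2 : 0 < √(1 + ε ^ 2 * ‖η‖ ^ 2) := by positivity
    simp only [mu, mul_pow]
    field_simp
  rw [e, abs_mul, abs_of_pos (mul_pos (mu_pos ε ξ) (mu_pos ε η)), abs_sub_comm]
  calc _ ≤ 1 * mu ε η * (ε * wt (η - ξ)) := by
        have := mu_pos ε η
        gcongr
        · exact mu_le_one ε ξ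
        · refine hb.trans ?_
          gcongr
          simp [wt]
    _ = _ := by ring

variable {G : Gas}

/-! ### The dissipation estimate for fixed position -/

theorem integral_sq_eq_toReal {α : Type*} [MeasurableSpace α] {ν : Measure α} {f : α → ℝ}
    (hf : AEStronglyMeasurable f ν) : ∫ a, f a ^ 2 ∂ν = (∫⁻ a, ‖f a‖ₑ ^ 2 ∂ν).toReal := by
  rw [integral_eq_lintegral_of_nonneg_ae (ae_of_all _ fun a => sq_nonneg _) (hf.pow 2)]
  congr 1
  refine lintegral_congr fun a => ?_
  rw [← ofReal_norm, ← ENNReal.ofReal_pow (norm_nonneg _), Real.norm_eq_abs, sq_abs]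

/-- Cauchy–Schwarz inequality for a factor bounded by the other one in mean square. -/
theorem abs_integral_mul_le_of_lintegral {α : Type*} [MeasurableSpace α] {ν : Measure α}
    {a b : α → ℝ} (ha : AEStronglyMeasurable a ν) (hb : AEStronglyMeasurable b ν) {t : ℝ}
    (ht : 0 ≤ t) (ha2 : ∫⁻ x, ‖a x‖ₑ ^ 2 ∂ν < ⊤)
    (hab : ∫⁻ x, ‖b x‖ₑ ^ 2 ∂ν ≤ ENNReal.ofReal (t ^ 2) * ∫⁻ x, ‖a x‖ₑ ^ 2 ∂ν) :
    Integrable (fun x => a x * b x) ν ∧ |∫ x, a x * b x ∂ν| ≤ t * ∫ x, a x ^ 2 ∂ν := by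
  have hcs := lintegral_mul_sq_le_mul ν (f := fun x => ‖a x‖ₑ) (g := fun x => ‖b x‖ₑ)
    ha.enorm hb.enorm
  have h1 : (∫⁻ x, ‖a x * b x‖ₑ ∂ν) ^ 2 ≤ (ENNReal.ofReal t * ∫⁻ x, ‖a x‖ₑ ^ 2 ∂ν) ^ 2 := by
    simp only [enorm_mul]
    refine hcs.trans ((mul_le_mul_right hab _).trans (le_of_eq ?_))
    rw [mul_pow, ENNReal.ofReal_pow ht]; ring
  have h2 : ∫⁻ x, ‖a x * b x‖ₑ ∂ν ≤ ENNReal.ofReal t * ∫⁻ x, ‖a x‖ₑ ^ 2 ∂ν :=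
    (ENNReal.pow_right_strictMono two_ne_zero).le_iff_le.1 h1
  refine ⟨⟨ha.mul hb, h2.trans_lt (ENNReal.mul_lt_top ENNReal.ofReal_lt_top ha2)⟩, ?_⟩
  rw [integral_sq_eq_toReal ha]
  have h3 := enorm_integral_le_lintegral_enorm (μ := ν) (fun x => a x * b x)
  have h4 := ENNReal.toReal_mono (ENNReal.mul_lt_top ENNReal.ofReal_lt_top ha2).ne (h3.trans h2)
  rwa [ENNReal.toReal_mul, ENNReal.toReal_ofReal ht, toReal_enorm, Real.norm_eq_abs] at h4

/-- The commutator of the weight with the nonlocal part is small. -/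
theorem Gas.Admissible.enorm_mu_mul_nl_sub_le (hG : G.Admissible) {ε : ℝ} (hε : 0 < ε) {w : V3 → ℝ}
    (hw : Measurable w) (h2 : ∫⁻ η, ‖w η‖ₑ ^ 2 < ⊤) (ξ : V3) :
    ‖mu ε ξ * G.nl w ξ - G.nl (fun η => mu ε η * w η) ξ‖ₑ
      ≤ ENNReal.ofReal ε * G.kAbs (fun η => ‖mu ε η * w η‖ₑ) ξ := by
  have hf : Measurable fun η => mu ε η * w η := by fun_prop
  have h2f : ∫⁻ η, ‖mu ε η * w η‖ₑ ^ 2 < ⊤ := by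
    refine lt_of_le_of_lt (lintegral_mono fun η => ?_) h2
    rw [enorm_mul, Real.enorm_of_nonneg (mu_pos ε η).le]
    gcongr
    exact mul_le_of_le_one_left zero_le (ENNReal.ofReal_le_one.2 (mu_le_one ε η))
  rw [Gas.nl, Gas.nl, ← integral_const_mul, ← integral_sub
    ((hG.integrable_nlInt hw h2 ξ).const_mul _) (hG.integrable_nlInt hf h2f ξ)]
  refine (enorm_integral_le_lintegral_enorm _).trans ?_
  rw [Gas.kAbs, ← lintegral_const_mul _ (by fun_prop)]
  refine lintegral_mono fun p => ?_
  have key : ∀ (x y : ℝ) (η : V3), 0 ≤ x → 0 ≤ y →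
      ‖(mu ε ξ - mu ε η) * (x * y * w η)‖ₑ
        ≤ ENNReal.ofReal ε * (ENNReal.ofReal (x * y * wt (η - ξ)) * ‖mu ε η * w η‖ₑ) := by
    intro x y η hx hy
    have hm := (mu_pos ε η).le
    have hwt := (wt_pos (η - ξ)).le
    rw [enorm_mul, enorm_mul, enorm_mul (mu ε η), Real.enorm_of_nonneg (mul_nonneg hx hy),
      Real.enorm_of_nonneg hm, ENNReal.ofReal_mul (mul_nonneg hx hy), ← ofReal_norm,
      Real.norm_eq_abs]
    calc _ ≤ ENNReal.ofReal (ε * mu ε η * wt (η - ξ)) * (ENNReal.ofReal (x * y) * ‖w η‖ₑ) := by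
          gcongr
          exact abs_mu_sub_le hε ξ η
      _ = _ := by
        rw [ENNReal.ofReal_mul (by positivity), ENNReal.ofReal_mul hε.le]; ring
  have e : mu ε ξ * G.nlInt w ξ p - G.nlInt (fun η => mu ε η * w η) ξ p
      = |(inner ℝ (ξ - p.1) (p.2 : V3) : ℝ)| *
        ((mu ε ξ - mu ε (postStar ξ p.1 p.2)) *
            (G.w0 p.1 * G.w0 (post ξ p.1 p.2) * w (postStar ξ p.1 p.2))
          + (mu ε ξ - mu ε (post ξ p.1 p.2)) *
            (G.w0 p.1 * G.w0 (postStar ξ p.1 p.2) * w (post ξ p.1 p.2))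
          - (mu ε ξ - mu ε p.1) * (G.w0 ξ * G.w0 p.1 * w p.1)) := by
    simp only [Gas.nlInt]; ring
  have hw0 := G.w0_nonneg
  rw [e, enorm_mul, Real.enorm_of_nonneg (abs_nonneg _),
    mul_left_comm (ENNReal.ofReal ε)]
  gcongr
  rw [mul_add, mul_add]
  refine enorm_sub_le.trans (add_le_add ((enorm_add_le _ _).trans (add_le_add ?_ ?_)) ?_)
  · exact key _ _ _ (hw0 _) (hw0 _)
  · exact key _ _ _ (hw0 _) (hw0 _)
  · exact key _ _ _ (hw0 _) (hw0 _)

/-- The dissipation estimate for the weighted function at a fixed position. -/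
theorem Gas.Admissible.fiber_estimate (hG : G.Admissible) {β : ℝ} (hβ : 2 < β) :
    ∃ σ₁ : ℝ, 0 < σ₁ ∧ ∀ σ, 0 < σ → σ ≤ σ₁ → ∃ c ε η : ℝ, 0 < c ∧ 0 < ε ∧ ε ≤ 1 ∧ 0 < η ∧
      ∀ h w : V3 → ℝ, Measurable h → Measurable w → ∫⁻ ξ, ‖w ξ‖ₑ ^ 2 < ⊤ →
        (∀ᵐ ξ, ‖h ξ‖ₑ ≤ ENNReal.ofReal η * ENNReal.ofReal (wt ξ ^ (-β))) →
        ∫ ξ, mu ε ξ * w ξ * (mu ε ξ * (σ * ξ 0 * w ξ + G.Lin w ξ + 2 * G.Gam h w ξ))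
          ≤ - (c * ∫ ξ, (mu ε ξ * w ξ) ^ 2) := by
  have hκ : 0 < G.rho * G.sigma := mul_pos hG.rho_pos hG.sigma_pos
  set κ := G.rho * G.sigma with hκd
  obtain ⟨σ₁, hσ₁, hco⟩ := hG.coercive (κ := κ / 4) (by positivity)
  obtain ⟨K, hK, hk⟩ := hG.kAbs_bounds
  obtain ⟨C, hC, hE2⟩ := hG.lintegral_gAbs_sq_le hβ
  refine ⟨σ₁, hσ₁, fun σ hσ hσ1 => ?_⟩
  obtain ⟨c, hc, hcg⟩ := hco σ hσ hσ1
  set k := √K.toReal with hkd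
  set d := G.sigma * √C.toReal with hdd
  have hk0 : 0 ≤ k := Real.sqrt_nonneg _
  have hd0 : 0 ≤ d := mul_nonneg hG.sigma_pos.le (Real.sqrt_nonneg _)
  refine ⟨c / 2, min 1 (c / (4 * κ * k + 1)), c / (8 * d + 1), by positivity, by positivity,
    min_le_left _ _, by positivity, ?_⟩
  set ε := min 1 (c / (4 * κ * k + 1)) with hεd
  set η := c / (8 * d + 1) with hηd
  have hε : 0 < ε := by positivity
  have hη : 0 < η := by positivity
  have hεc : κ * (ε * k) ≤ c / 4 := by
    have h1 : ε ≤ c / (4 * κ * k + 1) := min_le_right _ _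
    rw [le_div_iff₀ (by positivity)] at h1
    nlinarith
  have hηc : 2 * (d * η) ≤ c / 4 := by
    have h1 : η * (8 * d + 1) = c := by rw [hηd]; field_simp
    nlinarith
  intro h w hh hw h2 hhb
  set f : V3 → ℝ := fun ξ => mu ε ξ * w ξ with hf
  have hfm : Measurable f := by fun_prop
  have hwtm := measurable_wt
  have hm0 : Measurable fun x : V3 => x 0 := by fun_prop
  have h2f : ∫⁻ ξ, ENNReal.ofReal (wt ξ) * ‖f ξ‖ₑ ^ 2 < ⊤ := by
    have hb : ∀ ξ, ENNReal.ofReal (wt ξ) * ‖f ξ‖ₑ ^ 2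
        ≤ ENNReal.ofReal (1 + ε⁻¹) * ‖w ξ‖ₑ ^ 2 := fun ξ => by
      have hm := mu_pos ε ξ
      rw [hf, enorm_mul, mul_pow, ← mul_assoc, Real.enorm_of_nonneg hm.le,
        ← ENNReal.ofReal_pow hm.le, ← ENNReal.ofReal_mul (wt_pos ξ).le]
      gcongr
      calc wt ξ * mu ε ξ ^ 2 = wt ξ * mu ε ξ * mu ε ξ := by ring
        _ ≤ (1 + ε⁻¹) * 1 := by
          gcongr
          · exact wt_mul_mu_le hε ξ
          · exact mu_le_one ε ξ
        _ = _ := mul_one _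
    refine (lintegral_mono hb).trans_lt ?_
    rw [lintegral_const_mul _ (by fun_prop)]
    exact ENNReal.mul_lt_top ENNReal.ofReal_lt_top h2
  -- the element of `L²` whose weighted version is `f`
  have hae : ∀ ξ, ‖√(wt ξ) * f ξ‖ₑ ^ 2 = ENNReal.ofReal (wt ξ) * ‖f ξ‖ₑ ^ 2 := fun ξ => by
    rw [enorm_mul, mul_pow, Real.enorm_of_nonneg (Real.sqrt_nonneg _),
      ← ENNReal.ofReal_pow (Real.sqrt_nonneg _), Real.sq_sqrt (wt_pos ξ).le]
  have ham : Measurable fun ξ => √(wt ξ) * f ξ := by fun_prop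
  have hgm : MemLp (fun ξ => √(wt ξ) * f ξ) 2 volume :=
    memLp_two_of_lintegral ham.aestronglyMeasurable (by simp only [hae]; exact h2f)
  set g : VelL2 := hgm.toLp _ with hgd
  have hgc : g =ᵐ[volume] fun ξ => √(wt ξ) * f ξ := hgm.coeFn_toLp
  have hug : unw g =ᵐ[volume] f := by
    filter_upwards [hgc] with ξ hξ
    rw [unw, hξ, inv_mul_cancel_left₀ (Real.sqrt_pos.2 (wt_pos ξ)).ne']
  have hgn : ‖g‖ ^ 2 = ∫ ξ, (√(wt ξ) * f ξ) ^ 2 := by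
    rw [VelL2_norm_sq]
    refine integral_congr_ae ?_
    filter_upwards [hgc] with ξ hξ
    rw [hξ]
  have hsq : ∀ ξ, (√(wt ξ) * f ξ) ^ 2 = wt ξ * f ξ ^ 2 := fun ξ => by
    rw [mul_pow, Real.sq_sqrt (wt_pos ξ).le]
  have hiw : Integrable fun ξ => wt ξ * f ξ ^ 2 := by
    have := hgm.integrable_sq
    simpa only [hsq] using this
  have hif : Integrable fun ξ => f ξ ^ 2 := by
    refine hiw.mono' (by fun_prop) (ae_of_all _ fun ξ => ?_)
    rw [Real.norm_of_nonneg (sq_nonneg _)]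
    exact le_mul_of_one_le_left (sq_nonneg _) (one_le_wt ξ)
  have h2f' : ∫⁻ ξ, ‖f ξ‖ₑ ^ 2 < ⊤ := by
    refine (lintegral_mono fun ξ => ?_).trans_lt h2f
    refine le_mul_of_one_le_left zero_le ?_
    rw [ENNReal.one_le_ofReal]; exact one_le_wt ξ
  have hfn : ∫ ξ, f ξ ^ 2 ≤ ‖g‖ ^ 2 := by
    rw [hgn]; simp only [hsq]
    exact integral_mono hif hiw fun ξ => le_mul_of_one_le_left (sq_nonneg _) (one_le_wt ξ)
  -- the transport term
  have e1 : flux g = ∫ ξ : V3, ξ 0 * f ξ ^ 2 := by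
    refine integral_congr_ae ?_
    filter_upwards [hgc] with ξ hξ
    rw [hξ, hsq]
    have := (wt_pos ξ).ne'
    field_simp
  have i1 : Integrable fun ξ : V3 => ξ 0 * f ξ ^ 2 := by
    refine hiw.mono' (by fun_prop) (ae_of_all _ fun ξ => ?_)
    rw [norm_mul, Real.norm_of_nonneg (sq_nonneg (f ξ)), Real.norm_eq_abs]
    exact mul_le_mul_of_nonneg_right (abs_coord_le_wt ξ 0) (sq_nonneg _)
  -- the nonlocal part
  have e2 : hG.nlForm g = ∫ ξ, f ξ * G.nl f ξ := by
    rw [hG.nlForm_eq]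
    refine integral_congr_ae ?_
    filter_upwards [hug] with ξ hξ
    rw [hξ, hG.nl_congr (measurable_unw g) hfm h2f' hug]
  have hnlm := G.measurable_nl hfm
  have hnlw := G.measurable_nl hw
  have i2 := (abs_integral_mul_le_of_lintegral (ν := volume) hfm.aestronglyMeasurable
    hnlm.aestronglyMeasurable hk0 h2f' (by
      rw [hkd, Real.sq_sqrt ENNReal.toReal_nonneg, ENNReal.ofReal_toReal hK.ne]
      exact (lintegral_mono fun ξ => pow_le_pow_left' (G.enorm_nl_le ξ) 2).trans
        (hk _ (by fun_prop)).2)).1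
  -- the collision frequency
  obtain ⟨c₀, C₀, hc₀, hC₀, hfr⟩ := hG.freq_bounds
  have hfreqm : Measurable G.freq :=
    (StronglyMeasurable.integral_prod_right' (f := fun z : V3 × V3 × Metric.sphere (0 : V3) 1 =>
      |(inner ℝ (z.1 - z.2.1) (z.2.2 : V3) : ℝ)| * G.w0 z.2.1 ^ 2)
      (by fun_prop : Measurable _).stronglyMeasurable).measurable
  have i3 : Integrable fun ξ => G.freq ξ * f ξ ^ 2 := by
    refine (hiw.const_mul C₀).mono' (by fun_prop) (ae_of_all _ fun ξ => ?_)
    rw [Real.norm_of_nonneg (mul_nonneg (hG.freq_nonneg ξ) (sq_nonneg _)), ← mul_assoc]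
    exact mul_le_mul_of_nonneg_right (hfr ξ).2.2 (sq_nonneg _)
  have e3 : ‖hG.ampL g‖ ^ 2 = ∫ ξ, G.freq ξ * f ξ ^ 2 := by
    rw [← ENNReal.ofReal_eq_ofReal_iff (sq_nonneg _) (integral_nonneg fun ξ =>
      mul_nonneg (hG.freq_nonneg ξ) (sq_nonneg _)), hG.ampL_norm_sq,
      hG.lintegral_amp_sq (measurable_unw g), ofReal_integral_eq_lintegral_ofReal i3
      (ae_of_all _ fun ξ => mul_nonneg (hG.freq_nonneg ξ) (sq_nonneg _))]
    refine lintegral_congr_ae ?_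
    filter_upwards [hug] with ξ hξ
    rw [hξ, ENNReal.ofReal_mul (hG.freq_nonneg ξ), ← sq_abs (f ξ),
      ENNReal.ofReal_pow (abs_nonneg _), ← Real.norm_eq_abs, ofReal_norm]
  -- the commutator
  obtain ⟨i4, b4⟩ := abs_integral_mul_le_of_lintegral (ν := volume) (a := f)
    (b := fun ξ => mu ε ξ * G.nl w ξ - G.nl f ξ) (t := ε * k) hfm.aestronglyMeasurable
    (by fun_prop) (by positivity) h2f' (by
      rw [mul_pow, hkd, Real.sq_sqrt ENNReal.toReal_nonneg, ENNReal.ofReal_mul (sq_nonneg _),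
        ENNReal.ofReal_toReal hK.ne, ENNReal.ofReal_pow hε.le, mul_assoc]
      refine (lintegral_mono fun ξ => pow_le_pow_left' (hG.enorm_mu_mul_nl_sub_le hε hw h2 ξ) 2).trans ?_
      simp only [mul_pow]
      rw [lintegral_const_mul _ (by have := G.measurable_kAbs (F := fun η => ‖mu ε η * w η‖ₑ)
                                      (by fun_prop)
                                    fun_prop)]
      gcongr
      exact (hk _ (by fun_prop)).2)
  -- the perturbation
  have hGm := measurable_gam hG hh hw
  obtain ⟨i5, b5⟩ := abs_integral_mul_le_of_lintegral (ν := volume) (a := fun ξ => √(wt ξ) * f ξ)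
    (b := fun ξ => mu ε ξ * (√(wt ξ))⁻¹ * G.Gam h w ξ) (t := d * η) ham.aestronglyMeasurable
    (by fun_prop) (by positivity) (by simp only [hae]; exact h2f) (by
      have h3 := hE2 _ (slowWeight_mu_sq hε (min_le_left _ _)) (ENNReal.ofReal η) h w hh hw hhb
      have h4 : ∀ ξ, ‖mu ε ξ * (√(wt ξ))⁻¹ * G.Gam h w ξ‖ₑ ^ 2 ≤ ENNReal.ofReal (G.sigma ^ 2) *
          (ENNReal.ofReal (mu ε ξ ^ 2 / wt ξ) * G.gAbs h w ξ ^ 2) := fun ξ => by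
        have hwp := wt_pos ξ
        have hm := mu_pos ε ξ
        rw [enorm_mul, mul_pow, Real.enorm_of_nonneg (by positivity),
          ← ENNReal.ofReal_pow (by positivity), mul_pow, inv_pow, Real.sq_sqrt hwp.le,
          ← div_eq_mul_inv, mul_left_comm, ENNReal.ofReal_pow hG.sigma_pos.le, ← mul_pow]
        gcongr
        exact hG.enorm_gam_le h w ξ
      have hgm : Measurable (G.gAbs h w) := (measurable_gAbs_param (X := Unit) (h := fun z => h z.2)
        (k := fun z => w z.2) (by fun_prop) (by fun_prop)).comp
        (g := fun z : Unit × V3 => G.gAbs h w z.2) (f := fun ξ : V3 => ((), ξ)) (by fun_prop)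
      refine (lintegral_mono h4).trans ?_
      rw [lintegral_const_mul _ (by fun_prop)]
      refine (mul_le_mul_right h3 _).trans (le_of_eq ?_)
      have h5 : ∫⁻ ξ, ENNReal.ofReal (wt ξ * mu ε ξ ^ 2) * ‖w ξ‖ₑ ^ 2
          = ∫⁻ ξ, ‖√(wt ξ) * f ξ‖ₑ ^ 2 := by
        refine lintegral_congr fun ξ => ?_
        have hm := mu_pos ε ξ
        rw [hae, hf, enorm_mul, mul_pow, Real.enorm_of_nonneg hm.le, ← ENNReal.ofReal_pow hm.le,
          ← mul_assoc, ← ENNReal.ofReal_mul (wt_pos ξ).le]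
      rw [h5, hdd, mul_pow, mul_pow, Real.sq_sqrt ENNReal.toReal_nonneg,
        ENNReal.ofReal_mul (by positivity), ENNReal.ofReal_mul (by positivity),
        ENNReal.ofReal_toReal hC.ne, ENNReal.ofReal_pow hη.le]
      ring)
  have eI : ∫ ξ, mu ε ξ * w ξ * (mu ε ξ * (σ * ξ 0 * w ξ + G.Lin w ξ + 2 * G.Gam h w ξ))
      = σ * (∫ ξ : V3, ξ 0 * f ξ ^ 2) + κ * ((∫ ξ, f ξ * G.nl f ξ) - (∫ ξ, G.freq ξ * f ξ ^ 2)
        + ∫ ξ, f ξ * (mu ε ξ * G.nl w ξ - G.nl f ξ))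
        + 2 * ∫ ξ, √(wt ξ) * f ξ * (mu ε ξ * (√(wt ξ))⁻¹ * G.Gam h w ξ) := by
    have j1 : Integrable fun ξ => f ξ * G.nl f ξ - G.freq ξ * f ξ ^ 2 := i2.sub i3
    have j2 : Integrable fun ξ => f ξ * G.nl f ξ - G.freq ξ * f ξ ^ 2
        + f ξ * (mu ε ξ * G.nl w ξ - G.nl f ξ) := j1.add i4
    have j3 : Integrable fun ξ : V3 => σ * (ξ 0 * f ξ ^ 2) + κ * (f ξ * G.nl f ξ
        - G.freq ξ * f ξ ^ 2 + f ξ * (mu ε ξ * G.nl w ξ - G.nl f ξ)) :=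
      (i1.const_mul σ).add (j2.const_mul κ)
    rw [← integral_sub i2 i3, ← integral_add j1 i4, ← integral_const_mul,
      ← integral_const_mul, ← integral_const_mul,
      ← integral_add (i1.const_mul σ) (j2.const_mul κ), ← integral_add j3 (i5.const_mul 2)]
    refine integral_congr_ae (ae_of_all _ fun ξ => ?_)
    have hs := (Real.sqrt_pos.2 (wt_pos ξ)).ne'
    have e6 : √(wt ξ) * f ξ * (mu ε ξ * (√(wt ξ))⁻¹ * G.Gam h w ξ)
        = f ξ * (mu ε ξ * G.Gam h w ξ) := by field_simp
    simp only
    rw [e6, hG.lin_eq hw h2, ← hκd]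
    simp only [hf]; ring
  rw [eI, ← e1, ← e2, ← e3]
  have hd := hG.norm_diss_sq g
  have hcg' := hcg g
  rw [hd] at hcg'
  rw [← hgn] at b5
  have b4' := (abs_le.1 b4).2
  have b5' := (abs_le.1 b5).2
  have h7 := mul_le_mul_of_nonneg_left b4' hκ.le
  have hf0 : 0 ≤ ∫ ξ, f ξ ^ 2 := integral_nonneg fun ξ => sq_nonneg _
  have h8 := mul_le_mul_of_nonneg_right hεc hf0
  have h9 := mul_le_mul_of_nonneg_right hηc (sq_nonneg ‖g‖)
  have h10 := mul_le_mul_of_nonneg_left hfn hc.le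
  nlinarith

variable {G : Gas}

/-! ### Collision terms on the phase space -/

theorem phase_eq_prod : phase = (volume.restrict {x : V3 | 0 < x 0}).prod volume := by
  have e : {p : V3 × V3 | 0 < p.1 0} = {x : V3 | 0 < x 0} ×ˢ Set.univ := by ext p; simp
  rw [phase, Measure.volume_eq_prod, e, ← Measure.prod_restrict, Measure.restrict_univ]

/-- The bound `|h| ≤ A ⟨ξ⟩^{-β}` almost everywhere, for a measurable function. -/
structure VelBound (β : ℝ) (A : ℝ≥0∞) (h : V3 × V3 → ℝ) : Prop where
  meas : Measurable h
  le : ∀ᵐ z ∂phase, ‖h z‖ₑ ≤ A * ENNReal.ofReal (wt z.2 ^ (-β))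

/-- `Γ(h, k)` at each position. -/
def Gas.gamX (G : Gas) (h k : V3 × V3 → ℝ) (z : V3 × V3) : ℝ :=
  G.Gam (fun v => h (z.1, v)) (fun v => k (z.1, v)) z.2

/-- `gAbs` at each position. -/
def Gas.gAbsX (G : Gas) (h k : V3 × V3 → ℝ) (z : V3 × V3) : ℝ≥0∞ :=
  G.gAbs (fun v => h (z.1, v)) (fun v => k (z.1, v)) z.2

theorem Gas.gAbs_comm (h k : V3 → ℝ) (ξ : V3) : G.gAbs h k ξ = G.gAbs k h ξ := by
  unfold Gas.gAbs
  refine lintegral_congr fun p => ?_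
  ring

theorem ae_slice {q : V3 × V3 → Prop} (h : ∀ᵐ z ∂phase, q z) :
    ∀ᵐ x ∂(volume.restrict {x : V3 | 0 < x 0}), ∀ᵐ ξ, q (x, ξ) := by
  rw [phase_eq_prod] at h
  exact Measure.ae_ae_of_ae_prod h

theorem lintegral_phase {F : V3 × V3 → ℝ≥0∞} (hF : Measurable F) :
    ∫⁻ z, F z ∂phase = ∫⁻ x in {x : V3 | 0 < x 0}, ∫⁻ ξ, F (x, ξ) := by
  rw [phase_eq_prod, lintegral_prod _ hF.aemeasurable]

theorem Gas.Admissible.lintegral_gAbsX_le (hG : G.Admissible) {β : ℝ} (hβ : 2 < β) :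
    ∃ C : ℝ≥0∞, C < ⊤ ∧ ∀ (A : ℝ≥0∞) (h k : V3 × V3 → ℝ), VelBound β A h → Measurable k →
      ∫⁻ z, (ENNReal.ofReal (wt z.2)⁻¹ * G.gAbsX h k z) ^ 2 ∂phase
        ≤ C * A ^ 2 * ∫⁻ z, ‖k z‖ₑ ^ 2 ∂phase := by
  obtain ⟨C, hC, hE⟩ := hG.lintegral_gAbs_sq_le hβ
  refine ⟨C, hC, fun A h k hh hk => ?_⟩
  have hm := hh.meas
  have hwt := measurable_wt
  have hgm : Measurable (G.gAbsX h k) := measurable_gAbs_param hm hk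
  rw [lintegral_phase (by fun_prop), lintegral_phase (by fun_prop), ← lintegral_const_mul]
  · refine lintegral_mono_ae ?_
    filter_upwards [ae_slice hh.le] with x hx
    refine le_trans (le_of_eq ?_) ((hE _ slowWeight_wt_inv A (fun v => h (x, v)) (fun v => k (x, v))
      (by fun_prop) (by fun_prop) hx).trans (le_of_eq ?_))
    · refine lintegral_congr fun ξ => ?_
      have := wt_pos ξ
      rw [mul_pow, ← ENNReal.ofReal_pow (by positivity)]
      congr 2; rw [sq]; rfl
    · congr 1
      refine lintegral_congr fun ξ => ?_
      rw [mul_inv_cancel₀ (wt_pos ξ).ne', ENNReal.ofReal_one, one_mul]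
  · exact Measurable.lintegral_prod_right' (f := fun z : V3 × V3 => ‖k z‖ₑ ^ 2) (by fun_prop)

theorem Gas.Admissible.gAbsX_lt_top (hG : G.Admissible) {β : ℝ} (hβ : 2 < β) {A : ℝ≥0∞}
    (hA : A < ⊤) {h k : V3 × V3 → ℝ} (hh : VelBound β A h) (hk : Measurable k)
    (h2 : MemLp k 2 phase) : ∀ᵐ z ∂phase, G.gAbsX h k z < ⊤ := by
  obtain ⟨C, hC, hE⟩ := hG.lintegral_gAbsX_le hβ
  have hwt := measurable_wt
  have hgm : Measurable (G.gAbsX h k) := measurable_gAbs_param hh.meas hk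
  have := (hE A h k hh hk).trans_lt (ENNReal.mul_lt_top (ENNReal.mul_lt_top hC
    (ENNReal.pow_lt_top hA)) (lintegral_lt_top_of_memLp_two h2))
  filter_upwards [ae_lt_top (by fun_prop) this.ne] with z hz
  by_contra hc
  rw [not_lt, top_le_iff] at hc
  have h3 : ENNReal.ofReal (wt z.2)⁻¹ ≠ 0 := by
    rw [Ne, ENNReal.ofReal_eq_zero, not_le]; exact inv_pos.2 (wt_pos _)
  rw [hc, ENNReal.mul_top h3] at hz
  simp at hz

theorem eLpNorm_two_sq {α : Type*} [MeasurableSpace α] {ν : Measure α} (g : α → ℝ) :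
    eLpNorm g 2 ν ^ 2 = ∫⁻ z, ‖g z‖ₑ ^ 2 ∂ν := by
  rw [eLpNorm_eq_lintegral_rpow_enorm_toReal (by norm_num) (by norm_num), ← ENNReal.rpow_two,
    ← ENNReal.rpow_mul]
  norm_num

theorem eLpNorm_two_le_of_lintegral {α : Type*} [MeasurableSpace α] {ν : Measure α} {f k : α → ℝ}
    {C : ℝ≥0∞} (h : ∫⁻ z, ‖f z‖ₑ ^ 2 ∂ν ≤ C ^ 2 * ∫⁻ z, ‖k z‖ₑ ^ 2 ∂ν) :
    eLpNorm f 2 ν ≤ C * eLpNorm k 2 ν := by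
  rw [← (ENNReal.pow_right_strictMono two_ne_zero).le_iff_le, mul_pow, eLpNorm_two_sq,
    eLpNorm_two_sq]
  exact h

theorem Gas.Admissible.eLpNorm_gamX_le (hG : G.Admissible) {β : ℝ} (hβ : 2 < β) :
    ∃ C : ℝ≥0∞, C < ⊤ ∧ ∀ (A : ℝ≥0∞) (h k : V3 × V3 → ℝ), VelBound β A h → Measurable k →
      eLpNorm (fun z => (wt z.2)⁻¹ * G.gamX h k z) 2 phase ≤ C * A * eLpNorm k 2 phase := by
  obtain ⟨C, hC, hE⟩ := hG.lintegral_gAbsX_le hβ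
  refine ⟨ENNReal.ofReal G.sigma * (C + 1), ENNReal.mul_lt_top ENNReal.ofReal_lt_top (by simp [hC]),
    fun A h k hh hk => eLpNorm_two_le_of_lintegral ?_⟩
  have hwt := measurable_wt
  have hgm : Measurable (G.gAbsX h k) := measurable_gAbs_param hh.meas hk
  have h1 : ∀ z : V3 × V3, ‖(wt z.2)⁻¹ * G.gamX h k z‖ₑ ^ 2 ≤
      ENNReal.ofReal G.sigma ^ 2 * (ENNReal.ofReal (wt z.2)⁻¹ * G.gAbsX h k z) ^ 2 := fun z => by
    rw [← mul_pow, enorm_mul, Real.enorm_of_nonneg (inv_nonneg.2 (wt_pos _).le), mul_left_comm]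
    gcongr
    exact hG.enorm_gam_le _ _ _
  refine (lintegral_mono h1).trans ?_
  rw [lintegral_const_mul _ (by fun_prop), mul_pow, mul_pow, mul_assoc, mul_assoc]
  gcongr
  refine (hE A h k hh hk).trans ?_
  rw [mul_assoc]
  gcongr
  calc C ≤ C + 1 := le_self_add
    _ ≤ (C + 1) ^ 2 := by rw [sq]; exact le_mul_of_one_le_left zero_le le_add_self

theorem Gas.Admissible.measurable_gamX (hG : G.Admissible) {h k : V3 × V3 → ℝ} (hh : Measurable h)
    (hk : Measurable k) : Measurable (G.gamX h k) := measurable_gam_param hG hh hk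

theorem Gas.Admissible.gamX_comm (hG : G.Admissible) (h k : V3 × V3 → ℝ) :
    G.gamX h k = G.gamX k h := funext fun _ => hG.gam_comm _ _ _

theorem Gas.Admissible.gamX_add_right (hG : G.Admissible) {h k k' : V3 × V3 → ℝ} (hh : Measurable h)
    (hk : Measurable k) (hk' : Measurable k') {z : V3 × V3} (h1 : G.gAbsX h k z < ⊤)
    (h2 : G.gAbsX h k' z < ⊤) : G.gamX h (k + k') z = G.gamX h k z + G.gamX h k' z :=
  hG.gam_add_right (h := fun v => h (z.1, v)) (k := fun v => k (z.1, v))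
    (k' := fun v => k' (z.1, v)) (by fun_prop) (by fun_prop) (by fun_prop) h1 h2

/-- The linearized operator is `2 Γ(ρ W₀, ·)`. -/
theorem Gas.Admissible.lin_eq_gam (hG : G.Admissible) (f : V3 → ℝ) (ξ : V3) :
    G.Lin f ξ = 2 * G.Gam (fun v => G.rho * G.w0 v) f ξ := by
  have e : G.minf = fun v => G.w0 v * (G.rho * G.w0 v) := by
    ext v; rw [hG.minf_eq]; ring
  rw [two_mul]
  nth_rewrite 2 [hG.gam_comm]
  rw [Gas.Lin, Gas.Gam, Gas.Gam, e, mul_add]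

theorem VelBound.mono {β : ℝ} {A A' : ℝ≥0∞} {h : V3 × V3 → ℝ} (hh : VelBound β A h) (hA : A ≤ A') :
    VelBound β A' h :=
  ⟨hh.meas, hh.le.mono fun _ hz => hz.trans (by gcongr)⟩

/-- Pointwise bounds from bounds of the weighted supremum norm. -/
theorem ae_le_of_velSup_le {X : Type*} [MeasurableSpace X] {ν : Measure (X × V3)} {β : ℝ}
    {A : ℝ≥0∞} {h : X × V3 → ℝ} (hA : velSup ν β h ≤ A) :
    ∀ᵐ z ∂ν, ‖h z‖ₑ ≤ A * ENNReal.ofReal (wt z.2 ^ (-β)) := by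
  have := ae_le_eLpNormEssSup (f := fun p : X × V3 => (wt p.2 ^ β) • h p) (μ := ν)
  filter_upwards [this] with z hz
  have hw := wt_pos z.2
  have e : ‖h z‖ₑ = ‖(wt z.2 ^ β) • h z‖ₑ * ENNReal.ofReal (wt z.2 ^ (-β)) := by
    rw [enorm_smul, Real.enorm_of_nonneg (Real.rpow_nonneg hw.le β), mul_right_comm,
      ← ENNReal.ofReal_mul (by positivity), ← Real.rpow_add hw, add_neg_cancel, Real.rpow_zero,
      ENNReal.ofReal_one, one_mul]
  rw [velSup, eLpNorm_exponent_top] at hA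
  rw [e]
  gcongr
  exact hz.trans hA

theorem Gas.Admissible.velBound_rho_w0 (hG : G.Admissible) (β : ℝ) :
    ∃ A : ℝ≥0∞, A < ⊤ ∧ VelBound β A fun z => G.rho * G.w0 z.2 := by
  obtain ⟨C, hC, h⟩ := hG.w0_decay ⌈β⌉₊
  refine ⟨ENNReal.ofReal (G.rho * C), ENNReal.ofReal_lt_top, by fun_prop, ae_of_all _ fun z => ?_⟩
  have hw := wt_pos z.2
  have hr := hG.rho_pos
  have h0 := G.w0_nonneg z.2
  rw [← ENNReal.ofReal_mul (by positivity), Real.enorm_of_nonneg (by positivity)]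
  refine ENNReal.ofReal_le_ofReal ?_
  rw [mul_assoc]
  gcongr
  rw [Real.rpow_neg hw.le, ← div_eq_mul_inv, le_div_iff₀ (by positivity)]
  refine le_trans ?_ (h z.2)
  gcongr
  rw [← Real.rpow_natCast]
  exact Real.rpow_le_rpow_of_exponent_le (one_le_wt _) (Nat.le_ceil β)

/-! ### Continuity in time of the collision terms -/

theorem ContinuousInL2.add {α : Type*} [MeasurableSpace α] {ν : Measure α} {F K : ℝ → α → ℝ}
    (hF : ContinuousInL2 ν F) (hK : ContinuousInL2 ν K) :
    ContinuousInL2 ν fun t z => F t z + K t z := by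
  refine ⟨fun t => (hF.1 t).add (hK.1 t), fun t₀ => ?_⟩
  have h := (hF.2 t₀).add (hK.2 t₀)
  rw [add_zero] at h
  refine tendsto_of_tendsto_of_tendsto_of_le_of_le tendsto_const_nhds h (fun _ => zero_le) fun t => ?_
  have e : (fun p => F t p + K t p - (F t₀ p + K t₀ p))
      = (fun p => F t p - F t₀ p) + fun p => K t p - K t₀ p := by ext p; simp only [Pi.add_apply]; ring
  simp only [e]
  exact eLpNorm_add_le ((hF.1 t).sub (hF.1 t₀)).1 ((hK.1 t).sub (hK.1 t₀)).1 (by norm_num)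

theorem ContinuousInL2.mul_bdd {α : Type*} [MeasurableSpace α] {ν : Measure α} {F : ℝ → α → ℝ}
    (hF : ContinuousInL2 ν F) {m : α → ℝ} (hm : Measurable m) {c : ℝ} (hc : ∀ᵐ z ∂ν, |m z| ≤ c) :
    ContinuousInL2 ν fun t z => m z * F t z := by
  have key : ∀ f : α → ℝ, eLpNorm (fun z => m z * f z) 2 ν ≤ ENNReal.ofReal c * eLpNorm f 2 ν :=
    fun f => by
      refine eLpNorm_le_mul_eLpNorm_of_ae_le_mul (hc.mono fun z hz => ?_) 2
      rw [norm_mul]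
      exact mul_le_mul_of_nonneg_right hz (norm_nonneg _)
  refine ⟨fun t => ⟨hm.aestronglyMeasurable.mul (hF.1 t).1, (key _).trans_lt
    (ENNReal.mul_lt_top ENNReal.ofReal_lt_top (hF.1 t).2)⟩, fun t₀ => ?_⟩
  have h := ENNReal.Tendsto.const_mul (a := ENNReal.ofReal c) (hF.2 t₀) (Or.inr ENNReal.ofReal_ne_top)
  rw [mul_zero] at h
  refine tendsto_of_tendsto_of_tendsto_of_le_of_le tendsto_const_nhds h (fun _ => zero_le) fun t => ?_
  refine le_trans (le_of_eq ?_) (key _)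
  congr 1; ext z; ring

theorem ContinuousInL2.of_Lp {g : ℝ → Lp ℝ 2 phase} (hg : Continuous g) :
    ContinuousInL2 phase fun t => (g t : V3 × V3 → ℝ) := by
  refine ⟨fun t => Lp.memLp _, fun t₀ => ?_⟩
  have h := (tendsto_iff_edist_tendsto_0.1 (hg.tendsto t₀))
  refine h.congr fun t => ?_
  rw [Lp.edist_def]; rfl

/-- Continuity in time of the bilinear collision term. -/
theorem Gas.Admissible.continuousInL2_gamX (hG : G.Admissible) {β : ℝ} (hβ : 2 < β) {A : ℝ≥0∞}
    (hA : A < ⊤) {h k : ℝ → V3 × V3 → ℝ} (hh : ∀ t, VelBound β A (h t))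
    (hk : ∀ t, VelBound β A (k t)) (hk2 : ContinuousInL2 phase k)
    (hh2 : ContinuousInL2 phase fun t z => h t z - h 0 z) :
    ContinuousInL2 phase fun t z => (wt z.2)⁻¹ * G.gamX (h t) (k t) z := by
  obtain ⟨C, hC, hE⟩ := hG.eLpNorm_gamX_le hβ
  have hCA : C * A ≠ ⊤ := (ENNReal.mul_lt_top hC hA).ne
  have hwt := measurable_wt
  have hm : ∀ t s, Measurable fun z : V3 × V3 => (wt z.2)⁻¹ * G.gamX (h t) (k s) z := fun t s => by
    have := hG.measurable_gamX (hh t).meas (hk s).meas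
    fun_prop
  refine ⟨fun t => ⟨(hm t t).aestronglyMeasurable, (hE A _ _ (hh t) (hk t).meas).trans_lt
    (ENNReal.mul_lt_top hCA.lt_top (hk2.1 t).2)⟩, fun t₀ => ?_⟩
  have h1 := ENNReal.Tendsto.const_mul (a := C * A) (hk2.2 t₀) (Or.inr hCA)
  have h2 := ENNReal.Tendsto.const_mul (a := C * A) (hh2.2 t₀) (Or.inr hCA)
  have h3 := h1.add h2
  simp only [mul_zero, add_zero] at h3
  refine tendsto_of_tendsto_of_tendsto_of_le_of_le tendsto_const_nhds h3 (fun _ => zero_le) fun t => ?_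
  have mk : ∀ t, Measurable (k t) := fun t => (hk t).meas
  have mh : ∀ t, Measurable (h t) := fun t => (hh t).meas
  have mdk : Measurable fun z => k t z - k t₀ z := (mk t).sub (mk t₀)
  have mdh : Measurable fun z => h t z - h 0 z - (h t₀ z - h 0 z) :=
    ((mh t).sub (mh 0)).sub ((mh t₀).sub (mh 0))
  have hae : (fun z : V3 × V3 => (wt z.2)⁻¹ * G.gamX (h t) (k t) z
      - (wt z.2)⁻¹ * G.gamX (h t₀) (k t₀) z) =ᵐ[phase]
      (fun z => (wt z.2)⁻¹ * G.gamX (h t) (fun z => k t z - k t₀ z) z)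
      + fun z => (wt z.2)⁻¹ * G.gamX (k t₀) (fun z => h t z - h 0 z - (h t₀ z - h 0 z)) z := by
    filter_upwards [hG.gAbsX_lt_top hβ hA (hh t) (mk t₀) (hk2.1 t₀),
      hG.gAbsX_lt_top hβ hA (hh t) mdk ((hk2.1 t).sub (hk2.1 t₀)),
      hG.gAbsX_lt_top hβ hA (hh t₀) (mk t₀) (hk2.1 t₀),
      hG.gAbsX_lt_top hβ hA (hk t₀) mdh ((hh2.1 t).sub (hh2.1 t₀))] with z z1 z2 z3 z4
    have z3' : G.gAbsX (k t₀) (h t₀) z < ⊤ := by rw [Gas.gAbsX, G.gAbs_comm]; exact z3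
    have e1 := hG.gamX_add_right (mh t) (mk t₀) mdk z1 z2
    have e2 := hG.gamX_add_right (mk t₀) (mh t₀) mdh z3' z4
    have f1 : k t₀ + (fun z => k t z - k t₀ z) = k t := by ext; simp
    have f2 : h t₀ + (fun z => h t z - h 0 z - (h t₀ z - h 0 z)) = h t := by ext; simp
    rw [f1] at e1
    rw [f2, hG.gamX_comm (k t₀) (h t), hG.gamX_comm (k t₀) (h t₀)] at e2
    simp only [Pi.add_apply]
    rw [e1, e2]; ring
  rw [eLpNorm_congr_ae hae]
  refine (eLpNorm_add_le ?_ ?_ (by norm_num)).trans (add_le_add (hE A _ _ (hh t) mdk)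
    (hE A _ _ (hk t₀) mdh))
  · have := hG.measurable_gamX (mh t) mdk
    exact (by fun_prop : Measurable _).aestronglyMeasurable
  · have := hG.measurable_gamX (mk t₀) mdh
    exact (by fun_prop : Measurable _).aestronglyMeasurable

variable {G : Gas}

/-! ### The background -/

theorem measurePreserving_normal_tang :
    MeasurePreserving (fun x : V3 => ((x 0, tang x) : ℝ × V2)) volume volume := by
  have h1 := measurePreserving_coords
  have h2 := (volume_preserving_finTwoArrow ℝ).symm
  have h3 := PiLp.volume_preserving_toLp (Fin 2)
  have := ((MeasurePreserving.id (volume : Measure ℝ)).prod (h3.comp h2)).comp h1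
  exact this

@[fun_prop] theorem measurable_tang : Measurable tang :=
  measurable_snd.comp measurePreserving_normal_tang.measurable

/-- The splitting of the phase space into the normal variable and the boundary phase space. -/
theorem measurePreserving_split :
    MeasurePreserving (fun z : V3 × V3 => ((z.1 0, tang z.1, z.2) : ℝ × V2 × V3)) volume volume := by
  have h1 := measurePreserving_normal_tang.prod (MeasurePreserving.id (volume : Measure V3))
  have h2 := measurePreserving_prodAssoc (volume : Measure ℝ) (volume : Measure V2)
    (volume : Measure V3)
  exact h2.comp h1

theorem ae_phase_of_ae {q : V3 × V3 → Prop} (h : ∀ᵐ z, 0 < z.1 0 → q z) : ∀ᵐ z ∂phase, q z := by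
  have hm0 : Measurable fun x : V3 => x 0 := by fun_prop
  have hms : MeasurableSet {p : V3 × V3 | 0 < p.1 0} :=
    measurableSet_lt measurable_const (by fun_prop)
  rw [phase, ae_restrict_iff' hms]
  exact h

theorem ae_phase_of_ae_slab {q : ℝ × V3 → Prop} (h : ∀ᵐ p ∂slab, q p) :
    ∀ᵐ z ∂phase, q (z.1 0, z.2) := by
  rw [slab, ae_restrict_iff' (measurableSet_lt measurable_const measurable_fst)] at h
  have h2 : Measure.QuasiMeasurePreserving (fun p : ℝ × V2 × V3 => (p.1, p.2.2)) volume volume :=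
    QuasiMeasurePreserving.prodMap (Measure.QuasiMeasurePreserving.id (volume : Measure ℝ))
      (Measure.quasiMeasurePreserving_snd (μ := (volume : Measure V2)) (ν := (volume : Measure V3)))
  exact ae_phase_of_ae ((h2.comp measurePreserving_split.quasiMeasurePreserving).ae h)

theorem ae_phase_of_ae_tang {q : V2 × V3 → Prop} (h : ∀ᵐ p, q p) :
    ∀ᵐ z ∂phase, q (tang z.1, z.2) := by
  have h2 : Measure.QuasiMeasurePreserving (fun p : ℝ × V2 × V3 => p.2) volume volume :=
    Measure.quasiMeasurePreserving_snd
  exact ae_phase_of_ae (((h2.comp measurePreserving_split.quasiMeasurePreserving).ae h).mono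
    fun z hz _ => hz)

theorem measurePreserving_characteristic (s : ℝ) :
    MeasurePreserving (fun p : V2 × V3 => (p.1 - (s / p.2 0) • tang p.2, p.2)) volume volume := by
  have hm0 : Measurable fun x : V3 => x 0 := by fun_prop
  have h1 : MeasurePreserving (fun p : V3 × V2 => (p.1, p.2 - (s / p.1 0) • tang p.1))
      ((volume : Measure V3).prod (volume : Measure V2)) (volume.prod volume) := by
    refine MeasurePreserving.skew_product (f := id) (g := fun (ξ : V3) (y : V2) =>
      y - (s / ξ 0) • tang ξ) (MeasurePreserving.id _) (by fun_prop) (ae_of_all _ fun ξ => ?_)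
    exact (measurePreserving_sub_right volume _).map_eq
  exact (Measure.measurePreserving_swap.comp h1).comp Measure.measurePreserving_swap

theorem ae_phase_of_ae_characteristic {q : V2 × V3 → Prop} (h : ∀ᵐ p, q p) :
    ∀ᵐ z ∂phase, q (tang z.1 - (z.1 0 / z.2 0) • tang z.2, z.2) := by
  have hm0 : Measurable fun x : V3 => x 0 := by fun_prop
  have h1 : MeasurePreserving (fun p : ℝ × V2 × V3 =>
      (p.1, p.2.1 - (p.1 / p.2.2 0) • tang p.2.2, p.2.2))
      ((volume : Measure ℝ).prod (volume : Measure (V2 × V3))) (volume.prod volume) := by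
    refine MeasurePreserving.skew_product (f := id) (g := fun (s : ℝ) (p : V2 × V3) =>
      (p.1 - (s / p.2 0) • tang p.2, p.2)) (MeasurePreserving.id _) (by fun_prop)
      (ae_of_all _ fun s => (measurePreserving_characteristic s).map_eq)
  have h2 : Measure.QuasiMeasurePreserving (fun p : ℝ × V2 × V3 => p.2) volume volume :=
    Measure.quasiMeasurePreserving_snd
  exact ae_phase_of_ae (((h2.comp (h1.quasiMeasurePreserving.comp
    measurePreserving_split.quasiMeasurePreserving)).ae h).mono fun z hz _ => hz)

theorem Frame.Admissible.exists_cut_le {S : Frame} (hS : S.Admissible) :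
    ∃ C : ℝ, 0 < C ∧ ∀ s, 0 ≤ s → |S.cut s| ≤ C := by
  obtain ⟨C, hC⟩ := (isCompact_Icc (a := (0 : ℝ)) (b := 2)).exists_bound_of_continuousOn
    hS.cut_smooth.continuous.continuousOn
  refine ⟨max C 1, by positivity, fun s hs => ?_⟩
  by_cases h : s ≤ 2
  · exact (hC s ⟨hs, h⟩).trans (le_max_left _ _)
  · rw [hS.cut_zero s (by linarith), abs_zero]; positivity

theorem Profile.Admissible.dtil_nonneg {P : Profile} {S : Frame} {γ₀ M₀ : ℝ}
    (hP : P.Admissible S γ₀ M₀) : 0 ≤ P.dtil := by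
  have h := (abs_nonneg _).trans (hP.a0_bound 0)
  have hw : 0 < wt (0 : V3) ^ (-S.beta) := Real.rpow_pos_of_pos (wt_pos _) _
  exact nonneg_of_mul_nonneg_left h hw

theorem PeriodicAdmissible.velSup_le {β T : ℝ} {f dt : ℝ → V2 × V3 → ℝ} {grad : ℝ → V2 × V3 → V2}
    (h : PeriodicAdmissible β T f dt grad) (hT : 0 < T) {A : ℝ≥0∞}
    (hA : ∀ t ∈ Set.Icc 0 T, velSup volume β (f t) ≤ A) (t : ℝ) : velSup volume β (f t) ≤ A := by
  have hm : ∀ t, Measurable (f t) := fun t => h.meas.comp (measurable_const.prodMk measurable_id)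
  have hper : Function.Periodic (fun t => AEEqFun.mk (μ := volume) (f t)
      (hm t).aestronglyMeasurable) T := fun t => AEEqFun.mk_eq_mk.2 (h.periodic t)
  obtain ⟨y, hy, hty⟩ := hper.exists_mem_Ico₀ hT t
  have hty' : f t =ᵐ[volume] f y := AEEqFun.mk_eq_mk.1 hty
  refine le_trans (le_of_eq ?_) (hA y ⟨hy.1, hy.2.le⟩)
  refine eLpNorm_congr_ae ?_
  filter_upwards [hty'] with p hp
  rw [hp]

/-- The extension of the boundary data is bounded by the data. -/
theorem BoundaryData.Admissible.enorm_U_le {B : BoundaryData} {S : Frame} {P : Profile} {T : ℝ}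
    (hB : B.Admissible S P T) (hT : 0 < T) {C : ℝ} (hC : ∀ s, 0 ≤ s → |S.cut s| ≤ C) {A : ℝ≥0∞}
    (hA : B.delta S P T ≤ A) (t : ℝ) : ∀ᵐ z ∂phase, ‖B.U S P t z.1 z.2‖ₑ
      ≤ ENNReal.ofReal C * A * ENNReal.ofReal (wt z.2 ^ (-S.beta)) := by
  have hpos : ∀ᵐ z ∂phase, 0 < z.1 0 := ae_phase_of_ae (ae_of_all _ fun z hz => hz)
  have hcut : ∀ s, 0 < s → ‖S.cut s‖ₑ ≤ ENNReal.ofReal C := fun s hs => by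
    rw [← ofReal_norm]; exact ENNReal.ofReal_le_ofReal (hC s hs.le)
  cases B with
  | stationary fb =>
    have h1 : velSup volume S.beta (pert S P fb) ≤ A := le_trans le_add_self hA
    filter_upwards [ae_phase_of_ae_characteristic (ae_le_of_velSup_le h1), hpos] with z hz h0
    simp only [BoundaryData.U]
    rw [enorm_mul, mul_assoc]
    refine mul_le_mul' (hcut _ h0) ?_
    unfold freeExt
    split_ifs
    · exact hz
    · simp
  | periodic fb dt grad =>
    have h1 : ∀ t, velSup volume S.beta (pert S P (fb t)) ≤ A := by
      refine PeriodicAdmissible.velSup_le hB hT fun t ht => ?_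
      refine le_trans ?_ hA
      refine le_trans ?_ le_add_self
      refine le_trans ?_ (le_iSup₂_of_le t ht le_rfl)
      refine le_trans ?_ le_self_add
      refine le_trans ?_ le_self_add
      exact le_add_self
    filter_upwards [ae_phase_of_ae_tang (ae_le_of_velSup_le (h1 t)), hpos] with z hz h0
    simp only [BoundaryData.U]
    rw [enorm_mul, mul_assoc]
    exact mul_le_mul' (hcut _ h0) hz

theorem BoundaryData.Admissible.measurable_U {B : BoundaryData} {S : Frame} {P : Profile} {T : ℝ}
    (hS : S.Admissible) (hB : B.Admissible S P T) (t : ℝ) :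
    Measurable fun z : V3 × V3 => B.U S P t z.1 z.2 := by
  have hm0 : Measurable fun x : V3 => x 0 := by fun_prop
  have hcut : Measurable S.cut := hS.cut_smooth.continuous.measurable
  cases B with
  | stationary fb =>
    have hm : Measurable (pert S P fb) := StationaryAdmissible.meas hB
    simp only [BoundaryData.U, freeExt]
    refine (by fun_prop : Measurable fun z : V3 × V3 => S.cut (z.1 0)).mul
      (Measurable.ite (measurableSet_lt measurable_const (by fun_prop)) (by fun_prop) measurable_const)
  | periodic fb dt grad =>
    have hm : Measurable (pert S P (fb t)) :=
      (PeriodicAdmissible.meas hB).comp (measurable_const.prodMk measurable_id)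
    simp only [BoundaryData.U]
    fun_prop

/-- The background is small in the weighted supremum norm. -/
theorem BoundaryData.Admissible.velBound_background {B : BoundaryData} {S : Frame} {P : Profile}
    {T γ₀ M₀ : ℝ} (hS : S.Admissible) (hP : P.Admissible S γ₀ M₀) (hγ₀ : 0 < γ₀) (hM₀ : 0 < M₀)
    (hB : B.Admissible S P T) (hT : 0 < T) {C : ℝ} (hC0 : 0 < C)
    (hC : ∀ s, 0 ≤ s → |S.cut s| ≤ C) {η : ℝ} (hη : 0 ≤ η)
    (hA : B.delta S P T ≤ ENNReal.ofReal η) (t : ℝ) :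
    VelBound S.beta (ENNReal.ofReal (C * (M₀ + 1) * η)) fun z => B.background S P t z.1 z.2 := by
  have hm0 : Measurable fun x : V3 => x 0 := by fun_prop
  have hcut : Measurable S.cut := hS.cut_smooth.continuous.measurable
  have hU := hB.measurable_U hS t
  have hf := hP.ftil_measurable
  have hd : P.dtil ≤ η := by
    rw [← ENNReal.ofReal_le_ofReal_iff hη]
    refine le_trans ?_ hA
    cases B with
    | stationary fb => exact le_self_add.trans le_self_add
    | periodic fb dt grad => exact le_self_add
  have hpos : ∀ᵐ z ∂phase, 0 < z.1 0 := ae_phase_of_ae (ae_of_all _ fun z hz => hz)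
  refine ⟨?_, ?_⟩
  · unfold BoundaryData.background Frame.cutR
    fun_prop
  · filter_upwards [hB.enorm_U_le hT hC hA t, ae_phase_of_ae_slab hP.ftil_bound, hpos] with z h1 h2 h0
    have hwt : 0 ≤ wt z.2 ^ (-S.beta) := Real.rpow_nonneg (wt_pos _).le _
    rw [BoundaryData.background]
    refine (enorm_add_le _ _).trans ?_
    have h3 : ‖S.cutR (tang z.1) * P.ftil (z.1 0, z.2)‖ₑ
        ≤ ENNReal.ofReal (C * M₀ * η) * ENNReal.ofReal (wt z.2 ^ (-S.beta)) := by
      rw [← ofReal_norm, ← ENNReal.ofReal_mul (by positivity)]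
      refine ENNReal.ofReal_le_ofReal ?_
      rw [norm_mul, Real.norm_eq_abs, Real.norm_eq_abs, Frame.cutR]
      have h4 := hC (‖tang z.1‖ / S.R) (div_nonneg (norm_nonneg _) hS.R_pos.le)
      have h5 : Real.exp (-(γ₀ * z.1 0)) ≤ 1 := Real.exp_le_one_iff.2 (by
        have := mul_pos hγ₀ h0
        linarith)
      have h6 := hP.dtil_nonneg
      calc _ ≤ C * (P.dtil * M₀ * Real.exp (-(γ₀ * z.1 0)) * wt z.2 ^ (-S.beta)) := by gcongr
        _ ≤ C * (η * M₀ * 1 * wt z.2 ^ (-S.beta)) := by gcongr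
        _ = _ := by ring
    refine (add_le_add h3 h1).trans (le_of_eq ?_)
    rw [← add_mul, ← ENNReal.ofReal_mul hC0.le, ← ENNReal.ofReal_add (by positivity) (by positivity)]
    congr 2; ring

theorem eLpNorm_cut_mul_tang_le {S : Frame} (hS : S.Admissible) {C : ℝ}
    (hC : ∀ s, 0 ≤ s → |S.cut s| ≤ C) {q : V2 × V3 → ℝ} (hq : Measurable q) :
    eLpNorm (fun z : V3 × V3 => S.cut (z.1 0) * q (tang z.1, z.2)) 2 phase
      ≤ ENNReal.ofReal (2 * C) * eLpNorm q 2 volume := by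
  have hm0 : Measurable fun x : V3 => x 0 := by fun_prop
  have hcut : Measurable S.cut := hS.cut_smooth.continuous.measurable
  have hC0 : 0 ≤ C := (abs_nonneg _).trans (hC 0 le_rfl)
  have hms : MeasurableSet {p : V3 × V3 | 0 < p.1 0} :=
    measurableSet_lt measurable_const (by fun_prop)
  -- both sides are compared with integrals over the boundary phase space
  have key : ∫⁻ z : V3 × V3, ‖S.cut (z.1 0) * q (tang z.1, z.2)‖ₑ ^ 2 ∂phase
      ≤ ENNReal.ofReal (2 * C) ^ 2 * ∫⁻ p, ‖q p‖ₑ ^ 2 := by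
    have hF : Measurable fun y : ℝ × V2 × V3 =>
        (Set.Ioi (0 : ℝ)).indicator (fun s => ‖S.cut s‖ₑ ^ 2) y.1 * ‖q y.2‖ₑ ^ 2 :=
      (((by fun_prop : Measurable fun s => ‖S.cut s‖ₑ ^ 2).indicator measurableSet_Ioi).comp
        measurable_fst).mul (by fun_prop)
    have e1 : ∫⁻ z : V3 × V3, ‖S.cut (z.1 0) * q (tang z.1, z.2)‖ₑ ^ 2 ∂phase
        = ∫⁻ y : ℝ × V2 × V3,
          (Set.Ioi (0 : ℝ)).indicator (fun s => ‖S.cut s‖ₑ ^ 2) y.1 * ‖q y.2‖ₑ ^ 2 := by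
      rw [← measurePreserving_split.lintegral_comp hF, phase, ← lintegral_indicator hms]
      refine lintegral_congr fun z => ?_
      by_cases hz : 0 < z.1 0
      · rw [Set.indicator_of_mem (show z ∈ {p : V3 × V3 | 0 < p.1 0} from hz),
          Set.indicator_of_mem (show z.1 0 ∈ Set.Ioi (0 : ℝ) from hz), enorm_mul, mul_pow]
      · rw [Set.indicator_of_notMem (show z ∉ {p : V3 × V3 | 0 < p.1 0} from hz),
          Set.indicator_of_notMem (show z.1 0 ∉ Set.Ioi (0 : ℝ) from hz), zero_mul]
    rw [e1, Measure.volume_eq_prod, lintegral_prod_mul (g := fun p : V2 × V3 => ‖q p‖ₑ ^ 2)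
      ((by fun_prop : Measurable fun s => ‖S.cut s‖ₑ ^ 2).indicator measurableSet_Ioi).aemeasurable
      (by fun_prop)]
    gcongr
    calc _ ≤ ∫⁻ s, (Set.Ioc (0 : ℝ) 2).indicator (fun _ => ENNReal.ofReal C ^ 2) s := by
          refine lintegral_mono fun s => ?_
          by_cases hs : 0 < s
          · rw [Set.indicator_of_mem (show s ∈ Set.Ioi (0 : ℝ) from hs)]
            by_cases hs2 : s ≤ 2
            · rw [Set.indicator_of_mem (show s ∈ Set.Ioc (0 : ℝ) 2 from ⟨hs, hs2⟩), ← ofReal_norm]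
              gcongr
              exact hC s hs.le
            · rw [hS.cut_zero s (by linarith)]; simp
          · rw [Set.indicator_of_notMem (show s ∉ Set.Ioi (0 : ℝ) from hs)]; exact zero_le
      _ = ENNReal.ofReal C ^ 2 * 2 := by
          rw [lintegral_indicator measurableSet_Ioc, setLIntegral_const, Real.volume_Ioc]
          norm_num
      _ ≤ _ := by
          rw [ENNReal.ofReal_mul (by norm_num), mul_pow, mul_comm]
          gcongr
          norm_num
  rw [← (ENNReal.pow_right_strictMono two_ne_zero).le_iff_le, mul_pow, eLpNorm_two_sq,
    eLpNorm_two_sq]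
  exact key

theorem BoundaryData.Admissible.continuousInL2_background {B : BoundaryData} {S : Frame}
    {P : Profile} {T : ℝ} (hS : S.Admissible) (hB : B.Admissible S P T) :
    ContinuousInL2 phase fun t (z : V3 × V3) =>
      B.background S P t z.1 z.2 - B.background S P 0 z.1 z.2 := by
  cases B with
  | stationary fb =>
    have e : (fun (t : ℝ) (z : V3 × V3) =>
        (BoundaryData.stationary fb).background S P t z.1 z.2
          - (BoundaryData.stationary fb).background S P 0 z.1 z.2) = fun _ _ => 0 := by
      ext t z; simp only [BoundaryData.background, BoundaryData.U, sub_self]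
    rw [e]
    exact ⟨fun _ => MemLp.zero, fun _ => by simp⟩
  | periodic fb dt grad =>
    obtain ⟨C, hC0, hC⟩ := hS.exists_cut_le
    have hB' : PeriodicAdmissible S.beta T (fun t => pert S P (fb t)) dt grad := hB
    have hm : ∀ t, Measurable (pert S P (fb t)) := fun t =>
      hB'.meas.comp (measurable_const.prodMk measurable_id)
    have hc : Continuous S.cut := hS.cut_smooth.continuous
    have hcm : Measurable S.cut := hc.measurable
    have hm0 : Measurable fun x : V3 => x 0 := by fun_prop
    -- the weight in the norm of the data only helps
    have hq : ∀ t s, eLpNorm (fun p => pert S P (fb t) p - pert S P (fb s) p) 2 volume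
        ≤ eLpNorm (fun p : V2 × V3 => wt p.2 * pert S P (fb t) p - wt p.2 * pert S P (fb s) p) 2
          volume := fun t s => by
      refine eLpNorm_mono fun p => ?_
      rw [← mul_sub, norm_mul, Real.norm_of_nonneg (wt_pos _).le]
      exact le_mul_of_one_le_left (norm_nonneg _) (one_le_wt _)
    have hd : ∀ t s, eLpNorm (fun z : V3 × V3 =>
        (BoundaryData.periodic fb dt grad).background S P t z.1 z.2
        - (BoundaryData.periodic fb dt grad).background S P s z.1 z.2) 2 phase
        ≤ ENNReal.ofReal (2 * C) * eLpNorm (fun p : V2 × V3 =>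
          wt p.2 * pert S P (fb t) p - wt p.2 * pert S P (fb s) p) 2 volume := fun t s => by
      have e : (fun z : V3 × V3 => (BoundaryData.periodic fb dt grad).background S P t z.1 z.2
          - (BoundaryData.periodic fb dt grad).background S P s z.1 z.2)
          = fun z => S.cut (z.1 0) * (fun p => pert S P (fb t) p - pert S P (fb s) p)
            (tang z.1, z.2) := by
        ext z; simp only [BoundaryData.background, BoundaryData.U]; ring
      rw [e]
      refine (eLpNorm_cut_mul_tang_le hS hC ((hm t).sub (hm s))).trans ?_
      gcongr
      exact hq t s
    have hmeas : ∀ t s, Measurable fun z : V3 × V3 =>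
        (BoundaryData.periodic fb dt grad).background S P t z.1 z.2
        - (BoundaryData.periodic fb dt grad).background S P s z.1 z.2 := fun t s => by
      have e : (fun z : V3 × V3 => (BoundaryData.periodic fb dt grad).background S P t z.1 z.2
          - (BoundaryData.periodic fb dt grad).background S P s z.1 z.2)
          = fun z => S.cut (z.1 0) * (pert S P (fb t) (tang z.1, z.2)
            - pert S P (fb s) (tang z.1, z.2)) := by
        ext z; simp only [BoundaryData.background, BoundaryData.U]; ring
      rw [e]
      have h1 := hm t
      have h2 := hm s
      fun_prop
    refine ⟨fun t => ⟨(hmeas t 0).aestronglyMeasurable, (hd t 0).trans_lt (ENNReal.mul_lt_top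
      ENNReal.ofReal_lt_top ((hB'.contL2.1 t).sub (hB'.contL2.1 0)).2)⟩, fun t₀ => ?_⟩
    have h := ENNReal.Tendsto.const_mul (a := ENNReal.ofReal (2 * C)) (hB'.contL2.2 t₀)
      (Or.inr ENNReal.ofReal_ne_top)
    rw [mul_zero] at h
    refine tendsto_of_tendsto_of_tendsto_of_le_of_le tendsto_const_nhds h (fun _ => zero_le)
      fun t => ?_
    simp only [sub_sub_sub_cancel_right]
    exact hd t t₀

variable {G : Gas}

/-! ### Pairing with test functions -/

section Curves

variable {α : Type*} [MeasurableSpace α] {ν : Measure α} {F K : ℝ → α → ℝ}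

/-- The curve in `L²` given by an element of `C(ℝ; L²)`. -/
def ContinuousInL2.curve (hF : ContinuousInL2 ν F) (t : ℝ) : Lp ℝ 2 ν := (hF.1 t).toLp (F t)

theorem ContinuousInL2.curve_ae (hF : ContinuousInL2 ν F) (t : ℝ) : hF.curve t =ᵐ[ν] F t :=
  (hF.1 t).coeFn_toLp

theorem ContinuousInL2.continuous_curve (hF : ContinuousInL2 ν F) : Continuous hF.curve := by
  refine continuous_iff_continuousAt.2 fun t₀ => tendsto_iff_edist_tendsto_0.2 ?_
  refine (hF.2 t₀).congr fun t => ?_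
  rw [ContinuousInL2.curve, ContinuousInL2.curve, Lp.edist_toLp_toLp]; rfl

theorem ContinuousInL2.integrable_mul (hF : ContinuousInL2 ν F) (hK : ContinuousInL2 ν K) (t : ℝ) :
    Integrable (fun z => F t z * K t z) ν :=
  (L2_integrable_mul (hF.curve t) (hK.curve t)).congr ((hF.curve_ae t).mul (hK.curve_ae t))

theorem ContinuousInL2.inner_curve (hF : ContinuousInL2 ν F) (hK : ContinuousInL2 ν K) (t s : ℝ) :
    (inner ℝ (hF.curve t) (hK.curve s) : ℝ) = ∫ z, F t z * K s z ∂ν := by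
  rw [L2_inner_eq]
  exact integral_congr_ae ((hF.curve_ae t).mul (hK.curve_ae s))

theorem ContinuousInL2.continuous_integral_mul (hF : ContinuousInL2 ν F) (hK : ContinuousInL2 ν K) :
    Continuous fun t => ∫ z, F t z * K t z ∂ν := by
  simp_rw [← hF.inner_curve hK]
  exact hF.continuous_curve.inner hK.continuous_curve

end Curves

instance : IsLocallyFiniteMeasure phase := by rw [phase]; infer_instance

theorem continuousInL2_of_hasCompactSupport {Φ : ℝ × V3 × V3 → ℝ} (hc : Continuous Φ)
    (hs : HasCompactSupport Φ) : ContinuousInL2 phase fun t z => Φ (t, z) := by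
  set s : Set (V3 × V3) := Prod.snd '' tsupport Φ with hsd
  have hsc : IsCompact s := hs.isCompact.image continuous_snd
  have hsup : ∀ t, Function.support (fun z => Φ (t, z)) ⊆ s := fun t z hz =>
    ⟨(t, z), subset_tsupport _ hz, rfl⟩
  refine ⟨fun t => Continuous.memLp_of_hasCompactSupport (by fun_prop)
    (HasCompactSupport.of_support_subset_isCompact hsc (hsup t)), fun t₀ => ?_⟩
  have hu := hs.uniformContinuous_of_continuous hc
  have hfin : phase s < ⊤ := hsc.measure_lt_top
  set M : ℝ≥0∞ := phase s ^ (1 / (2 : ℝ≥0∞).toReal) with hM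
  have hMt : M < ⊤ := ENNReal.rpow_lt_top_of_nonneg (by positivity) hfin.ne
  rw [ENNReal.tendsto_nhds_zero]
  intro e he
  rcases eq_or_ne e ⊤ with rfl | het
  · simp
  -- the uniform bound `c` is chosen so that `c * M ≤ e`
  set c : ℝ := e.toReal / (M.toReal + 1) with hcd
  have hepos : 0 < e.toReal := ENNReal.toReal_pos he.ne' het
  have hcpos : 0 < c := by positivity
  obtain ⟨d, hd, hud⟩ := Metric.uniformContinuous_iff.1 hu c hcpos
  filter_upwards [Metric.ball_mem_nhds t₀ hd] with t ht
  have h := eLpNorm_sub_le_of_dist_bdd (p := 2) phase (by norm_num) hsc.measurableSet hcpos.le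
    (f := fun z => Φ (t, z)) (g := fun z => Φ (t₀, z)) (fun z => (hud (by
      rw [Prod.dist_eq, dist_self]; simpa using ht)).le) (hsup t) (hsup t₀)
  refine (show _ ≤ _ from h).trans ?_
  rw [← hM, ← ENNReal.ofReal_toReal hMt.ne, ← ENNReal.ofReal_mul hcpos.le]
  refine ENNReal.ofReal_le_of_le_toReal ?_
  rw [hcd, div_mul_eq_mul_div, div_le_iff₀ (by positivity)]
  nlinarith [ENNReal.toReal_nonneg (a := M)]

/-- Integrability for the pairing of `F` with a test function, when `⟨ξ⟩⁻¹ F ∈ C(ℝ; L²)`. -/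
theorem ContinuousInL2.pairing_integrable {F : ℝ → V3 × V3 → ℝ}
    (hF : ContinuousInL2 phase fun t z => (wt z.2)⁻¹ * F t z) {Φ : ℝ × V3 × V3 → ℝ}
    (hc : Continuous Φ) (hs : HasCompactSupport Φ) :
    (∀ t, Integrable (fun z => F t z * Φ (t, z)) phase) ∧
      Integrable fun t => ∫ z, F t z * Φ (t, z) ∂phase := by
  have hwt : Continuous wt := by unfold wt; fun_prop
  have hΦ := continuousInL2_of_hasCompactSupport (Φ := fun z => wt z.2.2 * Φ z) (by fun_prop)
    hs.mul_left
  have e : ∀ t (z : V3 × V3), (wt z.2)⁻¹ * F t z * (wt z.2 * Φ (t, z)) = F t z * Φ (t, z) :=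
    fun t z => by have := (wt_pos z.2).ne'; field_simp
  have h1 := hF.integrable_mul hΦ
  have h2 := hF.continuous_integral_mul hΦ
  simp only [e] at h1 h2
  refine ⟨h1, h2.integrable_of_hasCompactSupport ?_⟩
  refine HasCompactSupport.intro (hs.isCompact.image continuous_fst) fun t ht => ?_
  refine integral_eq_zero_of_ae (ae_of_all _ fun z => ?_)
  have : Φ (t, z) = 0 := by
    by_contra h
    exact ht ⟨(t, z), subset_tsupport _ h, rfl⟩
  simp [this]

theorem pairing_sub_left {F K : ℝ → V3 → V3 → ℝ}
    (hF : ContinuousInL2 phase fun t z => (wt z.2)⁻¹ * F t z.1 z.2)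
    (hK : ContinuousInL2 phase fun t z => (wt z.2)⁻¹ * K t z.1 z.2) {Φ : ℝ × V3 × V3 → ℝ}
    (hc : Continuous Φ) (hs : HasCompactSupport Φ) :
    pairing (fun t x ξ => F t x ξ - K t x ξ) Φ = pairing F Φ - pairing K Φ := by
  obtain ⟨h1, h2⟩ := ContinuousInL2.pairing_integrable (F := fun t z => F t z.1 z.2) hF hc hs
  obtain ⟨h3, h4⟩ := ContinuousInL2.pairing_integrable (F := fun t z => K t z.1 z.2) hK hc hs
  unfold pairing
  rw [← integral_sub h2 h4]
  refine integral_congr_ae (ae_of_all _ fun t => ?_)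
  simp only
  rw [← integral_sub (h1 t) (h3 t)]
  exact integral_congr_ae (ae_of_all _ fun z => sub_mul _ _ _)

theorem pairing_add_left {F K : ℝ → V3 → V3 → ℝ}
    (hF : ContinuousInL2 phase fun t z => (wt z.2)⁻¹ * F t z.1 z.2)
    (hK : ContinuousInL2 phase fun t z => (wt z.2)⁻¹ * K t z.1 z.2) {Φ : ℝ × V3 × V3 → ℝ}
    (hc : Continuous Φ) (hs : HasCompactSupport Φ) :
    pairing (fun t x ξ => F t x ξ + K t x ξ) Φ = pairing F Φ + pairing K Φ := by
  obtain ⟨h1, h2⟩ := ContinuousInL2.pairing_integrable (F := fun t z => F t z.1 z.2) hF hc hs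
  obtain ⟨h3, h4⟩ := ContinuousInL2.pairing_integrable (F := fun t z => K t z.1 z.2) hK hc hs
  unfold pairing
  rw [← integral_add h2 h4]
  refine integral_congr_ae (ae_of_all _ fun t => ?_)
  simp only
  rw [← integral_add (h1 t) (h3 t)]
  exact integral_congr_ae (ae_of_all _ fun z => add_mul _ _ _)

theorem pairing_add_right {F : ℝ → V3 → V3 → ℝ}
    (hF : ContinuousInL2 phase fun t z => (wt z.2)⁻¹ * F t z.1 z.2) {Φ Φ' : ℝ × V3 × V3 → ℝ}
    (hc : Continuous Φ) (hs : HasCompactSupport Φ) (hc' : Continuous Φ')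
    (hs' : HasCompactSupport Φ') :
    pairing F (fun z => Φ z + Φ' z) = pairing F Φ + pairing F Φ' := by
  obtain ⟨h1, h2⟩ := ContinuousInL2.pairing_integrable (F := fun t z => F t z.1 z.2) hF hc hs
  obtain ⟨h3, h4⟩ := ContinuousInL2.pairing_integrable (F := fun t z => F t z.1 z.2) hF hc' hs'
  unfold pairing
  rw [← integral_add h2 h4]
  refine integral_congr_ae (ae_of_all _ fun t => ?_)
  simp only
  rw [← integral_add (h1 t) (h3 t)]
  exact integral_congr_ae (ae_of_all _ fun z => mul_add _ _ _)

/-! ### Weak derivatives in time -/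

/-- A smooth function on the line with compact support to the left of `T` and vanishing integral
is the derivative of another function of this kind. -/
theorem exists_primitive_of_integral_eq_zero {T : ℝ} {θ : ℝ → ℝ} (hθ : Continuous θ)
    (hs : HasCompactSupport θ) (hT : tsupport θ ⊆ Set.Iio T) (h0 : ∫ t, θ t = 0) :
    ∃ χ : ℝ → ℝ, (∀ t, HasDerivAt χ (θ t) t) ∧ HasCompactSupport χ ∧ ∀ t, T ≤ t → χ t = 0 := by
  obtain ⟨r, hr⟩ := hs.isCompact.bddBelow
  obtain ⟨q, hq⟩ := hs.isCompact.bddAbove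
  set a := min r T - 1 with ha
  have hz : ∀ t, t ≤ a → θ t = 0 := fun t ht => by
    refine image_eq_zero_of_notMem_tsupport fun h => ?_
    have := hr h
    have := min_le_left r T
    linarith
  have hzT : ∀ t, T ≤ t → θ t = 0 := fun t ht => by
    refine image_eq_zero_of_notMem_tsupport fun h => ?_
    have := hT h
    exact absurd this (not_lt.2 ht)
  have hbig : ∀ t, T ≤ t → ∫ s in a..t, θ s = 0 := fun t ht => by
    rw [intervalIntegral.integral_eq_integral_of_support_subset, h0]
    intro s hs'
    refine ⟨not_le.1 fun h => hs' (hz s h), le_of_lt (lt_of_lt_of_le (not_le.1 fun h => hs' (hzT s h)) ht)⟩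
  refine ⟨fun t => ∫ s in a..t, θ s, fun t => (hθ.integral_hasStrictDerivAt a t).hasDerivAt, ?_, hbig⟩
  refine HasCompactSupport.intro (isCompact_Icc (a := a) (b := T)) fun t ht => ?_
  rcases lt_or_ge t a with h | h
  · refine intervalIntegral.integral_zero_ae (ae_of_all _ fun s hs' => hz s ?_)
    rw [Set.uIoc_of_ge h.le] at hs'
    exact hs'.2
  · exact hbig t (not_lt.1 fun h' => ht ⟨h, h'.le⟩)

/-- If `D` is continuous and `∫ χ' D = 0` for all `χ` supported to the left of `T`, then `D` is
constant there. -/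
theorem eq_of_integral_deriv_mul_eq_zero {T : ℝ} {D : ℝ → ℝ} (hD : Continuous D)
    (h : ∀ χ : ℝ → ℝ, ContDiff ℝ 1 χ → HasCompactSupport χ → (∀ t, T ≤ t → χ t = 0) →
      ∫ t, deriv χ t * D t = 0) {t : ℝ} (ht : t ≤ T) : D t = D T := by
  -- a fixed bump to the left of `T`
  let ρ : ContDiffBump (T - 2) := ⟨1 / 2, 1, by norm_num, by norm_num⟩
  set b : ℝ → ℝ := ρ.normed volume with hb
  have hbc : ContDiff ℝ (⊤ : ℕ∞) b := ρ.contDiff_normed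
  have hbs : HasCompactSupport b := ρ.hasCompactSupport_normed
  have hbT : tsupport b ⊆ Set.Iio T := by
    rw [hb, ρ.tsupport_normed_eq]
    intro s hs
    rw [Metric.mem_closedBall, Real.dist_eq] at hs
    have := (abs_le.1 hs).2
    change s < T
    have e : ρ.rOut = 1 := rfl
    linarith
  have hb1 : ∫ t, b t = 1 := ρ.integral_normed
  set c : ℝ := ∫ t, b t * D t with hc
  have hint : ∀ g : ℝ → ℝ, Continuous g → HasCompactSupport g → Integrable fun t => g t * D t :=
    fun g hg hgs => (hg.mul hD).integrable_of_hasCompactSupport hgs.mul_right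
  have key : ∀ᵐ s, s ∈ Set.Iio T → D s - c = 0 := by
    refine isOpen_Iio.ae_eq_zero_of_integral_contDiff_smul_eq_zero
      ((hD.sub continuous_const).locallyIntegrable.locallyIntegrableOn _) fun g hg hgs hgT => ?_
    set m : ℝ := ∫ t, g t with hm
    have hgi : Integrable g := hg.continuous.integrable_of_hasCompactSupport hgs
    have hbi : Integrable b := hbc.continuous.integrable_of_hasCompactSupport hbs
    have hθs : HasCompactSupport fun t => g t - m * b t := hgs.sub (hbs.mul_left)
    have hθc : ContDiff ℝ (⊤ : ℕ∞) fun t => g t - m * b t := hg.sub (contDiff_const.mul hbc)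
    obtain ⟨χ, hχ, hχs, hχT⟩ := exists_primitive_of_integral_eq_zero (T := T) hθc.continuous hθs
      (by
        refine (tsupport_sub g _).trans (Set.union_subset hgT ?_)
        exact (closure_mono (Function.support_mul_subset_right (fun _ => m) b)).trans hbT)
      (by
        rw [integral_sub hgi (hbi.const_mul m), integral_const_mul, hb1, mul_one, hm, sub_self])
    have hd : deriv χ = fun t => g t - m * b t := funext fun t => (hχ t).deriv
    have h' := h χ (contDiff_one_iff_deriv.2 ⟨fun t => (hχ t).differentiableAt, by
      rw [hd]; exact hθc.continuous⟩) hχs hχT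
    rw [hd] at h'
    have i1 := hint g hg.continuous hgs
    have i2 := (hint b hbc.continuous hbs).const_mul m
    have e : ∀ t, (g t - m * b t) * D t = g t * D t - m * (b t * D t) := fun t => by ring
    simp only [e] at h'
    rw [integral_sub i1 i2, integral_const_mul, ← hc] at h'
    have e2 : ∀ t, g t • (D t - c) = g t * D t - c * g t := fun t => by rw [smul_eq_mul]; ring
    simp only [e2]
    rw [integral_sub i1 (hgi.const_mul c), integral_const_mul, ← hm]
    linarith
  have h1 : Set.EqOn D (fun _ => c) (Set.Iic T) := by
    have : D =ᵐ[volume.restrict (Set.Iic T)] fun _ => c := by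
      rw [Filter.EventuallyEq, ← restrict_Iio_eq_restrict_Iic, ae_restrict_iff' measurableSet_Iio]
      filter_upwards [key] with s hs hsT
      linarith [hs hsT]
    refine Measure.eqOn_of_ae_eq this hD.continuousOn continuousOn_const ?_
    rw [interior_Iic, closure_Iio]
  rw [h1 ht, h1 (Set.mem_Iic.2 le_rfl)]

/-- If `a' = b` weakly on the left of `T`, then `a` is a primitive of `b`. -/
theorem sub_eq_integral_of_weak_deriv {T : ℝ} {a b : ℝ → ℝ} (ha : Continuous a)
    (hb : Continuous b)
    (h : ∀ χ : ℝ → ℝ, ContDiff ℝ 1 χ → HasCompactSupport χ → (∀ t, T ≤ t → χ t = 0) →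
      (∫ t, deriv χ t * a t) + ∫ t, χ t * b t = 0) {t : ℝ} (ht : t ≤ T) :
    a T - a t = ∫ s in t..T, b s := by
  have hB : ∀ s, HasDerivAt (fun s => ∫ r in T..s, b r) (b s) s := fun s =>
    (hb.integral_hasStrictDerivAt T s).hasDerivAt
  have hBc : Continuous fun s => ∫ r in T..s, b r :=
    continuous_iff_continuousAt.2 fun s => (hB s).continuousAt
  have key := eq_of_integral_deriv_mul_eq_zero (T := T) (D := fun s => a s - ∫ r in T..s, b r)
    (ha.sub hBc) (fun χ hχ hχs hχT => ?_) ht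
  · simp only [intervalIntegral.integral_same, sub_zero] at key
    rw [intervalIntegral.integral_symm, ← key]; ring
  have hχ' : Continuous (deriv χ) := hχ.continuous_deriv le_rfl
  have hint : ∀ g k : ℝ → ℝ, Continuous g → Continuous k → HasCompactSupport g →
      Integrable fun t => g t * k t :=
    fun g k hg hk hgs => (hg.mul hk).integrable_of_hasCompactSupport hgs.mul_right
  have ibp := integral_mul_deriv_eq_deriv_mul_of_integrable (u := χ) (u' := deriv χ)
    (v := fun s => ∫ r in T..s, b r) (v' := b)
    (fun x _ => (hχ.differentiable one_ne_zero x).hasDerivAt) (fun x _ => hB x)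
    (hint _ _ hχ.continuous hb hχs) (hint _ _ hχ' hBc hχs.deriv) (hint _ _ hχ.continuous hBc hχs)
  have h' := h χ hχ hχs hχT
  simp only [mul_sub]
  rw [integral_sub (hint _ _ hχ' ha hχs.deriv) (hint _ _ hχ' hBc hχs.deriv)]
  linarith

variable {G : Gas}

/-! ### Free transport -/

/-- Free transport `(x, ξ) ↦ (x + s ξ, ξ)`. -/
def shear (s : ℝ) : C(V3 × V3, V3 × V3) := ⟨fun z => (z.1 + s • z.2, z.2), by fun_prop⟩

theorem continuous_shear : Continuous shear := by
  refine ContinuousMap.continuous_of_continuous_uncurry _ ?_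
  change Continuous fun p : ℝ × V3 × V3 => (p.2.1 + p.1 • p.2.2, p.2.2)
  fun_prop

theorem measurePreserving_shear (s : ℝ) : MeasurePreserving (shear s) volume volume := by
  have h1 : MeasurePreserving (fun p : V3 × V3 => (p.1, p.2 + s • p.1))
      ((volume : Measure V3).prod (volume : Measure V3)) (volume.prod volume) := by
    refine MeasurePreserving.skew_product (f := id) (g := fun (ξ : V3) (y : V3) =>
      y + s • ξ) (MeasurePreserving.id _) (by fun_prop) (ae_of_all _ fun ξ => ?_)
    exact (measurePreserving_add_right volume _).map_eq
  exact (Measure.measurePreserving_swap.comp h1).comp Measure.measurePreserving_swap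

theorem shear_neg_shear (s : ℝ) (z : V3 × V3) : shear s (shear (-s) z) = z := by
  ext1
  · change z.1 + -s • z.2 + s • z.2 = z.1
    rw [neg_smul, neg_add_cancel_right]
  · rfl

/-- The space `L²(ℝ³ × ℝ³)`, which contains `L²(ℝ³₊ × ℝ³)` by extension by zero. -/
abbrev WholeL2 := Lp ℝ 2 (volume : Measure (V3 × V3))

/-- The group `f ↦ f(x + s ξ, ξ)` of isometries of `L²(ℝ³ × ℝ³)`. -/
def transport (s : ℝ) : WholeL2 →ₗᵢ[ℝ] WholeL2 :=
  Lp.compMeasurePreservingₗᵢ ℝ (shear s) (measurePreserving_shear s)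

theorem transport_ae (s : ℝ) (f : WholeL2) : transport s f =ᵐ[volume] f ∘ shear s :=
  Lp.coeFn_compMeasurePreserving f (measurePreserving_shear s)

theorem transport_neg_transport (s : ℝ) (f : WholeL2) : transport (-s) (transport s f) = f := by
  refine Lp.ext ?_
  have h1 := transport_ae (-s) (transport s f)
  have h2 := (measurePreserving_shear (-s)).quasiMeasurePreserving.ae_eq_comp (transport_ae s f)
  filter_upwards [h1, h2] with z z1 z2
  rw [z1, z2, Function.comp_apply, Function.comp_apply, shear_neg_shear]

theorem transport_zero (f : WholeL2) : transport 0 f = f := by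
  refine Lp.ext ((transport_ae 0 f).trans (ae_of_all _ fun z => ?_))
  have : shear 0 z = z := by
    change (z.1 + (0 : ℝ) • z.2, z.2) = z
    simp
  rw [Function.comp_apply, this]

theorem inner_transport (s : ℝ) (f g : WholeL2) :
    (inner ℝ f (transport s g) : ℝ) = inner ℝ (transport (-s) f) g := by
  rw [← (transport (-s)).inner_map_map f (transport s g), transport_neg_transport]

theorem Continuous.transport {s : ℝ → ℝ} {f : ℝ → WholeL2} (hs : Continuous s)
    (hf : Continuous f) : Continuous fun t => HalfSpaceBoltzmann.transport (s t) (f t) :=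
  Continuous.compMeasurePreservingLp (g := fun t => shear (s t)) hf (continuous_shear.comp hs)
    (fun t => measurePreserving_shear (s t)) (by norm_num)

/-- The half-space of the phase space. -/
def halfPhase : Set (V3 × V3) := {p | 0 < p.1 0}

theorem phase_eq_restrict : phase = volume.restrict halfPhase := rfl

theorem isOpen_halfPhase : IsOpen halfPhase := isOpen_lt continuous_const (by fun_prop)

theorem ContinuousInL2.indicator {F : ℝ → V3 × V3 → ℝ} (hF : ContinuousInL2 phase F) :
    ContinuousInL2 volume fun t => halfPhase.indicator (F t) := by
  have hm := isOpen_halfPhase.measurableSet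
  refine ⟨fun t => (memLp_indicator_iff_restrict hm).2 (hF.1 t), fun t₀ => ?_⟩
  refine (hF.2 t₀).congr fun t => ?_
  have e : (fun p => halfPhase.indicator (F t) p - halfPhase.indicator (F t₀) p)
      = halfPhase.indicator (fun p => F t p - F t₀ p) := (Set.indicator_sub' _ (F t) (F t₀)).symm
  rw [e, eLpNorm_indicator_eq_eLpNorm_restrict hm]; rfl

theorem inner_indicator_curve {F K : ℝ → V3 × V3 → ℝ} (hF : ContinuousInL2 phase F)
    (hK : ContinuousInL2 phase K) (t s : ℝ) :
    (inner ℝ (hF.indicator.curve t) (hK.indicator.curve s) : ℝ) = ∫ z, F t z * K s z ∂phase := by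
  rw [hF.indicator.inner_curve hK.indicator, phase_eq_restrict, ← integral_indicator isOpen_halfPhase.measurableSet]
  refine integral_congr_ae (ae_of_all _ fun z => ?_)
  exact (congrFun (Set.indicator_mul halfPhase (F t) (K s)) z).symm

theorem inner_indicator_curve_transport {F : ℝ → V3 × V3 → ℝ} (hF : ContinuousInL2 phase F)
    {ψ : V3 × V3 → ℝ} (hψ : MemLp ψ 2 volume) (t s : ℝ) :
    (inner ℝ (hF.indicator.curve t) (transport s (hψ.toLp ψ)) : ℝ)
      = ∫ z, F t z * ψ (shear s z) ∂phase := by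
  rw [L2_inner_eq, phase_eq_restrict, ← integral_indicator isOpen_halfPhase.measurableSet]
  have h2 := (measurePreserving_shear s).quasiMeasurePreserving.ae_eq_comp hψ.coeFn_toLp
  refine integral_congr_ae ?_
  filter_upwards [hF.indicator.curve_ae t, transport_ae s (hψ.toLp ψ), h2] with z z1 z2 z3
  rw [z1, z2, z3]
  by_cases hz : z ∈ halfPhase
  · rw [Set.indicator_of_mem hz, Set.indicator_of_mem hz]; rfl
  · rw [Set.indicator_of_notMem hz, Set.indicator_of_notMem hz, zero_mul]

/-! ### Test functions carried by the free transport -/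

/-- The test function `χ(t) μ(ξ) ψ(x + (T - t) ξ, ξ)`, which is transported along the
characteristics except for the factor `χ`. -/
def charTest (ε T : ℝ) (χ : ℝ → ℝ) (ψ : V3 × V3 → ℝ) (z : ℝ × V3 × V3) : ℝ :=
  χ z.1 * (mu ε z.2.2 * ψ (shear (T - z.1) z.2))

theorem contDiff_charTest {ε T : ℝ} {χ : ℝ → ℝ} {ψ : V3 × V3 → ℝ} (hχ : ContDiff ℝ 1 χ)
    (hψ : ContDiff ℝ 1 ψ) : ContDiff ℝ 1 (charTest ε T χ ψ) := by
  unfold charTest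
  have h1 : ContDiff ℝ 1 fun z : ℝ × V3 × V3 => (shear (T - z.1) z.2 : V3 × V3) := by
    change ContDiff ℝ 1 fun z : ℝ × V3 × V3 => (z.2.1 + (T - z.1) • z.2.2, z.2.2)
    fun_prop
  have h2 : ContDiff ℝ 1 (mu ε) := contDiff_mu ε
  exact (hχ.comp contDiff_fst).mul ((h2.comp (contDiff_snd.comp contDiff_snd)).mul (hψ.comp h1))

/-- The homeomorphism `(t, x, ξ) ↦ (t, x + (T - t) ξ, ξ)`. -/
def charHomeo (T : ℝ) : ℝ × V3 × V3 ≃ₜ ℝ × V3 × V3 where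
  toFun z := (z.1, z.2.1 + (T - z.1) • z.2.2, z.2.2)
  invFun z := (z.1, z.2.1 - (T - z.1) • z.2.2, z.2.2)
  left_inv z := by simp
  right_inv z := by simp
  continuous_toFun := by fun_prop
  continuous_invFun := by fun_prop

theorem hasCompactSupport_charTest {ε T : ℝ} {χ : ℝ → ℝ} {ψ : V3 × V3 → ℝ}
    (hχ : HasCompactSupport χ) (hψ : HasCompactSupport ψ) :
    HasCompactSupport (charTest ε T χ ψ) := by
  have h : HasCompactSupport fun z : ℝ × V3 × V3 => χ z.1 * (mu ε z.2.2 * ψ z.2) := by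
    refine HasCompactSupport.of_support_subset_isCompact (hχ.isCompact.prod hψ.isCompact) ?_
    intro z hz
    have h1 := left_ne_zero_of_mul hz
    have h2 := right_ne_zero_of_mul (right_ne_zero_of_mul hz)
    exact ⟨subset_tsupport _ h1, subset_tsupport _ h2⟩
  exact h.comp_homeomorph (charHomeo T)

theorem isTest_charTest {ε T : ℝ} {χ : ℝ → ℝ} {ψ : V3 × V3 → ℝ} (hχ : ContDiff ℝ 1 χ)
    (hχs : HasCompactSupport χ) (hχT : ∀ t, T ≤ t → χ t = 0) (hψ : ContDiff ℝ 1 ψ)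
    (hψs : HasCompactSupport ψ) (hψh : tsupport ψ ⊆ halfPhase) : IsTest (charTest ε T χ ψ) := by
  refine ⟨contDiff_charTest hχ hψ, hasCompactSupport_charTest hχs hψs, fun t x ξ hx hξ => ?_⟩
  unfold charTest
  rcases le_or_gt T t with h | h
  · rw [hχT t h, zero_mul]
  · -- the characteristic through a point of the outgoing boundary stays outside the half-space
    have : ψ (shear (T - t) (x, ξ)) = 0 := by
      refine image_eq_zero_of_notMem_tsupport fun hmem => ?_
      have h' := hψh hmem
      change 0 < (x + (T - t) • ξ) 0 at h'
      rw [PiLp.add_apply, PiLp.smul_apply, hx, smul_eq_mul, zero_add] at h'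
      nlinarith
    simp [this]

theorem fderiv_charTest {ε T : ℝ} {χ : ℝ → ℝ} {ψ : V3 × V3 → ℝ} (hχ : ContDiff ℝ 1 χ)
    (hψ : ContDiff ℝ 1 ψ) (z : ℝ × V3 × V3) :
    fderiv ℝ (charTest ε T χ ψ) z (1, 0, 0) + fderiv ℝ (charTest ε T χ ψ) z (0, z.2.2, 0)
      = charTest ε T (deriv χ) ψ z := by
  obtain ⟨t, x, ξ⟩ := z
  rw [← map_add]
  have e : ((1, 0, 0) + (0, ξ, 0) : ℝ × V3 × V3) = (1, ξ, 0) := by simp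
  rw [e]
  have h1 : HasDerivAt (fun s : ℝ => ((t, x, ξ) + (s - t) • (1, ξ, 0) : ℝ × V3 × V3)) (1, ξ, 0) t := by
    have := (((hasDerivAt_id t).sub_const t).smul_const ((1, ξ, 0) : ℝ × V3 × V3)).const_add
      ((t, x, ξ) : ℝ × V3 × V3)
    simpa using this
  have h2 := ((contDiff_charTest (ε := ε) (T := T) hχ hψ).differentiable one_ne_zero
    ((t, x, ξ) + (t - t) • (1, ξ, 0))).hasFDerivAt.comp_hasDerivAt t h1
  have e2 : (charTest ε T χ ψ ∘ fun s : ℝ => ((t, x, ξ) + (s - t) • (1, ξ, 0) : ℝ × V3 × V3))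
      = fun s => χ s * (mu ε ξ * ψ (shear (T - t) (x, ξ))) := by
    funext s
    have e3 : ((t, x, ξ) + (s - t) • (1, ξ, 0) : ℝ × V3 × V3) = (s, x + (s - t) • ξ, ξ) := by simp
    have e4 : shear (T - s) (x + (s - t) • ξ, ξ) = shear (T - t) (x, ξ) := by
      change (x + (s - t) • ξ + (T - s) • ξ, ξ) = (x + (T - t) • ξ, ξ)
      rw [add_assoc, ← add_smul]
      congr 3; ring
    rw [Function.comp_apply, e3, charTest, e4]
  rw [e2] at h2
  have h3 := ((hχ.differentiable one_ne_zero t).hasDerivAt).mul_const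
    (mu ε ξ * ψ (shear (T - t) (x, ξ)))
  have h4 := h2.unique h3
  simp only [sub_self, zero_smul, add_zero] at h4
  rw [h4]; rfl

/-! ### The weighted energy -/

theorem ContinuousInL2.wt_inv_mul {F : ℝ → V3 × V3 → ℝ} (hF : ContinuousInL2 phase F) :
    ContinuousInL2 phase fun t z => (wt z.2)⁻¹ * F t z := by
  have := measurable_wt
  refine hF.mul_bdd (m := fun z : V3 × V3 => (wt z.2)⁻¹) (by fun_prop) (c := 1) (ae_of_all _ fun z => ?_)
  rw [abs_of_nonneg (inv_nonneg.2 (wt_pos _).le)]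
  exact inv_le_one_of_one_le₀ (by unfold wt; linarith [norm_nonneg z.2])

theorem ContinuousInL2.mu_mul {ε : ℝ} (hε : 0 < ε) {F : ℝ → V3 × V3 → ℝ}
    (hF : ContinuousInL2 phase fun t z => (wt z.2)⁻¹ * F t z) :
    ContinuousInL2 phase fun t z => mu ε z.2 * F t z := by
  have h1 := measurable_wt
  have h2 := measurable_mu ε
  have h := hF.mul_bdd (m := fun z : V3 × V3 => wt z.2 * mu ε z.2) (by fun_prop) (c := 1 + ε⁻¹)
    (ae_of_all _ fun z => by
      rw [abs_of_nonneg (mul_nonneg (wt_pos _).le (mu_pos _ _).le)]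
      exact wt_mul_mu_le hε _)
  convert h using 3 with t z
  have := (wt_pos z.2).ne'
  field_simp

/-- A weak solution `w` of `(∂_t + ξ · ∇_x) w = S` on the half-space, with vanishing incoming data:
`⟨ξ⟩⁻¹ S ∈ C(ℝ; L²)` is enough for the equation to make sense. -/
structure WeakTransport (w S : ℝ → V3 → V3 → ℝ) : Prop where
  cont : ContinuousInL2 phase fun t z => w t z.1 z.2
  cont_source : ContinuousInL2 phase fun t z => (wt z.2)⁻¹ * S t z.1 z.2
  weak : ∀ ψ : ℝ × V3 × V3 → ℝ, IsTest ψ →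
    pairing w (fun z => fderiv ℝ ψ z (1, 0, 0)) + pairing w (fun z => fderiv ℝ ψ z (0, z.2.2, 0))
      + pairing S ψ = 0

section Energy

variable {w S : ℝ → V3 → V3 → ℝ} {ε : ℝ}

/-- The curve `μ w` in `L²(ℝ³ × ℝ³)`, extended by zero. -/
def WeakTransport.f (h : WeakTransport w S) (hε : 0 < ε) : ℝ → WholeL2 :=
  (ContinuousInL2.mu_mul hε h.cont.wt_inv_mul).indicator.curve

/-- The curve `μ S` in `L²(ℝ³ × ℝ³)`, extended by zero. -/
def WeakTransport.p (h : WeakTransport w S) (hε : 0 < ε) : ℝ → WholeL2 :=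
  (ContinuousInL2.mu_mul hε h.cont_source).indicator.curve

theorem WeakTransport.continuous_f (h : WeakTransport w S) (hε : 0 < ε) : Continuous (h.f hε) :=
  ContinuousInL2.continuous_curve _

theorem WeakTransport.continuous_p (h : WeakTransport w S) (hε : 0 < ε) : Continuous (h.p hε) :=
  ContinuousInL2.continuous_curve _

/-- Duhamel's formula, tested with a function that vanishes near the boundary. -/
theorem WeakTransport.inner_sub_eq (h : WeakTransport w S) (hε : 0 < ε) {ψ : V3 × V3 → ℝ}
    (hψ : ContDiff ℝ 1 ψ) (hψs : HasCompactSupport ψ) (hψh : tsupport ψ ⊆ halfPhase)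
    (hψ2 : MemLp ψ 2 volume) {t T : ℝ} (ht : t ≤ T) :
    (inner ℝ (h.f hε T) (hψ2.toLp ψ) : ℝ) - inner ℝ (h.f hε t) (transport (T - t) (hψ2.toLp ψ))
      = ∫ s in t..T, (inner ℝ (h.p hε s) (transport (T - s) (hψ2.toLp ψ)) : ℝ) := by
  have hT : Continuous fun s => transport (T - s) (hψ2.toLp ψ) :=
    Continuous.transport (by fun_prop) continuous_const
  have key := sub_eq_integral_of_weak_deriv (T := T)
    (a := fun s => (inner ℝ (h.f hε s) (transport (T - s) (hψ2.toLp ψ)) : ℝ))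
    (b := fun s => (inner ℝ (h.p hε s) (transport (T - s) (hψ2.toLp ψ)) : ℝ))
    ((h.continuous_f hε).inner hT) ((h.continuous_p hε).inner hT) (fun χ hχ hχs hχT => ?_) ht
  · rw [sub_self, transport_zero] at key
    exact key
  have hΨ := isTest_charTest (ε := ε) (T := T) hχ hχs hχT hψ hψs hψh
  have hw := h.weak _ hΨ
  have hc1 : Continuous (fderiv ℝ (charTest ε T χ ψ)) := hΨ.contDiff.continuous_fderiv one_ne_zero
  have hs1 : HasCompactSupport (fderiv ℝ (charTest ε T χ ψ)) := hΨ.compact.fderiv ℝ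
  have hsup : ∀ v : ℝ × V3 × V3 → ℝ × V3 × V3,
      HasCompactSupport fun z => fderiv ℝ (charTest ε T χ ψ) z (v z) := fun v =>
    hs1.mono fun z hz h0 => hz (by
      change fderiv ℝ (charTest ε T χ ψ) z (v z) = 0
      rw [h0]; rfl)
  rw [← pairing_add_right h.cont.wt_inv_mul (by fun_prop) (hsup _) (by fun_prop) (hsup _)] at hw
  simp_rw [fderiv_charTest hχ hψ] at hw
  have e : ∀ (F : ℝ → V3 → V3 → ℝ) (hF : ContinuousInL2 phase fun t z => mu ε z.2 * F t z.1 z.2)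
      (χ : ℝ → ℝ), pairing F (charTest ε T χ ψ)
      = ∫ s, χ s * (inner ℝ (hF.indicator.curve s) (transport (T - s) (hψ2.toLp ψ)) : ℝ) := by
    intro F hF χ
    refine integral_congr_ae (ae_of_all _ fun s => ?_)
    simp only
    rw [inner_indicator_curve_transport hF, ← integral_const_mul]
    refine integral_congr_ae (ae_of_all _ fun z => ?_)
    change F s z.1 z.2 * (χ s * (mu ε z.2 * ψ (shear (T - s) z))) = _
    ring
  rw [e w (ContinuousInL2.mu_mul hε h.cont.wt_inv_mul), e S (ContinuousInL2.mu_mul hε h.cont_source)]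
    at hw
  exact hw

end Energy

variable {G : Gas}

/-! ### The energy inequality -/

section Energy

variable {w S : ℝ → V3 → V3 → ℝ} {ε : ℝ}

theorem WeakTransport.continuous_transport_p (h : WeakTransport w S) (hε : 0 < ε) (T : ℝ) :
    Continuous fun s => transport (s - T) (h.p hε s) :=
  Continuous.transport (by fun_prop) (h.continuous_p hε)

theorem integral_inner_left {v : ℝ → WholeL2} (hv : Continuous v) (g : WholeL2) (t T : ℝ) :
    ∫ s in t..T, (inner ℝ (v s) g : ℝ) = inner ℝ (∫ s in t..T, v s) g := by
  rw [real_inner_comm, ← innerSL_apply_apply ℝ, ← ContinuousLinearMap.intervalIntegral_comp_comm _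
    (hv.intervalIntegrable t T)]
  exact intervalIntegral.integral_congr fun s _ => real_inner_comm _ _

/-- Duhamel's formula on the half-space, tested with the solution itself at the final time. -/
theorem WeakTransport.inner_self_eq (h : WeakTransport w S) (hε : 0 < ε) {t T : ℝ} (ht : t ≤ T) :
    (inner ℝ (h.f hε T) (h.f hε T) : ℝ) = inner ℝ (transport (t - T) (h.f hε t)) (h.f hε T)
      + ∫ s in t..T, (inner ℝ (transport (s - T) (h.p hε s)) (h.f hε T) : ℝ) := by
  set v : WholeL2 := h.f hε T - transport (t - T) (h.f hε t)
    - ∫ s in t..T, transport (s - T) (h.p hε s) with hv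
  have hpc := h.continuous_transport_p hε T
  have hv0 : ∀ᵐ z, z ∈ halfPhase → v z = 0 := by
    refine isOpen_halfPhase.ae_eq_zero_of_integral_contDiff_smul_eq_zero
      (((Lp.memLp v).locallyIntegrable (by norm_num)).locallyIntegrableOn _) fun ψ hψ hψs hψh => ?_
    have hψ2 : MemLp ψ 2 volume := hψ.continuous.memLp_of_hasCompactSupport hψs
    have hψ1 : ContDiff ℝ 1 ψ := hψ.of_le (by exact_mod_cast le_top)
    have e : ∫ z, ψ z • v z = inner ℝ v (hψ2.toLp ψ) := by
      rw [L2_inner_eq]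
      refine integral_congr_ae ?_
      filter_upwards [hψ2.coeFn_toLp] with z hz
      rw [hz, smul_eq_mul, mul_comm]
    have key := h.inner_sub_eq hε hψ1 hψs hψh hψ2 ht
    simp only [inner_transport, neg_sub] at key
    rw [integral_inner_left hpc] at key
    rw [e, hv, inner_sub_left, inner_sub_left, key, sub_self]
  have hvf : (inner ℝ v (h.f hε T) : ℝ) = 0 := by
    rw [L2_inner_eq]
    refine integral_eq_zero_of_ae ?_
    filter_upwards [hv0, ContinuousInL2.curve_ae
      (ContinuousInL2.mu_mul hε h.cont.wt_inv_mul).indicator T] with z z1 z2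
    change v z * h.f hε T z = 0
    by_cases hz : z ∈ halfPhase
    · rw [z1 hz, zero_mul]
    · rw [WeakTransport.f, z2, Set.indicator_of_notMem hz, mul_zero]
  rw [hv, inner_sub_left, inner_sub_left] at hvf
  rw [integral_inner_left hpc]
  linarith

/-- Duhamel's formula and the isometry of the free transport. -/
theorem WeakTransport.energy_sub_le (h : WeakTransport w S) (hε : 0 < ε) {t T : ℝ} (ht : t ≤ T) :
    ‖h.f hε T‖ ^ 2 - ‖h.f hε t‖ ^ 2
      ≤ 2 * ∫ s in t..T, (inner ℝ (transport (s - T) (h.p hε s)) (h.f hε T) : ℝ) := by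
  have h1 := h.inner_self_eq hε ht
  have h2 := real_inner_le_norm (transport (t - T) (h.f hε t)) (h.f hε T)
  rw [LinearIsometry.norm_map] at h2
  rw [real_inner_self_eq_norm_sq] at h1
  nlinarith [sq_nonneg (‖h.f hε T‖ - ‖h.f hε t‖)]

/-- A weak solution on the whole time axis that is bounded and dissipative vanishes: its energy
decays exponentially from every earlier time on. -/
theorem WeakTransport.f_eq_zero (h : WeakTransport w S) (hε : 0 < ε) {c : ℝ} (hc : 0 < c)
    (hdiss : ∀ t, (inner ℝ (h.p hε t) (h.f hε t) : ℝ) ≤ -(c * ‖h.f hε t‖ ^ 2)) {M : ℝ}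
    (hM : ∀ t, ‖h.f hε t‖ ^ 2 ≤ M) (t : ℝ) : h.f hε t = 0 := by
  have hfc := h.continuous_f hε
  -- time is reversed, because the energy inequality controls left difference quotients
  have gr : ∀ b, -t ≤ b → -‖h.f hε (-b)‖ ^ 2
      ≤ gronwallBound (-‖h.f hε t‖ ^ 2) (2 * c) 0 (b - -t) := by
    intro b hb
    refine le_gronwallBound_of_liminf_deriv_right_le (f := fun s => -‖h.f hε (-s)‖ ^ 2)
      (f' := fun s => 2 * inner ℝ (h.p hε (-s)) (h.f hε (-s))) (a := -t) (b := b)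
      (Continuous.continuousOn (by fun_prop)) (fun x _ r hr => ?_) (by simp) (fun x _ => ?_) b ⟨hb, le_rfl⟩
    · refine Eventually.frequently ?_
      set q : ℝ → ℝ := fun s => (inner ℝ (transport (s - -x) (h.p hε s)) (h.f hε (-x)) : ℝ) with hq
      have hqc : Continuous q := (h.continuous_transport_p hε (-x)).inner continuous_const
      have hq0 : q (-x) = inner ℝ (h.p hε (-x)) (h.f hε (-x)) := by
        simp only [hq]; rw [sub_self, transport_zero]
      have hr' : 2 * q (-x) < r := by rw [hq0]; exact hr
      obtain ⟨r', hr1, hr2⟩ := exists_between hr'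
      obtain ⟨d, hd, hdq⟩ := Metric.eventually_nhds_iff.1
        (((continuous_const.mul hqc).tendsto (-x)).eventually_lt_const hr1)
      filter_upwards [Ioo_mem_nhdsGT (show x < x + d by linarith)] with z hz
      have hzx : 0 < z - x := sub_pos.2 hz.1
      have h1 := h.energy_sub_le hε (neg_le_neg hz.1.le)
      have h2 : ∫ s in -z..-x, q s ≤ ∫ _ in -z..-x, r' / 2 := by
        refine intervalIntegral.integral_mono_on (neg_le_neg hz.1.le) (hqc.intervalIntegrable _ _)
          (continuous_const.intervalIntegrable _ _) fun s hs => ?_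
        have : dist s (-x) < d := by
          rw [Real.dist_eq, abs_lt]; constructor <;> linarith [hs.1, hs.2, hz.2]
        have h3 : 2 * q s < r' := hdq this
        change q s ≤ r' / 2
        linarith
      rw [intervalIntegral.integral_const, smul_eq_mul] at h2
      rw [inv_mul_lt_iff₀ hzx]
      simp only [hq] at h2
      nlinarith
    · have := hdiss (-x)
      change 2 * inner ℝ (h.p hε (-x)) (h.f hε (-x)) ≤ 2 * c * (-‖h.f hε (-x)‖ ^ 2) + 0
      linarith
  by_contra hne
  have hpos : 0 < ‖h.f hε t‖ ^ 2 := by positivity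
  obtain ⟨n, hn⟩ := exists_nat_gt (M / (‖h.f hε t‖ ^ 2 * (2 * c)))
  have g := gr (-t + n) (by linarith [Nat.cast_nonneg (α := ℝ) n])
  rw [gronwallBound_ε0, show -t + (n : ℝ) - -t = n by ring] at g
  have hb := hM (-(-t + n))
  rw [div_lt_iff₀ (by positivity)] at hn
  have hexp := Real.add_one_le_exp (2 * c * n)
  nlinarith

end Energy

variable {G : Gas}

/-! ### The equation for the difference of two solutions -/

theorem VelBound.add {β : ℝ} {A A' : ℝ≥0∞} {h k : V3 × V3 → ℝ} (hh : VelBound β A h)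
    (hk : VelBound β A' k) : VelBound β (A + A') fun z => h z + k z := by
  have m1 := hh.meas
  have m2 := hk.meas
  refine ⟨by fun_prop, ?_⟩
  filter_upwards [hh.le, hk.le] with z z1 z2
  rw [add_mul]
  exact (enorm_add_le _ _).trans (add_le_add z1 z2)

theorem abs_exp_neg_le_one {σ : ℝ} (hσ : 0 < σ) :
    ∀ᵐ z ∂phase, |Real.exp (-(σ * z.1 0))| ≤ 1 := by
  refine ae_phase_of_ae (ae_of_all _ fun z hz => ?_)
  rw [abs_of_pos (Real.exp_pos _), Real.exp_le_one_iff]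
  have := mul_pos hσ hz
  linarith

/-- The coefficient `e^{-σ x₁} (k₁ + k₂) / 2`, which factorizes a difference of quadratic terms. -/
def meanDamped (σ : ℝ) (k₁ k₂ : V3 × V3 → ℝ) (z : V3 × V3) : ℝ :=
  Real.exp (-(σ * z.1 0)) / 2 * (k₁ z + k₂ z)

theorem VelBound.meanDamped {β σ : ℝ} (hσ : 0 < σ) {A : ℝ≥0∞} {k₁ k₂ : V3 × V3 → ℝ}
    (h₁ : VelBound β A k₁) (h₂ : VelBound β A k₂) : VelBound β A (meanDamped σ k₁ k₂) := by
  have m1 := h₁.meas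
  have m2 := h₂.meas
  have hm0 : Measurable fun x : V3 => x 0 := by fun_prop
  refine ⟨by unfold HalfSpaceBoltzmann.meanDamped; fun_prop, ?_⟩
  filter_upwards [h₁.le, h₂.le, abs_exp_neg_le_one hσ] with z z1 z2 z3
  have e : ‖Real.exp (-(σ * z.1 0)) / 2‖ₑ ≤ 2⁻¹ := by
    rw [← ofReal_norm, Real.norm_eq_abs, abs_div, abs_of_pos (two_pos : (0 : ℝ) < 2)]
    refine (ENNReal.ofReal_le_ofReal (div_le_div_of_nonneg_right z3 two_pos.le)).trans ?_
    rw [one_div, ENNReal.ofReal_inv_of_pos two_pos]; simp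
  rw [HalfSpaceBoltzmann.meanDamped, enorm_mul]
  calc _ ≤ 2⁻¹ * (A * ENNReal.ofReal (wt z.2 ^ (-β)) + A * ENNReal.ofReal (wt z.2 ^ (-β))) :=
        mul_le_mul' e ((enorm_add_le _ _).trans (add_le_add z1 z2))
    _ = A * ENNReal.ofReal (wt z.2 ^ (-β)) := by
        rw [← two_mul, ← mul_assoc, ENNReal.inv_mul_cancel (by norm_num) (by norm_num), one_mul]

theorem Gas.Admissible.gamX_sub_right (hG : G.Admissible) {h k k' : V3 × V3 → ℝ} (hh : Measurable h)
    (hk : Measurable k) (hk' : Measurable k') {z : V3 × V3} (h1 : G.gAbsX h (k - k') z < ⊤)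
    (h2 : G.gAbsX h k' z < ⊤) : G.gamX h (k - k') z = G.gamX h k z - G.gamX h k' z := by
  have := hG.gamX_add_right hh (hk.sub hk') hk' h1 h2
  rw [sub_add_cancel] at this
  rw [this, add_sub_cancel_right]

theorem Gas.gAbsX_comm (h k : V3 × V3 → ℝ) (z : V3 × V3) : G.gAbsX h k z = G.gAbsX k h z :=
  Gas.gAbs_comm _ _ _

/-- All terms of the equation that depend on the unknown `k`, except the transport term; `b` is the
background. -/
def Gas.force (G : Gas) (σ : ℝ) (b k : V3 × V3 → ℝ) (z : V3 × V3) : ℝ :=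
  (σ * z.2 0 * k z + G.Lin (fun v => k (z.1, v)) z.2)
    + (Real.exp (-(σ * z.1 0)) * G.gamX k k z + 2 * G.gamX b k z)

theorem Gas.Admissible.force_sub (hG : G.Admissible) {β σ : ℝ} (hβ : 2 < β) (hσ : 0 < σ)
    {A : ℝ≥0∞} (hA : A < ⊤) {b k₁ k₂ : V3 × V3 → ℝ} (hb : VelBound β A b) (h₁ : VelBound β A k₁)
    (h₂ : VelBound β A k₂) (hk₁ : MemLp k₁ 2 phase) (hk₂ : MemLp k₂ 2 phase) :
    ∀ᵐ z ∂phase, G.force σ b k₁ z - G.force σ b k₂ z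
      = σ * z.2 0 * (k₁ - k₂) z + G.Lin (fun v => (k₁ - k₂) (z.1, v)) z.2
        + 2 * G.gamX (fun z => meanDamped σ k₁ k₂ z + b z) (k₁ - k₂) z := by
  have m1 := h₁.meas
  have m2 := h₂.meas
  have mb := hb.meas
  have mw : Measurable (k₁ - k₂) := m1.sub m2
  have hw2 : MemLp (k₁ - k₂) 2 phase := hk₁.sub hk₂
  have hd := VelBound.meanDamped hσ h₁ h₂
  have md := hd.meas
  obtain ⟨A', hA', hW⟩ := hG.velBound_rho_w0 β
  have mW := hW.meas
  filter_upwards [hG.gAbsX_lt_top hβ hA' hW mw hw2, hG.gAbsX_lt_top hβ hA' hW m2 hk₂,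
    hG.gAbsX_lt_top hβ hA hb mw hw2, hG.gAbsX_lt_top hβ hA hb m2 hk₂,
    hG.gAbsX_lt_top hβ hA hd mw hw2, hG.gAbsX_lt_top hβ hA h₁ mw hw2,
    hG.gAbsX_lt_top hβ hA h₂ mw hw2, hG.gAbsX_lt_top hβ hA h₁ m2 hk₂,
    hG.gAbsX_lt_top hβ hA h₂ m2 hk₂] with z z1 z2 z3 z4 z5 z6 z7 z8 z9
  have eL : ∀ k : V3 × V3 → ℝ, G.Lin (fun v => k (z.1, v)) z.2
      = 2 * G.gamX (fun z => G.rho * G.w0 z.2) k z := fun k => hG.lin_eq_gam _ _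
  have e1 := hG.gamX_sub_right mW m1 m2 z1 z2
  have e2 := hG.gamX_sub_right mb m1 m2 z3 z4
  have e3 := hG.gamX_sub_right m1 m1 m2 z6 z8
  have e4 := hG.gamX_sub_right m2 m1 m2 z7 z9
  have e5 : G.gamX (k₁ - k₂) (meanDamped σ k₁ k₂ + b) z
      = G.gamX (k₁ - k₂) (meanDamped σ k₁ k₂) z + G.gamX (k₁ - k₂) b z :=
    hG.gamX_add_right mw md mb (by rwa [Gas.gAbsX_comm]) (by rwa [Gas.gAbsX_comm])
  have e6 : G.gamX (k₁ - k₂) (meanDamped σ k₁ k₂) z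
      = Real.exp (-(σ * z.1 0)) / 2 * G.gamX (k₁ - k₂) (k₁ + k₂) z :=
    hG.gam_smul_right (Real.exp (-(σ * z.1 0)) / 2) (fun v => (k₁ - k₂) (z.1, v))
      (fun v => (k₁ + k₂) (z.1, v)) z.2
  have e7 := hG.gamX_add_right mw m1 m2 (z := z) (by rwa [Gas.gAbsX_comm]) (by rwa [Gas.gAbsX_comm])
  have e8 : G.gamX (fun z => meanDamped σ k₁ k₂ z + b z) (k₁ - k₂) z
      = G.gamX (k₁ - k₂) (meanDamped σ k₁ k₂ + b) z := by rw [hG.gamX_comm]; rfl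
  rw [e8, e5, e6, e7, hG.gamX_comm (k₁ - k₂) k₁, hG.gamX_comm (k₁ - k₂) k₂,
    hG.gamX_comm (k₁ - k₂) b, e2, e3, e4, eL (k₁ - k₂), e1, Gas.force, Gas.force, eL, eL,
    hG.gamX_comm k₂ k₁, Pi.sub_apply]
  ring

theorem Gas.Admissible.continuousInL2_linear (hG : G.Admissible) {β : ℝ} (hβ : 2 < β) (σ : ℝ)
    {A : ℝ≥0∞} (hA : A < ⊤) {k : ℝ → V3 × V3 → ℝ} (hk : ∀ t, VelBound β A (k t))
    (hk2 : ContinuousInL2 phase k) :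
    ContinuousInL2 phase fun t z =>
      (wt z.2)⁻¹ * (σ * z.2 0 * k t z + G.Lin (fun v => k t (z.1, v)) z.2) := by
  obtain ⟨A', hA', hW⟩ := hG.velBound_rho_w0 β
  have hwt := measurable_wt
  have hm0 : Measurable fun x : V3 => x 0 := by fun_prop
  have h1 := hG.continuousInL2_gamX hβ (A := A + A') (by simp [hA, hA'])
    (h := fun _ z => G.rho * G.w0 z.2) (k := k) (fun t => hW.mono le_add_self)
    (fun t => (hk t).mono le_self_add) hk2
    ⟨fun t => by simp, fun t => by simp⟩
  have h2 := hk2.mul_bdd (m := fun z : V3 × V3 => σ * z.2 0 * (wt z.2)⁻¹) (by fun_prop) (c := |σ|)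
    (ae_of_all _ fun z => by
      rw [mul_assoc, abs_mul, abs_mul, abs_of_nonneg (inv_nonneg.2 (wt_pos z.2).le)]
      refine mul_le_of_le_one_right (abs_nonneg _) ?_
      rw [← div_eq_mul_inv, div_le_one (wt_pos _)]
      exact abs_coord_le_wt _ _)
  have h3 := h1.mul_bdd (m := fun _ => (2 : ℝ)) measurable_const (c := 2) (ae_of_all _ fun z => by simp)
  have h4 := h2.add h3
  convert h4 using 3 with t z
  rw [hG.lin_eq_gam]
  change _ = _ + 2 * ((wt z.2)⁻¹ * G.Gam (fun v => G.rho * G.w0 v) (fun v => k t (z.1, v)) z.2)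
  ring

theorem Gas.Admissible.continuousInL2_quadratic (hG : G.Admissible) {β : ℝ} (hβ : 2 < β) {σ : ℝ}
    (hσ : 0 < σ) {A : ℝ≥0∞} (hA : A < ⊤) {b k : ℝ → V3 × V3 → ℝ} (hb : ∀ t, VelBound β A (b t))
    (hb2 : ContinuousInL2 phase fun t z => b t z - b 0 z) (hk : ∀ t, VelBound β A (k t))
    (hk2 : ContinuousInL2 phase k) :
    ContinuousInL2 phase fun t z =>
      (wt z.2)⁻¹ * (Real.exp (-(σ * z.1 0)) * G.gamX (k t) (k t) z + 2 * G.gamX (b t) (k t) z) := by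
  have hm0 : Measurable fun x : V3 => x 0 := by fun_prop
  have h0 : ContinuousInL2 phase fun t z => k t z - k 0 z := by
    refine ⟨fun t => (hk2.1 t).sub (hk2.1 0), fun t₀ => ?_⟩
    simpa using hk2.2 t₀
  have h1 := (hG.continuousInL2_gamX hβ hA hk hk hk2 h0).mul_bdd
    (m := fun z => Real.exp (-(σ * z.1 0))) (by fun_prop) (abs_exp_neg_le_one hσ)
  have h2 := (hG.continuousInL2_gamX hβ hA hb hk hk2 hb2).mul_bdd
    (m := fun _ => (2 : ℝ)) measurable_const (c := 2) (ae_of_all _ fun z => by simp)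
  convert h1.add h2 using 3 with t z
  ring

/-- The dissipation of the weighted energy, integrated over the half-space. -/
theorem dissipation_le {β σ c ε η : ℝ}
    (hfib : ∀ h w : V3 → ℝ, Measurable h → Measurable w → ∫⁻ ξ, ‖w ξ‖ₑ ^ 2 < ⊤ →
        (∀ᵐ ξ, ‖h ξ‖ₑ ≤ ENNReal.ofReal η * ENNReal.ofReal (wt ξ ^ (-β))) →
        ∫ ξ, mu ε ξ * w ξ * (mu ε ξ * (σ * ξ 0 * w ξ + G.Lin w ξ + 2 * G.Gam h w ξ))
          ≤ - (c * ∫ ξ, (mu ε ξ * w ξ) ^ 2))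
    {h w s : V3 × V3 → ℝ} (hh : VelBound β (ENNReal.ofReal η) h) (hw : Measurable w)
    (hw2 : MemLp w 2 phase)
    (hs : ∀ᵐ z ∂phase, s z = σ * z.2 0 * w z + G.Lin (fun v => w (z.1, v)) z.2 + 2 * G.gamX h w z)
    (hi : Integrable (fun z => mu ε z.2 * s z * (mu ε z.2 * w z)) phase)
    (hi2 : Integrable (fun z => mu ε z.2 * w z * (mu ε z.2 * w z)) phase) :
    ∫ z, mu ε z.2 * s z * (mu ε z.2 * w z) ∂phase
      ≤ -(c * ∫ z, mu ε z.2 * w z * (mu ε z.2 * w z) ∂phase) := by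
  have mh := hh.meas
  have hae : (fun z => mu ε z.2 * s z * (mu ε z.2 * w z)) =ᵐ[phase] fun z => mu ε z.2 * w z *
      (mu ε z.2 * (σ * z.2 0 * w z + G.Lin (fun v => w (z.1, v)) z.2
        + 2 * G.Gam (fun v => h (z.1, v)) (fun v => w (z.1, v)) z.2)) := by
    filter_upwards [hs] with z hz
    rw [hz, Gas.gamX]; ring
  have hi3 := hi.congr hae
  rw [integral_congr_ae hae]
  have hfin : ∀ᵐ x ∂(volume.restrict {x : V3 | 0 < x 0}), ∫⁻ ξ, ‖w (x, ξ)‖ₑ ^ 2 < ⊤ := by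
    have h1 := lintegral_lt_top_of_memLp_two hw2
    rw [lintegral_phase (by fun_prop)] at h1
    exact ae_lt_top (by fun_prop) h1.ne
  have hsl := ae_slice hh.le
  rw [phase_eq_prod] at hi2 hi3 ⊢
  rw [integral_prod _ hi3, integral_prod _ hi2, ← integral_const_mul, ← integral_neg]
  refine integral_mono_ae hi3.integral_prod_left (hi2.integral_prod_left.const_mul c).neg ?_
  filter_upwards [hfin, hsl] with x x1 x2
  have := hfib (fun v => h (x, v)) (fun v => w (x, v)) (by fun_prop) (by fun_prop) x1 x2
  refine this.trans (le_of_eq ?_)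
  simp only [sq]

variable {G : Gas}

/-! ### Uniqueness -/

theorem velBound_of_normX_le {β : ℝ} {A : ℝ≥0∞} {g : ℝ → Lp ℝ 2 phase} (h : normX β g ≤ A) (t : ℝ) :
    VelBound β A (g t) := by
  refine ⟨(Lp.stronglyMeasurable (g t)).measurable, ae_le_of_velSup_le (le_trans ?_ h)⟩
  exact le_add_self.trans (le_iSup (fun t => eLpNorm (g t) 2 phase + velSup phase β (g t)) t)

/-- The inhomogeneous term `H` contributes the same number to both weak formulations and drops out of
their difference. -/
theorem weakTransport_sub {S : Frame} (hS : S.Admissible) {P : Profile} {B : BoundaryData} {σ T : ℝ}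
    (hσ : 0 < σ) {A : ℝ≥0∞} (hA : A < ⊤) {g₁ g₂ : ℝ → Lp ℝ 2 phase}
    (h₁ : IsTimePeriodicSolution S P B σ T g₁) (h₂ : IsTimePeriodicSolution S P B σ T g₂)
    (hb : ∀ t, VelBound S.beta A fun z => B.background S P t z.1 z.2)
    (hb2 : ContinuousInL2 phase fun t z => B.background S P t z.1 z.2 - B.background S P 0 z.1 z.2)
    (hk₁ : ∀ t, VelBound S.beta A (g₁ t)) (hk₂ : ∀ t, VelBound S.beta A (g₂ t)) :
    WeakTransport (fun t x ξ => valAt g₁ t x ξ - valAt g₂ t x ξ) (fun t x ξ =>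
      S.gas.force σ (fun z => B.background S P t z.1 z.2) (g₁ t) (x, ξ)
        - S.gas.force σ (fun z => B.background S P t z.1 z.2) (g₂ t) (x, ξ)) := by
  have hG := hS.gas
  have hβ : 2 < S.beta := by linarith [hS.beta_gt]
  have c₁ := ContinuousInL2.of_Lp h₁.mem.1
  have c₂ := ContinuousInL2.of_Lp h₂.mem.1
  have neg : ∀ {F K : ℝ → V3 × V3 → ℝ}, ContinuousInL2 phase F → ContinuousInL2 phase K →
      ContinuousInL2 phase fun t z => F t z - K t z := fun hF hK => by
    have := hF.add (hK.mul_bdd (m := fun _ => (-1 : ℝ)) measurable_const (c := 1)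
      (ae_of_all _ fun z => by simp))
    simpa only [neg_one_mul, ← sub_eq_add_neg] using this
  have l₁ := hG.continuousInL2_linear hβ σ hA hk₁ c₁
  have l₂ := hG.continuousInL2_linear hβ σ hA hk₂ c₂
  have q₁ := hG.continuousInL2_quadratic hβ hσ hA hb hb2 hk₁ c₁
  have q₂ := hG.continuousInL2_quadratic hβ hσ hA hb hb2 hk₂ c₂
  have f₁ : ContinuousInL2 phase fun t z => (wt z.2)⁻¹ *
      S.gas.force σ (fun z => B.background S P t z.1 z.2) (g₁ t) z := by
    convert l₁.add q₁ using 3 with t z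
    rw [Gas.force]; ring
  have f₂ : ContinuousInL2 phase fun t z => (wt z.2)⁻¹ *
      S.gas.force σ (fun z => B.background S P t z.1 z.2) (g₂ t) z := by
    convert l₂.add q₂ using 3 with t z
    rw [Gas.force]; ring
  refine ⟨neg c₁ c₂, ?_, fun ψ hψ => ?_⟩
  · convert neg f₁ f₂ using 3 with t z
    ring
  have hc := hψ.contDiff.continuous
  have hc1 : Continuous (fderiv ℝ ψ) := hψ.contDiff.continuous_fderiv one_ne_zero
  have hsup : ∀ v : ℝ × V3 × V3 → ℝ × V3 × V3,
      HasCompactSupport fun z => fderiv ℝ ψ z (v z) := fun v =>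
    (hψ.compact.fderiv ℝ).mono fun z hz h0 => hz (by
      change fderiv ℝ ψ z (v z) = 0
      rw [h0]; rfl)
  have w₁ := h₁.weak ψ hψ
  have w₂ := h₂.weak ψ hψ
  have split : ∀ g : ℝ → Lp ℝ 2 phase, (∀ t, VelBound S.beta A (g t)) →
      ContinuousInL2 phase (fun t => (g t : V3 × V3 → ℝ)) → pairing (fun t x ξ =>
        S.gas.force σ (fun z => B.background S P t z.1 z.2) (g t) (x, ξ)) ψ
      = pairing (fun t x ξ => σ * ξ 0 * valAt g t x ξ + S.gas.Lin (valAt g t x) ξ) ψ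
        + pairing (fun t x ξ => Real.exp (-(σ * x 0)) * S.gas.Gam (valAt g t x) (valAt g t x) ξ
            + 2 * S.gas.Gam (B.background S P t x) (valAt g t x) ξ) ψ := fun g hk hg =>
    pairing_add_left (hG.continuousInL2_linear hβ σ hA hk hg)
      (hG.continuousInL2_quadratic hβ hσ hA hb hb2 hk hg) hc hψ.compact
  have diff : ∀ Φ : ℝ × V3 × V3 → ℝ, Continuous Φ → HasCompactSupport Φ →
      pairing (fun t x ξ => valAt g₁ t x ξ - valAt g₂ t x ξ) Φ
        = pairing (valAt g₁) Φ - pairing (valAt g₂) Φ := fun Φ hΦ hs =>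
    pairing_sub_left c₁.wt_inv_mul c₂.wt_inv_mul hΦ hs
  rw [diff _ (by fun_prop) (hsup _), diff _ (by fun_prop) (hsup _),
    pairing_sub_left f₁ f₂ hc hψ.compact, split g₁ hk₁ c₁, split g₂ hk₂ c₂]
  linarith

end HalfSpaceBoltzmann

end

theorem mainTheorem6 (S : HalfSpaceBoltzmann.Frame) (hS : S.Admissible)
    (γ₀ M₀ : ℝ) (hγ₀ : 0 < γ₀) (hM₀ : 0 < M₀) :
    ∃ σ₁ : ℝ, 0 < σ₁ ∧ σ₁ ≤ γ₀ / 2 ∧ ∀ σ : ℝ, 0 < σ → σ ≤ σ₁ →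
      ∃ η₀ : ℝ, 0 < η₀ ∧
        ∀ (T : ℝ), 0 < T →
        ∀ (P : HalfSpaceBoltzmann.Profile), P.Admissible S γ₀ M₀ →
        ∀ (B : HalfSpaceBoltzmann.BoundaryData), B.Admissible S P T →
        ∀ g₁ g₂ : ℝ → MeasureTheory.Lp ℝ 2 HalfSpaceBoltzmann.phase,
          HalfSpaceBoltzmann.IsTimePeriodicSolution S P B σ T g₁ →
          HalfSpaceBoltzmann.IsTimePeriodicSolution S P B σ T g₂ →
          B.delta S P T + HalfSpaceBoltzmann.normX S.beta g₁ ≤ ENNReal.ofReal η₀ →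
          B.delta S P T + HalfSpaceBoltzmann.normX S.beta g₂ ≤ ENNReal.ofReal η₀ →
          g₁ = g₂ := by
  open HalfSpaceBoltzmann in
  have hβ : 2 < S.beta := by linarith [hS.beta_gt]
  obtain ⟨σf, hσf, hfib⟩ := hS.gas.fiber_estimate hβ
  obtain ⟨C, hC0, hC⟩ := hS.exists_cut_le
  refine ⟨min σf (γ₀ / 2), lt_min hσf (by positivity), min_le_right _ _, fun σ hσ hσ1 => ?_⟩
  obtain ⟨c, ε, η, hc, hε, -, hη, hdis⟩ := hfib σ hσ (hσ1.trans (min_le_left _ _))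
  -- `η₀` makes the coefficient of the bilinear term in the difference equation at most `η`
  set η₀ : ℝ := η / (1 + C * (M₀ + 1)) with hη₀d
  have hη₀ : 0 < η₀ := by positivity
  have hsum : η₀ + C * (M₀ + 1) * η₀ = η := by
    rw [hη₀d]; field_simp
  refine ⟨η₀, hη₀, fun T hT P hP B hB g₁ g₂ h₁ h₂ hd₁ hd₂ => ?_⟩
  have hb := fun t => hB.velBound_background hS hP hγ₀ hM₀ hT hC0 hC hη₀.le
    (le_self_add.trans hd₁) t
  have hb2 := hB.continuousInL2_background (P := P) hS
  have k₁ := fun t => velBound_of_normX_le (le_add_self.trans hd₁) t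
  have k₂ := fun t => velBound_of_normX_le (le_add_self.trans hd₂) t
  have hAe : ENNReal.ofReal η₀ + ENNReal.ofReal (C * (M₀ + 1) * η₀) = ENNReal.ofReal η := by
    rw [← ENNReal.ofReal_add hη₀.le (by positivity), hsum]
  have hle1 : ENNReal.ofReal η₀ ≤ ENNReal.ofReal η := by rw [← hAe]; exact le_self_add
  have hle2 : ENNReal.ofReal (C * (M₀ + 1) * η₀) ≤ ENNReal.ofReal η := by
    rw [← hAe]; exact le_add_self
  have hw := weakTransport_sub hS hσ ENNReal.ofReal_lt_top h₁ h₂ (fun t => (hb t).mono hle2) hb2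
    (fun t => (k₁ t).mono hle1) (fun t => (k₂ t).mono hle1)
  have cw := ContinuousInL2.mu_mul hε hw.cont.wt_inv_mul
  have cs := ContinuousInL2.mu_mul hε hw.cont_source
  have hnorm : ∀ t, ‖hw.f hε t‖ ^ 2
      = ∫ z, mu ε z.2 * (g₁ t z - g₂ t z) * (mu ε z.2 * (g₁ t z - g₂ t z)) ∂phase := fun t => by
    rw [← real_inner_self_eq_norm_sq]
    exact inner_indicator_curve cw cw t t
  have hdiss : ∀ t, (inner ℝ (hw.p hε t) (hw.f hε t) : ℝ) ≤ -(c * ‖hw.f hε t‖ ^ 2) := fun t => by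
    rw [hnorm]
    refine (inner_indicator_curve cs cw t t).le.trans ?_
    refine dissipation_le hdis (h := fun z => meanDamped σ (g₁ t) (g₂ t) z + B.background S P t z.1 z.2)
      (w := (g₁ t : V3 × V3 → ℝ) - g₂ t) (hAe ▸ (VelBound.meanDamped hσ (k₁ t) (k₂ t)).add (hb t))
      ((k₁ t).meas.sub (k₂ t).meas) ((Lp.memLp _).sub (Lp.memLp _))
      (hS.gas.force_sub hβ hσ ENNReal.ofReal_lt_top ((hb t).mono hle2) ((k₁ t).mono hle1)
        ((k₂ t).mono hle1) (Lp.memLp _) (Lp.memLp _)) ?_ ?_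
    · exact cs.integrable_mul cw t
    · exact cw.integrable_mul cw t
  have hper : Function.Periodic (hw.f hε) T := fun t => by
    have e : ∀ z : V3 × V3, mu ε z.2 * (valAt g₁ (t + T) z.1 z.2 - valAt g₂ (t + T) z.1 z.2)
        = mu ε z.2 * (valAt g₁ t z.1 z.2 - valAt g₂ t z.1 z.2) := fun z => by
      rw [valAt, valAt, h₁.periodic, h₂.periodic]; rfl
    refine Lp.ext ((ContinuousInL2.curve_ae _ _).trans (EventuallyEq.trans ?_
      (ContinuousInL2.curve_ae _ _).symm))
    simp only [e]
    rfl
  obtain ⟨M, hM⟩ := (hper.isBounded_of_continuous hT.ne' (hw.continuous_f hε)).exists_norm_le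
  have hzero := hw.f_eq_zero hε hc hdiss (M := M ^ 2) fun t =>
    pow_le_pow_left₀ (norm_nonneg _) (hM _ ⟨t, rfl⟩) 2
  funext t
  have h0 := hzero t
  have hae := ContinuousInL2.curve_ae cw.indicator t
  refine Lp.ext ?_
  refine (ae_restrict_iff' (μ := volume) isOpen_halfPhase.measurableSet).2 ?_
  have hae0 : hw.f hε t =ᵐ[volume] (0 : V3 × V3 → ℝ) := by rw [h0]; exact Lp.coeFn_zero _ _ _
  filter_upwards [hae, hae0] with z z1 z2 hz
  rw [Set.indicator_of_mem hz] at z1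
  have z3 : mu ε z.2 * (g₁ t z - g₂ t z) = 0 := z1.symm.trans z2
  exact sub_eq_zero.1 ((mul_eq_zero.1 z3).resolve_left (mu_pos ε z.2).ne')
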